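/- Let $L>0$ and $\Omega=\mathbb{R}^2\times\mathbb{R}/2\pi L\mathbb{Z}$, with cylindrical coordinates $(r,\theta,z)$. A vector field on $\Omega$ is called helical if its cylindrical components $f=u_r,u_\theta,u_z$ are constant along vertical helices of pitch $2\pi L$, i.e. $f(r,\theta+\alpha,z+L\alpha)=f(r,\theta,z)$ for all $\alpha\in\mathbb{R}$ (up to null sets). All derivatives are taken in the sense of distributions on $\Omega$. Let \[ H=\{v\in (H^1(\Omega))^3 : \operatorname{div} v=0,\ v \text{ helical}\},\qquad \|v\|_{H^1}^2=\|v\|_{L^2}^2+\|\nabla v\|_{L^2}^2, \] \[ u^{LO}(0)=\frac{1}{2\pi r}\bigl(1-e^{-r^2/4}\bigr)e_\theta ,\qquad X=H+a\,u^{LO}(0)\quad (a\in\mathbb{R}), \] and, for $m\in\mathbb{R}$, \[ Y_m=\{w\in (L^2_m(\Omega))^3 : \operatorname{div} w=0,\ w\text{ helical}\},\qquad \|w\|_{L^2_m}^2=\int_\Omega (1+r^2)^m|w|^2\,r\,dr\,d\theta\,dz . \] For every $m>1$ there is a constant $C>0$, depending only on $m$ and $L$, such that the following holds for every $\omega\in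 Y_m$. There is a unique helical vector field $u\in (L^6(\Omega))^3$ with $\operatorname{div}u=0$ and $\operatorname{rot}u=\omega$ (the helical Biot--Savart velocity of $\omega$). With \[ a=\frac{1}{2\pi L}\int_\Omega \omega_z\,r\,dr\,d\theta\,dz \] one has $u=a\,u^{LO}(0)+v$ for some $v\in H$ with $\|v\|_{H^1}\le C\|\omega\|_{L^2_m}$. In particular $u\in X$ (with this value of $a$). -/

import Mathlib

open MeasureTheory
open scoped ENNReal

noncomputable section

namespace HelicalOseen

/-- The vertically periodic domain `Ω = ℝ² × ℝ/2πLℤ`. Its `volume` is the product of Lebesgue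
measure on the plane and of the measure of total mass `2πL` on the circle, i.e. `r dr dθ dz`. -/
abbrev Omega (L : ℝ) : Type := EuclideanSpace ℝ (Fin 2) × AddCircle (2 * Real.pi * L)

/-- The space of values of vector fields, with the Euclidean norm. -/
abbrev Vec : Type := EuclideanSpace ℝ (Fin 3)

instance fact_period_pos (L : ℝ) [hL : Fact (0 < L)] : Fact (0 < 2 * Real.pi * L) :=
  ⟨mul_pos Real.two_pi_pos hL.out⟩

/-- The distance `r` to the vertical axis. -/
def radius {L : ℝ} (p : Omega L) : ℝ := ‖p.1‖

/-- The unit vector `e_r` (the value on the axis `r = 0` is irrelevant). -/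
def eR {L : ℝ} (p : Omega L) : Vec := !₂[p.1 0 / radius p, p.1 1 / radius p, 0]

/-- The unit vector `e_θ` (the value on the axis `r = 0` is irrelevant). -/
def eTheta {L : ℝ} (p : Omega L) : Vec := !₂[-(p.1 1) / radius p, p.1 0 / radius p, 0]

/-- The unit vector `e_z`. -/
def eZ : Vec := !₂[0, 0, 1]

/-! ### Helical symmetry -/

/-- Rotation of the plane by the angle `α`. -/
def rotate (α : ℝ) (x : EuclideanSpace ℝ (Fin 2)) : EuclideanSpace ℝ (Fin 2) :=
  !₂[Real.cos α * x 0 - Real.sin α * x 1, Real.sin α * x 0 + Real.cos α * x 1]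

/-- The screw motion `(r, θ, z) ↦ (r, θ + α, z + L α)`, along vertical helices of pitch `2πL`. -/
def screw (L α : ℝ) (p : Omega L) : Omega L :=
  (rotate α p.1, p.2 + ((L * α : ℝ) : AddCircle (2 * Real.pi * L)))

variable {L : ℝ} [Fact (0 < L)]

/-- A scalar map (up to null sets) is helical if it is constant along vertical helices of
pitch `2πL`: `f (r, θ + α, z + L α) = f (r, θ, z)`. -/
def IsHelicalScalar (f : Omega L → ℝ) : Prop :=
  ∀ α : ℝ, ∀ᵐ p : Omega L, f (screw L α p) = f p

/-- A vector field is helical if its cylindrical components `u_r`, `u_θ`, `u_z` are helical. -/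
def IsHelical (u : Omega L → Vec) : Prop :=
  IsHelicalScalar (fun p => inner ℝ (u p) (eR p)) ∧
  IsHelicalScalar (fun p => inner ℝ (u p) (eTheta p)) ∧
  IsHelicalScalar (fun p => inner ℝ (u p) eZ)

/-! ### Distributional derivatives on `Ω` -/

/-- The one-parameter subgroups of translations of `Ω` along the three coordinate axes. -/
def translation (L : ℝ) (i : Fin 3) (t : ℝ) : Omega L :=
  ![(EuclideanSpace.single 0 t, 0), (EuclideanSpace.single 1 t, 0), (0, (t : AddCircle _))] i

/-- The classical partial derivative `∂_i φ`, with respect to the Cartesian coordinates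
`(x, y, z)`. -/
def partialDeriv (i : Fin 3) (φ : Omega L → ℝ) (p : Omega L) : ℝ :=
  deriv (fun t : ℝ => φ (p + translation L i t)) 0

/-- Test functions: `φ ∈ C_c^∞(Ω)`. Smoothness on `Ω` is smoothness of the lift to `ℝ² × ℝ`. -/
structure IsTest (φ : Omega L → ℝ) : Prop where
  smooth : ContDiff ℝ ((⊤ : ℕ∞) : WithTop ℕ∞)
    (fun q : EuclideanSpace ℝ (Fin 2) × ℝ => φ (q.1, (q.2 : AddCircle (2 * Real.pi * L))))
  compact_support : HasCompactSupport φ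

/-- The distributional derivative `∂_i f`, paired with the test function `φ`. -/
def distDeriv (i : Fin 3) (f φ : Omega L → ℝ) : ℝ :=
  -∫ p, f p * partialDeriv i φ p

/-- `div u = 0` in the sense of distributions on `Ω`. -/
structure IsDivFree (u : Omega L → Vec) : Prop where
  locallyIntegrable : LocallyIntegrable u
  div_eq_zero : ∀ φ : Omega L → ℝ, IsTest φ →
    ∑ i : Fin 3, distDeriv i (fun p => u p i) φ = 0

/-- `rot u = ω` in the sense of distributions on `Ω`. -/
structure HasCurl (u ω : Omega L → Vec) : Prop where
  locallyIntegrable : LocallyIntegrable u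
  locallyIntegrable_curl : LocallyIntegrable ω
  curl_x : ∀ φ : Omega L → ℝ, IsTest φ →
    distDeriv 1 (fun p => u p 2) φ - distDeriv 2 (fun p => u p 1) φ = ∫ p, ω p 0 * φ p
  curl_y : ∀ φ : Omega L → ℝ, IsTest φ →
    distDeriv 2 (fun p => u p 0) φ - distDeriv 0 (fun p => u p 2) φ = ∫ p, ω p 1 * φ p
  curl_z : ∀ φ : Omega L → ℝ, IsTest φ →
    distDeriv 0 (fun p => u p 1) φ - distDeriv 1 (fun p => u p 0) φ = ∫ p, ω p 2 * φ p

/-- `G` is the weak gradient of `v`: `G i = ∂_i v` in the sense of distributions on `Ω`. -/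
structure IsWeakGradient (v : Omega L → Vec) (G : Fin 3 → Omega L → Vec) : Prop where
  locallyIntegrable : LocallyIntegrable v
  locallyIntegrable_grad : ∀ i, LocallyIntegrable (G i)
  eq_grad : ∀ φ : Omega L → ℝ, IsTest φ → ∀ i j : Fin 3,
    distDeriv i (fun p => v p j) φ = ∫ p, G i p j * φ p

/-! ### Function spaces -/

/-- `v ∈ (H¹(Ω))³`. -/
def MemH1 (v : Omega L → Vec) : Prop :=
  MemLp v 2 ∧ ∃ G : Fin 3 → Omega L → Vec, IsWeakGradient v G ∧ ∀ i, MemLp (G i) 2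

/-- The `H¹` norm, `‖v‖²_{H¹} = ‖v‖²_{L²} + ‖∇v‖²_{L²}`. Weak gradients are unique up to null
sets, so that the infimum is over (at most) one value; it is `∞` if there is no weak gradient. -/
def h1Norm (v : Omega L → Vec) : ℝ≥0∞ :=
  ⨅ (G : Fin 3 → Omega L → Vec) (_ : IsWeakGradient v G),
    (eLpNorm v 2 volume ^ 2 + ∑ i, eLpNorm (G i) 2 volume ^ 2) ^ (1 / 2 : ℝ)

/-- The weighted field `(1 + r²)^{m/2} w`. -/
def weighted (m : ℝ) (w : Omega L → Vec) (p : Omega L) : Vec :=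
  (1 + radius p ^ 2) ^ (m / 2) • w p

/-- The weighted norm, `‖w‖²_{L²_m} = ∫_Ω (1 + r²)^m |w|²`. -/
def l2mNorm (m : ℝ) (w : Omega L → Vec) : ℝ≥0∞ := eLpNorm (weighted m w) 2 volume

/-- `w ∈ (L²_m(Ω))³`. -/
def MemL2m (m : ℝ) (w : Omega L → Vec) : Prop := MemLp w 2 ∧ l2mNorm m w < ∞

/-- `Y_m`: the helical divergence-free vector fields in `(L²_m(Ω))³`. -/
structure MemY (m : ℝ) (w : Omega L → Vec) : Prop where
  memL2m : MemL2m m w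
  divFree : IsDivFree w
  helical : IsHelical w

/-- `H`: the helical divergence-free vector fields in `(H¹(Ω))³`. -/
structure MemH (v : Omega L → Vec) : Prop where
  memH1 : MemH1 v
  divFree : IsDivFree v
  helical : IsHelical v

/-- The velocity field of the Lamb-Oseen vortex,
`u^{LO}(t) = (1 / (2πr)) (1 - exp (-r² / (4 (1 + t)))) e_θ`. -/
def oseenVelocity (t : ℝ) (p : Omega L) : Vec :=
  (1 / (2 * Real.pi * radius p) * (1 - Real.exp (-(radius p ^ 2) / (4 * (1 + t))))) • eTheta p

/-- `X = H + a u^{LO}(0)`. -/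
def MemX (a : ℝ) (u : Omega L → Vec) : Prop :=
  ∃ v : Omega L → Vec, MemH v ∧ u =ᵐ[volume] fun p => v p + a • oseenVelocity 0 p

/-- `u` is a velocity field associated with `ω` by the helical Biot-Savart law: a helical field in
`(L⁶(Ω))³` with `div u = 0` and `rot u = ω`. -/
structure IsBiotSavart (ω u : Omega L → Vec) : Prop where
  helical : IsHelical u
  memL6 : MemLp u 6
  divFree : IsDivFree u
  curl : HasCurl u ω

/-- The circulation Reynolds number `a = (1 / (2πL)) ∫_Ω ω_z`. -/
def circulation (ω : Omega L → Vec) : ℝ := 1 / (2 * Real.pi * L) * ∫ p, ω p 2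

end HelicalOseen

end

open HelicalOseen

set_option linter.unusedSectionVars false

/-! The circulation `a` is the only obstruction to a square integrable velocity. Let `g` be the
Gaussian vorticity profile of the Lamb-Oseen vortex, normalised so that `g e_z` has circulation one.
The field `ω' = ω - a g e_z` then has circulation zero, and it suffices to find `v ∈ H` with `rot v
= ω'`, bounded by `ω` in `L²_m`.

It is enough to find some `u ∈ L²` with `rot u = ω'` and a norm bound, with no condition on its
divergence or symmetry. Removing the gradient part (`exists_divFree_of_hasCurl`) keeps the curl and
does not increase the norm. The identity `Δv = -rot ω'` then gives `v ∈ H¹ ∩ L⁶`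
(`exists_weakGradient_of_lap`). Moreover `v` is helical, because each screw motion carries it to an
`L²` field with the same divergence and curl. Uniqueness, here and in `L⁶`, comes from a Liouville
theorem (`ae_eq_zero_of_lap`): pairing an `L^p` solution of `Δf = c f`, `c ≥ 0`, with translates of
a test function gives a classical solution that decays away from the axis, and the maximum principle
applies to it.

To construct `u`, write `⟨·⟩` for the vertical average and `P` for the mean-free vertical primitive,
and split `ω' = (ω - ⟨ω_z⟩ e_z) + (⟨ω_z⟩ - a g) e_z`. The first term is the curl of `(P ω_y, -P ω_x,
k)`, where `∂_x k = -⟨ω_y⟩` and `∂_y k = ⟨ω_x⟩`. Such a `k` exists because `(⟨ω_x⟩, ⟨ω_y⟩)` is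
divergence free; integrating along rays from infinity and using a Hardy inequality bounds `k` by `r
⟨ω⟩` in `L²` (`exists_potential`). In the second term helicity makes `⟨ω_z⟩` radial, since averaging
in `z` turns screw motions into rotations. A radial vorticity `Φ` has the velocity `r h e_θ` with `h
= r⁻² ∫_0^r Φ t dt`. As the total mass of `Φ` vanishes, this is also `-r⁻² ∫_r^∞ Φ t dt`, and a
weighted Hardy inequality with constant `1 / (m - 1)` gives the decay that makes `r h` square
integrable.

The averages, primitives, potentials and disc means are all superpositions `∫ w(s) f ∘ τ_s ds` of
measure-scaling maps, so one application of Minkowski's inequality (`IsSuperposition`) bounds them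
all. -/

namespace HelicalOseen

/-! ### Calculus of smooth and test functions on `Ω` through the covering map -/

variable {L : ℝ}

/-- The horizontal plane. -/
abbrev Plane : Type := EuclideanSpace ℝ (Fin 2)

/-- The covering map `ℝ² × ℝ → Ω`. -/
noncomputable def cover (L : ℝ) (q : Plane × ℝ) : Omega L := (q.1, (q.2 : AddCircle (2 * Real.pi * L)))

/-- The standard basis of `ℝ² × ℝ`. -/
noncomputable def basisVec : Fin 3 → Plane × ℝ :=
  ![(EuclideanSpace.single 0 1, 0), (EuclideanSpace.single 1 1, 0), (0, 1)]

lemma cover_add (q q' : Plane × ℝ) : cover L (q + q') = cover L q + cover L q' := by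
  simp [cover]

/-- Allows continuity to be checked on the lift to `ℝ² × ℝ`, where all differentiation takes place.
-/
lemma isOpenQuotientMap_cover : IsOpenQuotientMap (cover L) := by
  have h := IsOpenQuotientMap.prodMap (IsOpenQuotientMap.id (X := Plane))
    (QuotientAddGroup.isOpenQuotientMap_mk (G := ℝ)
      (N := AddSubgroup.zmultiples (2 * Real.pi * L)))
  exact h

lemma exists_cover (p : Omega L) : ∃ q, cover L q = p := isOpenQuotientMap_cover.surjective p

lemma continuous_cover : Continuous (cover L) := isOpenQuotientMap_cover.continuous

lemma translation_eq_cover (i : Fin 3) (t : ℝ) : translation L i t = cover L (t • basisVec i) := by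
  have h : ∀ j : Fin 2, EuclideanSpace.single j t = t • EuclideanSpace.single j (1 : ℝ) := by
    intro j
    ext k
    simp
  fin_cases i <;> simp [translation, cover, basisVec, ← h]

lemma translation_zero (i : Fin 3) : translation L i 0 = 0 := by
  simp [translation_eq_cover, cover]

lemma continuous_of_comp_cover {X : Type*} [TopologicalSpace X] {φ : Omega L → X}
    (h : Continuous (fun q => φ (cover L q))) : Continuous φ :=
  isOpenQuotientMap_cover.continuous_comp_iff.1 h

/-- A function on `Ω` is smooth if its lift to `ℝ² × ℝ` is. -/
def IsSmooth (φ : Omega L → ℝ) : Prop :=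
  ContDiff ℝ ((⊤ : ℕ∞) : WithTop ℕ∞) (fun q : Plane × ℝ => φ (cover L q))

lemma IsTest.isSmooth {φ : Omega L → ℝ} (h : IsTest φ) : IsSmooth φ := h.smooth

lemma IsSmooth.continuous {φ : Omega L → ℝ} (h : IsSmooth φ) : Continuous φ :=
  continuous_of_comp_cover (ContDiff.continuous h)

lemma IsTest.continuous {φ : Omega L → ℝ} (h : IsTest φ) : Continuous φ := h.isSmooth.continuous

lemma IsSmooth.hasDerivAt_line {φ : Omega L → ℝ} (h : IsSmooth φ) (q w : Plane × ℝ) (t : ℝ) :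
    HasDerivAt (fun t : ℝ => φ (cover L (q + t • w)))
      (fderiv ℝ (fun q => φ (cover L q)) (q + t • w) w) t := by
  have h1 : HasFDerivAt (fun q => φ (cover L q)) _ (q + t • w) :=
    (ContDiff.differentiable h (by simp) (q + t • w)).hasFDerivAt
  have h2 : HasDerivAt (fun t : ℝ => q + t • w) w t := by
    simpa using ((hasDerivAt_id t).smul_const w).const_add q
  exact h1.comp_hasDerivAt t h2

lemma IsSmooth.partialDeriv_cover {φ : Omega L → ℝ} (h : IsSmooth φ) (i : Fin 3) (q : Plane × ℝ) :
    partialDeriv i φ (cover L q) = fderiv ℝ (fun q => φ (cover L q)) q (basisVec i) := by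
  have := (h.hasDerivAt_line q (basisVec i) 0).deriv
  simpa only [partialDeriv, translation_eq_cover, ← cover_add, zero_smul, add_zero] using this

lemma IsSmooth.hasDerivAt {φ : Omega L → ℝ} (h : IsSmooth φ) (i : Fin 3) (p : Omega L) (t : ℝ) :
    HasDerivAt (fun t : ℝ => φ (p + translation L i t))
      (partialDeriv i φ (p + translation L i t)) t := by
  obtain ⟨q, rfl⟩ := exists_cover p
  simp only [translation_eq_cover, ← cover_add, h.partialDeriv_cover]
  exact h.hasDerivAt_line q (basisVec i) t

lemma fderiv_basis_apply (A : Plane × ℝ →L[ℝ] ℝ) (v : Plane × ℝ) :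
    A v = v.1 0 * A (basisVec 0) + v.1 1 * A (basisVec 1) + v.2 * A (basisVec 2) := by
  have : v = v.1 0 • basisVec 0 + v.1 1 • basisVec 1 + v.2 • basisVec 2 := by
    ext i
    · fin_cases i <;> simp [basisVec]
    · simp [basisVec]
  conv_lhs => rw [this]
  simp

/-- Directional derivatives in terms of partial derivatives. -/
lemma IsSmooth.hasDerivAt_curve {φ : Omega L → ℝ} (h : IsSmooth φ) {c : ℝ → Plane × ℝ}
    {c' : Plane × ℝ} {t : ℝ} (hc : HasDerivAt c c' t) :
    HasDerivAt (fun t : ℝ => φ (cover L (c t)))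
      (c'.1 0 * partialDeriv 0 φ (cover L (c t)) + c'.1 1 * partialDeriv 1 φ (cover L (c t)) +
        c'.2 * partialDeriv 2 φ (cover L (c t))) t := by
  have h1 : HasFDerivAt (fun q => φ (cover L q)) _ (c t) :=
    (ContDiff.differentiable h (by simp) (c t)).hasFDerivAt
  have := h1.comp_hasDerivAt t hc
  rw [fderiv_basis_apply] at this
  simp only [h.partialDeriv_cover]
  exact this

lemma IsSmooth.isSmooth_partialDeriv {φ : Omega L → ℝ} (h : IsSmooth φ) (i : Fin 3) :
    IsSmooth (partialDeriv i φ) := by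
  unfold IsSmooth
  simp only [h.partialDeriv_cover]
  exact (ContDiff.fderiv_right h (m := ((⊤ : ℕ∞) : WithTop ℕ∞)) (by simp)).clm_apply contDiff_const

/-- Both sides are values of the second Fréchet derivative of the lift, which is symmetric. -/
lemma IsSmooth.partialDeriv_comm {φ : Omega L → ℝ} (h : IsSmooth φ) (i j : Fin 3) :
    partialDeriv i (partialDeriv j φ) =
      partialDeriv j (partialDeriv i φ) := by
  funext p
  obtain ⟨q, rfl⟩ := exists_cover p
  have key : ∀ i j, partialDeriv i (partialDeriv j φ) (cover L q) =
      fderiv ℝ (fderiv ℝ (fun q => φ (cover L q))) q (basisVec i) (basisVec j) := by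
    intro i j
    rw [(h.isSmooth_partialDeriv j).partialDeriv_cover]
    simp only [h.partialDeriv_cover]
    have hd : DifferentiableAt ℝ (fderiv ℝ (fun q => φ (cover L q))) q :=
      (ContDiff.fderiv_right h (m := ((⊤ : ℕ∞) : WithTop ℕ∞)) (by simp)).differentiable (by simp) q
    rw [fderiv_clm_apply hd (by fun_prop)]
    simp
  rw [key, key]
  have : ContDiffAt ℝ ((⊤ : ℕ∞) : WithTop ℕ∞) (fun q => φ (cover L q)) q := ContDiff.contDiffAt h
  exact this.isSymmSndFDerivAt (by
    simpa [minSmoothness_of_isRCLikeNormedField] using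
      WithTop.coe_le_coe.2 (le_top : (2 : ℕ∞) ≤ ⊤)) _ _

lemma IsTest.isTest_partialDeriv {φ : Omega L → ℝ} (h : IsTest φ) (i : Fin 3) :
    IsTest (partialDeriv i φ) := by
  refine ⟨h.isSmooth.isSmooth_partialDeriv i, h.compact_support.mono' ?_⟩
  intro p hp
  by_contra hn
  apply hp
  have h0 : φ =ᶠ[nhds p] 0 := by
    rwa [← notMem_tsupport_iff_eventuallyEq]
  have hc : Filter.Tendsto (fun t : ℝ => p + translation L i t) (nhds 0) (nhds p) := by
    have : Continuous (fun t : ℝ => p + translation L i t) := by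
      simp only [translation_eq_cover]
      exact continuous_const.add (continuous_cover.comp (by fun_prop))
    have h2 := this.tendsto 0
    rwa [translation_zero, add_zero] at h2
  have : (fun t : ℝ => φ (p + translation L i t)) =ᶠ[nhds 0] fun _ => 0 := hc.eventually h0
  simpa [partialDeriv] using this.deriv_eq

lemma IsSmooth.mul {φ ψ : Omega L → ℝ} (hφ : IsSmooth φ) (hψ : IsSmooth ψ) :
    IsSmooth (fun p => φ p * ψ p) := ContDiff.mul hφ hψ

lemma IsSmooth.mul_test {φ ψ : Omega L → ℝ} (hφ : IsSmooth φ) (hψ : IsTest ψ) :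
    IsTest (fun p => φ p * ψ p) :=
  ⟨hφ.mul hψ.isSmooth, hψ.compact_support.mul_left⟩

lemma isSmooth_const (c : ℝ) : IsSmooth (fun _ : Omega L => c) := contDiff_const

lemma IsTest.const_mul {ψ : Omega L → ℝ} (c : ℝ) (hψ : IsTest ψ) : IsTest (fun p => c * ψ p) :=
  (isSmooth_const c).mul_test hψ

lemma isTest_zero : IsTest (fun _ : Omega L => 0) :=
  ⟨contDiff_const, HasCompactSupport.zero⟩

lemma IsTest.add {φ ψ : Omega L → ℝ} (hφ : IsTest φ) (hψ : IsTest ψ) :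
    IsTest (fun p => φ p + ψ p) :=
  ⟨ContDiff.add hφ.smooth hψ.smooth, hφ.compact_support.add hψ.compact_support⟩

lemma isSmooth_coord (i : Fin 2) : IsSmooth (fun p : Omega L => p.1 i) := by
  unfold IsSmooth
  simp only [cover]
  fun_prop

lemma IsSmooth.partialDeriv_mul {φ ψ : Omega L → ℝ} (hφ : IsSmooth φ) (hψ : IsSmooth ψ)
    (i : Fin 3) (p : Omega L) :
    partialDeriv i (fun p => φ p * ψ p) p =
      partialDeriv i φ p * ψ p + φ p * partialDeriv i ψ p := by
  have := ((hφ.hasDerivAt i p 0).mul (hψ.hasDerivAt i p 0)).deriv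
  simp only [translation_zero, add_zero] at this
  exact this

lemma IsSmooth.partialDeriv_add {φ ψ : Omega L → ℝ} (hφ : IsSmooth φ) (hψ : IsSmooth ψ)
    (i : Fin 3) (p : Omega L) :
    partialDeriv i (fun p => φ p + ψ p) p =
      partialDeriv i φ p + partialDeriv i ψ p := by
  have := ((hφ.hasDerivAt i p 0).add (hψ.hasDerivAt i p 0)).deriv
  simp only [translation_zero, add_zero] at this
  exact this

lemma partialDeriv_const_mul (c : ℝ) (φ : Omega L → ℝ) (i : Fin 3) (p : Omega L) :
    partialDeriv i (fun p => c * φ p) p = c * partialDeriv i φ p := by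
  simp [partialDeriv]

lemma partialDeriv_coord (i : Fin 3) (j : Fin 2) (p : Omega L) :
    partialDeriv i (fun p : Omega L => p.1 j) p = (basisVec i).1 j := by
  have : (fun t : ℝ => (p + translation L i t).1 j) = fun t => p.1 j + t * (basisVec i).1 j := by
    funext t
    simp [translation_eq_cover, cover]
  simp only [partialDeriv, this]
  simp

/-- The homeomorphism `(x, z) ↦ (A x, z) + c` of `Ω`. -/
noncomputable def affineHomeo (A : Plane ≃L[ℝ] Plane) (c : Omega L) : Omega L ≃ₜ Omega L :=
  (A.toHomeomorph.prodCongr (Homeomorph.refl _)).trans (Homeomorph.addRight c)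

lemma affineHomeo_apply (A : Plane ≃L[ℝ] Plane) (c p : Omega L) :
    affineHomeo A c p = (A p.1, p.2) + c := rfl

lemma affineHomeo_cover (A : Plane ≃L[ℝ] Plane) (c q : Plane × ℝ) :
    affineHomeo A (cover L c) (cover L q) = cover L ((A q.1, q.2) + c) := by
  simp [affineHomeo_apply, cover]

lemma IsSmooth.comp_affine {φ : Omega L → ℝ} (h : IsSmooth φ) (A : Plane ≃L[ℝ] Plane)
    (c : Omega L) : IsSmooth (fun p => φ (affineHomeo A c p)) := by
  obtain ⟨c, rfl⟩ := exists_cover c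
  unfold IsSmooth
  simp only [affineHomeo_cover]
  exact ContDiff.comp (g := fun q => φ (cover L q)) h (by fun_prop)

lemma IsTest.comp_affine {φ : Omega L → ℝ} (h : IsTest φ) (A : Plane ≃L[ℝ] Plane)
    (c : Omega L) : IsTest (fun p => φ (affineHomeo A c p)) :=
  ⟨h.isSmooth.comp_affine A c, h.compact_support.comp_homeomorph (affineHomeo A c)⟩

lemma IsSmooth.partialDeriv_comp_affine {φ : Omega L → ℝ} (h : IsSmooth φ)
    (A : Plane ≃L[ℝ] Plane) (c : Omega L) (i : Fin 3) (p : Omega L) :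
    partialDeriv i (fun p => φ (affineHomeo A c p)) p =
      A (basisVec i).1 0 * partialDeriv 0 φ (affineHomeo A c p) +
      A (basisVec i).1 1 * partialDeriv 1 φ (affineHomeo A c p) +
      (basisVec i).2 * partialDeriv 2 φ (affineHomeo A c p) := by
  obtain ⟨c, rfl⟩ := exists_cover c
  obtain ⟨q, rfl⟩ := exists_cover p
  have hc : HasDerivAt (fun t : ℝ => (((A q.1, q.2) + c) + t • ((A (basisVec i).1, (basisVec i).2)) : Plane × ℝ))
      (A (basisVec i).1, (basisVec i).2) 0 := by
    simpa using ((hasDerivAt_id (0 : ℝ)).smul_const (A (basisVec i).1, (basisVec i).2)).const_add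
      ((A q.1, q.2) + c)
  have := (h.hasDerivAt_curve hc).deriv
  simp only [zero_smul, add_zero, ← affineHomeo_cover] at this
  rw [← this]
  unfold partialDeriv
  congr 1
  funext t
  rw [translation_eq_cover, ← cover_add]
  beta_reduce
  rw [affineHomeo_cover]
  congr 2
  ext j <;> simp <;> ring

lemma IsTest.comp_add {φ : Omega L → ℝ} (h : IsTest φ) (c : Omega L) :
    IsTest (fun p => φ (p + c)) :=
  h.comp_affine (ContinuousLinearEquiv.refl ℝ Plane) c

lemma partialDeriv_comp_add (φ : Omega L → ℝ) (c : Omega L) (i : Fin 3) (p : Omega L) :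
    partialDeriv i (fun p => φ (p + c)) p = partialDeriv i φ (p + c) := by
  simp only [partialDeriv]
  congr 1
  funext t
  rw [add_right_comm]

/-! ### Differentiation under the integral and integration by parts -/

section Measure
variable [Fact (0 < L)]

instance : (volume : Measure (Omega L)).IsAddHaarMeasure :=
  inferInstanceAs (Measure.IsAddHaarMeasure
    ((volume : Measure Plane).prod (volume : Measure (AddCircle (2 * Real.pi * L)))))

lemma IsTest.memLp {φ : Omega L → ℝ} (h : IsTest φ) (p : ℝ≥0∞) : MemLp φ p :=
  h.continuous.memLp_of_hasCompactSupport h.compact_support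

lemma LocallyIntegrable.integrable_mul {f φ : Omega L → ℝ} (hf : LocallyIntegrable f)
    (hφ : Continuous φ) (hc : HasCompactSupport φ) : Integrable (fun p => f p * φ p) := by
  simpa [mul_comm] using hf.integrable_smul_left_of_hasCompactSupport hφ hc

lemma IsTest.integrable_mul {f φ : Omega L → ℝ} (h : IsTest φ) (hf : LocallyIntegrable f) :
    Integrable (fun p => f p * φ p) :=
  LocallyIntegrable.integrable_mul hf h.continuous h.compact_support

/-- Differentiation under the integral along a flow. -/
lemma hasDerivAt_integral_flow {f φ ψ : Omega L → ℝ} (hf : LocallyIntegrable f)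
    (hφ : Continuous φ) (hφc : HasCompactSupport φ) (hψ : Continuous ψ) (hψc : HasCompactSupport ψ)
    {Φ : ℝ → Omega L → Omega L} (hΦ : Continuous (Function.uncurry Φ))
    (hinv : ∀ t p, Φ (-t) (Φ t p) = p)
    (hd : ∀ p t, HasDerivAt (fun t => φ (Φ t p)) (ψ (Φ t p)) t) (t₀ : ℝ) :
    HasDerivAt (fun t => ∫ p, f p * φ (Φ t p)) (∫ p, f p * ψ (Φ t₀ p)) t₀ := by
  have hΦt : ∀ t, Continuous (Φ t) := fun t => hΦ.comp (by fun_prop : Continuous fun p => (t, p))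
  -- If `|t - t₀| < 1` and `ψ (Φ t p) ≠ 0`, then `p = Φ (-t) (Φ t p)` lies in the compact set `K`.
  -- Hence `|f| M` restricted to `K` dominates the derivatives for all these `t`.
  let K : Set (Omega L) := Function.uncurry Φ '' (Set.Icc (-t₀ - 1) (-t₀ + 1) ×ˢ tsupport ψ)
  have hK : IsCompact K := (isCompact_Icc.prod hψc).image hΦ
  have hcs : ∀ {χ : Omega L → ℝ}, HasCompactSupport χ → ∀ t, HasCompactSupport (χ ∘ Φ t) := by
    intro χ hχ t
    refine HasCompactSupport.intro (hχ.isCompact.image (hΦt (-t))) ?_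
    intro p hp
    by_contra hne
    exact hp ⟨Φ t p, subset_tsupport _ hne, hinv t p⟩
  obtain ⟨M, hM⟩ := hψ.bounded_above_of_compact_support hψc
  have hbd : Integrable (fun p => K.indicator (fun p => |f p| * M) p) :=
    IntegrableOn.integrable_indicator ((hf.integrableOn_isCompact hK).abs.mul_const M)
      hK.measurableSet
  refine (hasDerivAt_integral_of_dominated_loc_of_deriv_le (F := fun t p => f p * φ (Φ t p))
    (F' := fun t p => f p * ψ (Φ t p)) (Metric.ball_mem_nhds t₀ one_pos)
    (.of_forall fun t => ?_) ?_ ?_ (.of_forall fun p t ht => ?_) hbd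
    (.of_forall fun p t _ => ?_)).2
  · exact hf.aestronglyMeasurable.mul (hφ.comp (hΦt t)).aestronglyMeasurable
  · exact LocallyIntegrable.integrable_mul hf (hφ.comp (hΦt _)) (hcs hφc _)
  · exact hf.aestronglyMeasurable.mul (hψ.comp (hΦt _)).aestronglyMeasurable
  · by_cases hz : ψ (Φ t p) = 0
    · rw [hz, mul_zero, norm_zero]
      refine Set.indicator_nonneg (fun q _ => mul_nonneg (abs_nonneg _) ?_) _
      exact (norm_nonneg _).trans (hM p)
    · have hp : p ∈ K := by
        refine ⟨(-t, Φ t p), ⟨?_, subset_tsupport _ hz⟩, hinv t p⟩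
        rw [Metric.mem_ball, Real.dist_eq, abs_lt] at ht
        constructor <;> linarith [ht.1, ht.2]
      rw [Set.indicator_of_mem hp, norm_mul, Real.norm_eq_abs]
      exact mul_le_mul_of_nonneg_left (hM _) (abs_nonneg _)
  · exact (hd p t).const_mul (f p)

lemma IsTest.hasDerivAt_integral {f φ : Omega L → ℝ} (h : IsTest φ) (hf : LocallyIntegrable f)
    (i : Fin 3) (c : Omega L) (t : ℝ) :
    HasDerivAt (fun t : ℝ => ∫ p, f p * φ (p + (c + translation L i t)))
      (∫ p, f p * partialDeriv i φ (p + (c + translation L i t))) t := by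
  have := hasDerivAt_integral_flow hf (h.comp_add c).continuous (h.comp_add c).compact_support
    ((h.comp_add c).isTest_partialDeriv i).continuous ((h.comp_add c).isTest_partialDeriv i).compact_support
    (Φ := fun t p => p + translation L i t) ?_ ?_ (fun p t => (h.comp_add c).isSmooth.hasDerivAt i p t) t
  · simpa only [partialDeriv_comp_add, add_assoc, add_comm c] using this
  · simp only [Function.uncurry_def, translation_eq_cover]
    exact continuous_snd.add (continuous_cover.comp (by fun_prop))
  · intro t p
    rw [translation_eq_cover, translation_eq_cover, add_assoc, ← cover_add]
    simp [cover]

/-- By invariance of the measure and of `f`, the pairing of `f` with the translates of `φ` along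
this axis is constant; the integral is its derivative. -/
lemma integral_partialDeriv_of_invariant {f φ : Omega L → ℝ} (h : IsTest φ)
    (hf : LocallyIntegrable f) (i : Fin 3) (hi : ∀ t p, f (p + translation L i t) = f p) :
    ∫ p, f p * partialDeriv i φ p = 0 := by
  have := h.hasDerivAt_integral hf i 0 0
  have hc : (fun t : ℝ => ∫ p, f p * φ (p + (0 + translation L i t))) =
      fun _ => ∫ p, f p * φ p := by
    funext t
    rw [← integral_add_right_eq_self (fun p => f p * φ p) (translation L i t)]
    simp [hi]
  rw [hc] at this
  simpa [translation_zero] using this.unique (hasDerivAt_const _ _)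

lemma IsTest.integral_partialDeriv {φ : Omega L → ℝ} (h : IsTest φ) (i : Fin 3) :
    ∫ p, partialDeriv i φ p = 0 := by
  simpa using integral_partialDeriv_of_invariant (f := fun _ => 1) h
    (continuous_const.locallyIntegrable) i (by simp)

end Measure

end HelicalOseen

namespace HelicalOseen

variable {L : ℝ}

lemma enorm_integral_mul_le {α : Type*} [MeasurableSpace α] {μ : Measure α} {f g : α → ℝ}
    {p q : ℝ≥0∞} [ENNReal.HolderConjugate p q] (hf : AEStronglyMeasurable f μ)
    (hg : AEStronglyMeasurable g μ) :
    ‖∫ x, f x * g x ∂μ‖ₑ ≤ eLpNorm f p μ * eLpNorm g q μ := by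
  have h := eLpNorm_smul_le_mul_eLpNorm (p := p) (q := q) (r := 1) hg hf
  rw [eLpNorm_one_eq_lintegral_enorm] at h
  exact (enorm_integral_le_lintegral_enorm _).trans h

/-! ### The maximum principle -/

/-- A positive second derivative would make the point a local minimum as well, so `g` would be
constant nearby and its second derivative zero. -/
lemma second_deriv_nonpos_of_isLocalMax {g g' : ℝ → ℝ} {g'' : ℝ}
    (h1 : ∀ t, HasDerivAt g (g' t) t) (h2 : HasDerivAt g' g'' 0) (hm : IsLocalMax g 0) :
    g'' ≤ 0 := by
  by_contra! hpos
  have hd : deriv g = g' := funext fun t => (h1 t).deriv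
  have hmin : IsLocalMin g 0 := by
    refine isLocalMin_of_deriv_deriv_pos ?_ hm.deriv_eq_zero (h1 0).continuousAt
    rw [hd, h2.deriv]
    exact hpos
  have hc : g =ᶠ[nhds 0] fun _ => g 0 := by
    filter_upwards [hm, hmin] with t ht ht' using le_antisymm ht ht'
  have hc' : g' =ᶠ[nhds 0] fun _ => 0 := by
    have := hc.deriv
    rw [hd] at this
    simpa using this
  have := hc'.deriv_eq
  rw [h2.deriv, deriv_const] at this
  exact hpos.ne' this

lemma norm_sq_line (p : Omega L) (i : Fin 3) (t : ℝ) :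
    ‖(p + translation L i t).1‖ ^ 2 =
      (p.1 0 + t * (basisVec i).1 0) ^ 2 + (p.1 1 + t * (basisVec i).1 1) ^ 2 := by
  rw [EuclideanSpace.norm_sq_eq, Fin.sum_univ_two, translation_eq_cover]
  simp [cover]

/-- If `F p₀ = δ > 0`, perturb to `G = F + ε r²`, with `ε` so small that the added term is at most
`δ / 4` on the cylinder `r ≤ R`. At `r = R` the decay gives `G ≤ 3δ / 4`, so the maximum of `G` over
the cylinder is interior and `F > 0` there. At that point the Laplacian of `G` is `≤ 0`, yet it
equals `c F + 4 ε > 0`. Derivatives enter only along translations, which is what differentiating a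
convolution provides. -/
lemma le_zero_of_laplacian_eq [Fact (0 < L)] {F : Omega L → ℝ} {D1 D2 : Fin 3 → Omega L → ℝ}
    (hF : Continuous F)
    (h1 : ∀ i p t, HasDerivAt (fun t => F (p + translation L i t)) (D1 i (p + translation L i t)) t)
    (h2 : ∀ i p, HasDerivAt (fun t => D1 i (p + translation L i t)) (D2 i p) 0)
    {c : ℝ} (hc : 0 ≤ c) (hD : ∀ p, ∑ i, D2 i p = c * F p)
    (hdecay : ∀ ε : ℝ, 0 < ε → ∃ R : ℝ, ∀ p : Omega L, R ≤ ‖p.1‖ → |F p| ≤ ε) (p₀ : Omega L) :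
    F p₀ ≤ 0 := by
  by_contra! hpos
  obtain ⟨R₀, hR₀⟩ := hdecay (F p₀ / 2) (by positivity)
  obtain ⟨R, hR1, hR2, hR3⟩ : ∃ R, R₀ ≤ R ∧ ‖p₀.1‖ ≤ R ∧ 0 < R :=
    ⟨max R₀ (max ‖p₀.1‖ 1), by simp, by simp, by simp⟩
  set δ := F p₀ with hδ
  set ε := δ / (4 * R ^ 2) with hε
  have hεpos : 0 < ε := by positivity
  have hεR : ε * R ^ 2 = δ / 4 := by rw [hε]; field_simp
  let G : Omega L → ℝ := fun p => F p + ε * ‖p.1‖ ^ 2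
  have hK : IsCompact (Metric.closedBall (0 : Plane) R ×ˢ
      (Set.univ : Set (AddCircle (2 * Real.pi * L)))) :=
    (isCompact_closedBall 0 R).prod isCompact_univ
  obtain ⟨p₁, hp₁, hmax⟩ := hK.exists_isMaxOn (f := G) ⟨p₀, by simpa using hR2⟩
    (by fun_prop)
  have hp₁R : ‖p₁.1‖ ≤ R := by simpa using hp₁
  have hG : δ ≤ G p₁ := by
    have : G p₀ ≤ G p₁ := hmax (by simpa using hR2)
    have h0 : δ ≤ G p₀ := by
      simp only [G, ← hδ]
      nlinarith [sq_nonneg ‖p₀.1‖]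
    exact h0.trans this
  have hsq : ε * ‖p₁.1‖ ^ 2 ≤ δ / 4 := by
    rw [← hεR]
    gcongr
  have hlt : ‖p₁.1‖ < R := by
    by_contra! hge
    have := (le_abs_self _).trans (hR₀ p₁ (hR1.trans hge))
    simp only [G] at hG
    linarith
  have hnhds : ∀ᶠ p in nhds p₁, G p ≤ G p₁ := by
    have : ∀ᶠ p : Omega L in nhds p₁, ‖p.1‖ < R :=
      (by fun_prop : Continuous fun p : Omega L => ‖p.1‖).continuousAt.eventually_lt
        continuousAt_const hlt
    filter_upwards [this] with p hp
    exact hmax (by simpa using hp.le)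
  have key : ∀ i, D2 i p₁ + ε * (2 * (basisVec i).1 0 ^ 2 + 2 * (basisVec i).1 1 ^ 2) ≤ 0 := by
    intro i
    set a := (basisVec i).1 0
    set b := (basisVec i).1 1
    refine second_deriv_nonpos_of_isLocalMax (g := fun t => G (p₁ + translation L i t))
      (g' := fun t => D1 i (p₁ + translation L i t) +
        ε * (2 * (p₁.1 0 + t * a) * a + 2 * (p₁.1 1 + t * b) * b)) (fun t => ?_) ?_ ?_
    · simp only [G, norm_sq_line]
      have e : ∀ x y : ℝ, HasDerivAt (fun t : ℝ => (x + t * y) ^ 2) (2 * (x + t * y) * y) t := by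
        intro x y
        have := (((hasDerivAt_id t).mul_const y).const_add x).pow 2
        exact this.congr_deriv (by simp)
      exact (h1 i p₁ t).add (((e _ _).add (e _ _)).const_mul ε)
    · have e : ∀ x y : ℝ, HasDerivAt (fun t : ℝ => 2 * (x + t * y) * y) (2 * y ^ 2) 0 := by
        intro x y
        have := ((((hasDerivAt_id (0 : ℝ)).mul_const y).const_add x).const_mul 2).mul_const y
        refine this.congr_deriv ?_
        ring
      exact (h2 i p₁).add (((e _ _).add (e _ _)).const_mul ε)
    · have hcont : Filter.Tendsto (fun t : ℝ => p₁ + translation L i t) (nhds 0) (nhds p₁) := by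
        have : Continuous (fun t : ℝ => p₁ + translation L i t) := by
          simp only [translation_eq_cover]
          exact continuous_const.add (continuous_cover.comp (by fun_prop))
        have h2 := this.tendsto 0
        rwa [translation_zero, add_zero] at h2
      have := hcont.eventually hnhds
      unfold IsLocalMax IsMaxFilter
      simpa [translation_zero] using this
  have hsum := add_nonpos (add_nonpos (key 0) (key 1)) (key 2)
  have hD' := hD p₁
  rw [Fin.sum_univ_three] at hD'
  have hFp : 0 < F p₁ := by
    simp only [G] at hG
    linarith
  simp [basisVec] at hsum
  nlinarith [mul_nonneg hc hFp.le]

/-- The classical Laplacian. -/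
noncomputable def lap (φ : Omega L → ℝ) (p : Omega L) : ℝ :=
  ∑ i : Fin 3, partialDeriv i (partialDeriv i φ) p

lemma IsTest.isTest_lap {φ : Omega L → ℝ} (hφ : IsTest φ) : IsTest (lap φ) := by
  have e : lap φ = fun p => (partialDeriv 0 (partialDeriv 0 φ) p +
      partialDeriv 1 (partialDeriv 1 φ) p) + partialDeriv 2 (partialDeriv 2 φ) p := by
    funext p
    simp [lap, Fin.sum_univ_three]
  rw [e]
  have := fun i => (hφ.isTest_partialDeriv i).isTest_partialDeriv i
  exact ((this 0).add (this 1)).add (this 2)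

/-! ### Testing against smooth functions determines a function -/

lemma cover_sub_period (q : Plane × ℝ) (n : ℤ) :
    cover L (q - (0, n • (2 * Real.pi * L))) = cover L q := by
  refine Prod.ext (by simp [cover]) ?_
  have : ((n • (2 * Real.pi * L) : ℝ) : AddCircle (2 * Real.pi * L)) = 0 :=
    (QuotientAddGroup.eq_zero_iff _).2 (AddSubgroup.zsmul_mem _ (AddSubgroup.mem_zmultiples _) n)
  simp only [cover, Prod.snd_sub, AddCircle.coe_sub]
  rw [this, sub_zero]

section
variable [Fact (0 < L)]

/-- Any slab of height one period is a fundamental domain, so integrals on `Ω` can be computed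
upstairs. -/
lemma measurePreserving_cover (t : ℝ) :
    MeasurePreserving (cover L)
      (volume.restrict ((Set.univ : Set Plane) ×ˢ Set.Ioc t (t + 2 * Real.pi * L))) volume := by
  have := (MeasurePreserving.id (volume : Measure Plane)).prod
    (AddCircle.measurePreserving_mk (2 * Real.pi * L) t)
  have h2 : (volume : Measure Plane).prod
      ((volume : Measure ℝ).restrict (Set.Ioc t (t + 2 * Real.pi * L))) =
      (volume : Measure (Plane × ℝ)).restrict
        ((Set.univ : Set Plane) ×ˢ Set.Ioc t (t + 2 * Real.pi * L)) := by
    rw [Measure.volume_eq_prod, ← Measure.prod_restrict, Measure.restrict_univ]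
  rw [h2] at this
  exact this

/-- The section of the covering map with values in the slab `0 < z ≤ 2πL`. -/
noncomputable def slabSection (p : Omega L) : Plane × ℝ :=
  (p.1, (AddCircle.equivIoc (2 * Real.pi * L) 0 p.2 : ℝ))

lemma cover_slabSection (p : Omega L) : cover L (slabSection p) = p := by
  refine Prod.ext rfl ?_
  exact (AddCircle.equivIoc (2 * Real.pi * L) 0).symm_apply_apply p.2

lemma slabSection_cover {q : Plane × ℝ} (hq : q.2 ∈ Set.Ioc 0 (0 + 2 * Real.pi * L)) :
    slabSection (cover L q) = q := by
  refine Prod.ext rfl ?_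
  exact congrArg Subtype.val ((AddCircle.equivIoc (2 * Real.pi * L) 0).apply_symm_apply ⟨q.2, hq⟩)

/-- A compact support inside the open slab keeps a distance `δ` from both faces. The periodic
extension therefore agrees with `ψ` on the larger open strip `-δ < z < T + δ`, and period translates
of this strip cover the whole space, so the extension is smooth across the faces. -/
lemma isTest_of_slab {ψ : Plane × ℝ → ℝ} (hψ : ContDiff ℝ ((⊤ : ℕ∞) : WithTop ℕ∞) ψ)
    (hc : HasCompactSupport ψ)
    (hs : tsupport ψ ⊆ (Set.univ : Set Plane) ×ˢ Set.Ioo 0 (2 * Real.pi * L)) :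
    IsTest (fun p : Omega L => ψ (slabSection p)) := by
  set T := 2 * Real.pi * L with hT
  have hTpos : 0 < T := (fact_period_pos L).out
  obtain ⟨δ, hδ, hδs⟩ : ∃ δ > 0, ∀ q : Plane × ℝ, ψ q ≠ 0 → δ < q.2 ∧ q.2 < T - δ := by
    have hc2 : IsCompact (Prod.snd '' tsupport ψ) := hc.isCompact.image continuous_snd
    have hsub : Prod.snd '' tsupport ψ ⊆ Set.Ioo 0 T := by
      rintro _ ⟨q, hq, rfl⟩
      exact (hs hq).2
    obtain ⟨δ, hδ, hδs⟩ := hc2.exists_cthickening_subset_open isOpen_Ioo hsub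
    refine ⟨δ / 2, by positivity, fun q hq => ?_⟩
    have hmem : q.2 ∈ Prod.snd '' tsupport ψ := ⟨q, subset_tsupport _ hq, rfl⟩
    have h1 : q.2 - δ ∈ Set.Ioo 0 T := by
      refine hδs (Metric.mem_cthickening_of_dist_le _ q.2 _ _ hmem ?_)
      simp [abs_of_pos hδ]
    have h2 : q.2 + δ ∈ Set.Ioo 0 T := by
      refine hδs (Metric.mem_cthickening_of_dist_le _ q.2 _ _ hmem ?_)
      simp [abs_of_pos hδ]
    constructor <;> linarith [h1.1, h2.2]
  have hstrip : ∀ q : Plane × ℝ, -δ < q.2 → q.2 < T + δ → ψ (slabSection (cover L q)) = ψ q := by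
    intro q h1 h2
    have hzero : ∀ q : Plane × ℝ, ¬ (δ < q.2 ∧ q.2 < T - δ) → ψ q = 0 := by
      intro q hq
      by_contra hne
      exact hq (hδs q hne)
    by_cases ha : q.2 ≤ 0
    · rw [hzero q (by intro h; linarith [h.1])]
      by_cases hTδ : 0 < q.2 + T
      · have e : cover L q = cover L (q + (0, T)) := by
          rw [← cover_sub_period q (-1)]
          congr 1
          ext <;> simp [hT]
        rw [e, slabSection_cover (by constructor <;> simp <;> linarith)]
        exact hzero _ (by rintro ⟨h, h'⟩; simp at h'; linarith)
      · by_contra hne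
        have := hδs _ hne
        linarith [this.1]
    · by_cases hb : q.2 ≤ T
      · rw [slabSection_cover ⟨by linarith, by linarith⟩]
      · rw [hzero q (by intro h; linarith [h.2])]
        by_cases hTδ : q.2 - T ≤ T
        · have e : cover L q = cover L (q - (0, T)) := by
            have := cover_sub_period (L := L) q 1
            simpa [hT] using this.symm
          rw [e, slabSection_cover (by constructor <;> simp <;> linarith)]
          exact hzero _ (by rintro ⟨h, h'⟩; simp at h; linarith)
        · by_contra hne
          have := hδs _ hne
          linarith [this.1]
  refine ⟨?_, ?_⟩
  · change ContDiff ℝ _ (fun q => ψ (slabSection (cover L q)))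
    rw [contDiff_iff_contDiffAt]
    intro q
    obtain ⟨n, hn, -⟩ := existsUnique_sub_zsmul_mem_Ioc hTpos q.2 0
    have hev : (fun q => ψ (slabSection (cover L q))) =ᶠ[nhds q]
        fun q => ψ (q - (0, n • T)) := by
      have h1 : ∀ᶠ q' : Plane × ℝ in nhds q, q'.2 - n • T ∈ Set.Ioo (-δ) (T + δ) := by
        have hcont : Continuous fun q' : Plane × ℝ => q'.2 - n • T := by fun_prop
        refine hcont.continuousAt.eventually_mem (isOpen_Ioo.mem_nhds ?_)
        constructor <;> linarith [hn.1, hn.2]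
      filter_upwards [h1] with q' hq'
      rw [← cover_sub_period q' n]
      exact hstrip _ hq'.1 hq'.2
    refine ContDiffAt.congr_of_eventuallyEq ?_ hev
    exact (hψ.comp (contDiff_id.sub contDiff_const)).contDiffAt
  · refine HasCompactSupport.intro (hc.isCompact.image (continuous_cover (L := L))) ?_
    intro p hp
    by_contra hne
    exact hp ⟨slabSection p, subset_tsupport _ hne, cover_slabSection p⟩

/-- Reduces to the fundamental lemma of the calculus of variations on an open slab of `ℝ² × ℝ`: test
functions there descend to `Ω`, and the faces of the slab are null. -/
lemma ae_eq_zero_of_integral_test {f : Omega L → ℝ} (hf : LocallyIntegrable f)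
    (h : ∀ φ, IsTest φ → ∫ p, f p * φ p = 0) : f =ᵐ[volume] 0 := by
  have hmp := measurePreserving_cover (L := L) 0
  set S := (Set.univ : Set Plane) ×ˢ Set.Ioc 0 (0 + 2 * Real.pi * L) with hS
  have hSm : MeasurableSet S := MeasurableSet.univ.prod measurableSet_Ioc
  have hUS : (Set.univ : Set Plane) ×ˢ Set.Ioo 0 (2 * Real.pi * L) ⊆ S := by
    rintro q ⟨-, h1, h2⟩
    exact ⟨trivial, h1, by linarith⟩
  have hU : IsOpen ((Set.univ : Set Plane) ×ˢ Set.Ioo (0 : ℝ) (2 * Real.pi * L)) :=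
    isOpen_univ.prod isOpen_Ioo
  have hfl : LocallyIntegrableOn (fun q => f (cover L q))
      ((Set.univ : Set Plane) ×ˢ Set.Ioo 0 (2 * Real.pi * L)) := by
    rw [locallyIntegrableOn_iff hU.isLocallyClosed]
    intro K hK hKc
    have hK' : IsCompact (cover L '' K) := hKc.image continuous_cover
    have h1 : Integrable ((cover L '' K).indicator f) :=
      IntegrableOn.integrable_indicator (hf.integrableOn_isCompact hK') hK'.measurableSet
    have h2 := (hmp.integrable_comp h1.aestronglyMeasurable).2 h1
    have h3 : IntegrableOn (((cover L '' K).indicator f) ∘ cover L) K :=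
      IntegrableOn.mono_set h2 (hK.trans hUS)
    refine h3.congr_fun (fun q hq => ?_) hKc.measurableSet
    exact Set.indicator_of_mem (Set.mem_image_of_mem _ hq) f
  have hae := hU.ae_eq_zero_of_integral_contDiff_smul_eq_zero hfl (fun ψ hψ hψc hψs => by
    have ht := isTest_of_slab (L := L) hψ hψc hψs
    have h0 := h _ ht
    have hint := (ht.integrable_mul hf).aestronglyMeasurable
    rw [← hmp.map_eq, integral_map hmp.aemeasurable (by rwa [hmp.map_eq])] at h0
    have e : ∫ q in S, f (cover L q) * ψ (slabSection (cover L q)) = ∫ q in S, ψ q • f (cover L q) := by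
      refine setIntegral_congr_fun hSm fun q hq => ?_
      simp only [slabSection_cover hq.2, smul_eq_mul, mul_comm]
    rw [e, setIntegral_eq_integral_of_forall_compl_eq_zero] at h0
    · exact h0
    · intro q hq
      have : ψ q = 0 := image_eq_zero_of_notMem_tsupport fun hq' => hq (hUS (hψs hq'))
      simp [this])
  have hae' : (f ∘ cover L) =ᵐ[volume.restrict S] 0 := by
    have hnull : S =ᵐ[volume] ((Set.univ : Set Plane) ×ˢ Set.Ioo (0 : ℝ) (2 * Real.pi * L)) := by
      rw [hS, zero_add, Measure.volume_eq_prod]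
      exact Measure.set_prod_ae_eq (ae_eq_refl _) Ioo_ae_eq_Ioc.symm
    rw [Measure.restrict_congr_set hnull]
    exact (ae_restrict_iff' hU.measurableSet).2 hae
  have h1 : eLpNorm f 1 volume = 0 := by
    rw [← eLpNorm_comp_measurePreserving hf.aestronglyMeasurable hmp, eLpNorm_congr_ae hae']
    simp
  exact (eLpNorm_eq_zero_iff hf.aestronglyMeasurable one_ne_zero).1 h1

/-! ### A Liouville theorem -/

/-- Approximate `f` in `L^p` by a compactly supported `g`, which needs `p ≠ ∞`. For a large
horizontal shift `g` and the translate of `φ` have disjoint supports, and Hölder's inequality bounds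
what is left by the approximation error. Vertical shifts play no role because the circle is compact.
-/
lemma IsTest.integral_mul_shift_decay {f φ : Omega L → ℝ} (hφ : IsTest φ) {p q : ℝ≥0∞}
    [ENNReal.HolderConjugate p q] (hp : p ≠ ∞) (hf : MemLp f p) (ε : ℝ) (hε : 0 < ε) :
    ∃ R : ℝ, ∀ c : Omega L, R ≤ ‖c.1‖ → |∫ x, f x * φ (x + c)| ≤ ε := by
  have hp1 : 1 ≤ p := ENNReal.HolderConjugate.one_le p q
  set A := eLpNorm φ q volume with hA
  have hAtop : A ≠ ∞ := (hφ.memLp q).2.ne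
  obtain ⟨g, hgc, hge, hgcont, hgLp⟩ := hf.exists_hasCompactSupport_eLpNorm_sub_le hp
    -- The `1` protects the quotient when `A = 0`.
    (ε := ENNReal.ofReal ε / (A + 1))
    (ENNReal.div_ne_zero.2 ⟨by simpa using hε, by finiteness⟩)
  obtain ⟨R₁, hR₁⟩ : ∃ R, ∀ x, g x ≠ 0 → ‖x.1‖ ≤ R := by
    obtain ⟨R, hR⟩ := (hgc.isCompact.image (by fun_prop : Continuous fun x : Omega L =>
      ‖x.1‖)).bddAbove
    exact ⟨R, fun x hx => hR ⟨x, subset_tsupport _ hx, rfl⟩⟩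
  obtain ⟨R₂, hR₂⟩ : ∃ R, ∀ x, φ x ≠ 0 → ‖x.1‖ ≤ R := by
    obtain ⟨R, hR⟩ := (hφ.compact_support.isCompact.image (by fun_prop : Continuous fun x : Omega L =>
      ‖x.1‖)).bddAbove
    exact ⟨R, fun x hx => hR ⟨x, subset_tsupport _ hx, rfl⟩⟩
  refine ⟨R₁ + R₂ + 1, fun c hc => ?_⟩
  have hz : ∀ x, g x * φ (x + c) = 0 := by
    intro x
    by_contra hne
    have h1 := hR₁ x (left_ne_zero_of_mul hne)
    have h2 := hR₂ (x + c) (right_ne_zero_of_mul hne)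
    have h3 : ‖c.1‖ ≤ ‖(x + c).1‖ + ‖x.1‖ := by
      have : c.1 = (x + c).1 - x.1 := by simp
      rw [this]
      exact norm_sub_le _ _
    linarith
  have e : ∫ x, f x * φ (x + c) = ∫ x, (f - g) x * φ (x + c) := by
    congr 1
    funext x
    rw [Pi.sub_apply, sub_mul, hz, sub_zero]
  rw [e]
  have hφc : eLpNorm (fun x => φ (x + c)) q volume = A :=
    eLpNorm_comp_measurePreserving hφ.continuous.aestronglyMeasurable
      (measurePreserving_add_right volume c)
  have hb : ‖∫ x, (f - g) x * φ (x + c)‖ₑ ≤ ENNReal.ofReal ε := by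
    refine (enorm_integral_mul_le (p := p) (q := q)
      (hf.1.sub hgcont.aestronglyMeasurable)
      (hφ.comp_add c).continuous.aestronglyMeasurable).trans ?_
    rw [hφc]
    calc _ ≤ ENNReal.ofReal ε / (A + 1) * (A + 1) := by gcongr; exact le_self_add
      _ = _ := ENNReal.div_mul_cancel (by simp) (by finiteness)
  rw [← ofReal_norm, Real.norm_eq_abs] at hb
  exact (ENNReal.ofReal_le_ofReal_iff hε.le).1 hb

/-- The function `F φ y = ∫ f(x) φ(x + y) dx` inherits the equation in the classical sense and tends
to zero away from the axis, so the maximum principle gives `F φ ≤ 0`; evaluate at `y = 0`. The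
reverse inequality follows by replacing `φ` with `-φ`. -/
lemma IsTest.integral_eq_zero_of_lap {f φ : Omega L → ℝ} {p q : ℝ≥0∞}
    [ENNReal.HolderConjugate p q] (hp : p ≠ ∞) (hf : MemLp f p) {c : ℝ} (hc : 0 ≤ c)
    (h : ∀ φ, IsTest φ → ∫ x, f x * lap φ x = c * ∫ x, f x * φ x) (hφ : IsTest φ) :
    ∫ x, f x * φ x ≤ 0 := by
  have hp1 : 1 ≤ p := ENNReal.HolderConjugate.one_le p q
  have hloc : LocallyIntegrable f := hf.locallyIntegrable hp1
  let F : (Omega L → ℝ) → Omega L → ℝ := fun φ y => ∫ x, f x * φ (x + y)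
  have hline : ∀ φ, IsTest φ → ∀ i p t, HasDerivAt (fun t => F φ (p + translation L i t))
      (F (partialDeriv i φ) (p + translation L i t)) t :=
    fun φ hφ i p t => hφ.hasDerivAt_integral hloc i p t
  have hcont : Continuous (F φ) := by
    apply continuous_of_comp_cover
    rw [continuous_iff_continuousAt]
    intro q
    obtain ⟨M, hM⟩ := hφ.continuous.bounded_above_of_compact_support hφ.compact_support
    let K : Set (Omega L) := (fun x : Omega L × Omega L => x.1 - x.2) ''
      (tsupport φ ×ˢ (cover L '' Metric.closedBall q 1))
    have hK : IsCompact K := (hφ.compact_support.isCompact.prod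
      ((isCompact_closedBall q 1).image continuous_cover)).image (by fun_prop)
    have hbd : Integrable (fun p => K.indicator (fun p => |f p| * M) p) :=
      IntegrableOn.integrable_indicator ((hloc.integrableOn_isCompact hK).abs.mul_const M)
        hK.measurableSet
    refine continuousAt_of_dominated (F := fun q x => f x * φ (x + cover L q)) (.of_forall fun q => ?_) ?_ hbd
      (.of_forall fun x => ?_)
    · exact hf.1.mul (hφ.comp_add _).continuous.aestronglyMeasurable
    · filter_upwards [Metric.closedBall_mem_nhds q one_pos] with q' hq'
      refine .of_forall fun x => ?_
      by_cases hz : φ (x + cover L q') = 0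
      · rw [hz, mul_zero, norm_zero]
        refine Set.indicator_nonneg (fun q _ => mul_nonneg (abs_nonneg _) ?_) _
        exact (norm_nonneg _).trans (hM x)
      · have hx : x ∈ K := ⟨(x + cover L q', cover L q'),
          ⟨subset_tsupport _ hz, ⟨q', hq', rfl⟩⟩, by simp⟩
        rw [Set.indicator_of_mem hx, norm_mul, Real.norm_eq_abs]
        exact mul_le_mul_of_nonneg_left (hM _) (abs_nonneg _)
    · exact (continuous_const.mul (hφ.continuous.comp
        (continuous_const.add continuous_cover))).continuousAt
  have := le_zero_of_laplacian_eq (F := F φ) (D1 := fun i => F (partialDeriv i φ))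
    (D2 := fun i => F (partialDeriv i (partialDeriv i φ))) hcont (hline φ hφ)
    (fun i p => by
      have := hline _ (hφ.isTest_partialDeriv i) i p 0
      rwa [translation_zero, add_zero] at this) hc (fun y => by
      have := h _ (hφ.comp_add y)
      rw [← this]
      simp only [F, lap]
      rw [← integral_finsetSum]
      · congr 1
        funext x
        rw [Finset.mul_sum]
        have e : ∀ i, partialDeriv i (fun p => φ (p + y)) = fun p => partialDeriv i φ (p + y) :=
          fun i => funext fun p => partialDeriv_comp_add φ y i p
        simp only [e, partialDeriv_comp_add]
      · intro i _
        exact (((hφ.isTest_partialDeriv i).isTest_partialDeriv i).comp_add y).integrable_mul hloc)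
    (fun ε hε => hφ.integral_mul_shift_decay (q := q) hp hf ε hε) 0
  simpa [F] using this

/-- `L^p` solutions of `Δ f = c f` with `c ≥ 0` vanish. -/
theorem ae_eq_zero_of_lap {f : Omega L → ℝ} {p : ℝ≥0∞} (q : ℝ≥0∞)
    [ENNReal.HolderConjugate p q] (hp : p ≠ ∞) (hf : MemLp f p) {c : ℝ} (hc : 0 ≤ c)
    (h : ∀ φ, IsTest φ → ∫ x, f x * lap φ x = c * ∫ x, f x * φ x) : f =ᵐ[volume] 0 := by
  have hp1 : 1 ≤ p := ENNReal.HolderConjugate.one_le p q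
  refine ae_eq_zero_of_integral_test (hf.locallyIntegrable hp1) fun φ hφ => ?_
  refine le_antisymm (hφ.integral_eq_zero_of_lap (q := q) hp hf hc h) ?_
  have := (hφ.const_mul (-1)).integral_eq_zero_of_lap (q := q) hp hf hc h
  simp only [neg_one_mul, mul_neg, integral_neg] at this
  linarith

end

end HelicalOseen

namespace HelicalOseen

/-! ### Orthogonal projections in `L²` -/

section Projection

variable {α : Type*} [MeasurableSpace α] {μ : Measure α} {V : Type*} [NormedAddCommGroup V]
  [InnerProductSpace ℝ V] [CompleteSpace V]

lemma eLpNorm_two_sq {E : Type*} [NormedAddCommGroup E] (f : α → E) :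
    eLpNorm f 2 μ ^ 2 = ∫⁻ x, ‖f x‖ₑ ^ 2 ∂μ := by
  rw [eLpNorm_eq_lintegral_rpow_enorm_toReal two_ne_zero ENNReal.ofNat_ne_top, ← ENNReal.rpow_natCast,
    ← ENNReal.rpow_mul]
  simp

/-- Orthogonal projection onto the `L²` closure of a linear family of honest functions. The
annihilator clause carries linear identities valid on `S`, such as a vanishing curl or the
definition of a weak derivative, over to the limit `W`. It is used with gradients, for the Leray
projection, and with jets `(φ, ∇φ)`, for `H¹`. -/
lemma exists_projection (S : Set (α → V)) (h0 : (0 : α → V) ∈ S)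
    (hadd : ∀ s ∈ S, ∀ t ∈ S, s + t ∈ S) (hsmul : ∀ (c : ℝ), ∀ s ∈ S, c • s ∈ S)
    (hS : ∀ s ∈ S, MemLp s 2 μ) {U : α → V} (hU : MemLp U 2 μ) :
    ∃ W : α → V, MemLp W 2 μ ∧ eLpNorm W 2 μ ≤ eLpNorm U 2 μ ∧
      eLpNorm (U - W) 2 μ ≤ eLpNorm U 2 μ ∧
      (∀ s ∈ S, ∫ x, inner ℝ ((U - W) x) (s x) ∂μ = 0) ∧
      (∀ G : α → V, MemLp G 2 μ → (∀ s ∈ S, ∫ x, inner ℝ (s x) (G x) ∂μ = 0) →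
        ∫ x, inner ℝ (W x) (G x) ∂μ = 0) ∧
      ∃ s : ℕ → α → V, (∀ n, s n ∈ S) ∧
        Filter.Tendsto (fun n => eLpNorm (s n - W) 2 μ) Filter.atTop (nhds 0) := by
  let M : Submodule ℝ (Lp V 2 μ) :=
    { carrier := {f | ∃ s ∈ S, f =ᵐ[μ] s}
      add_mem' := by
        rintro f g ⟨s, hs, hfs⟩ ⟨t, ht, hgt⟩
        exact ⟨s + t, hadd s hs t ht, (Lp.coeFn_add f g).trans (hfs.add hgt)⟩
      zero_mem' := ⟨0, h0, Lp.coeFn_zero V 2 μ⟩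
      smul_mem' := by
        rintro c f ⟨s, hs, hfs⟩
        exact ⟨c • s, hsmul c s hs, (Lp.coeFn_smul c f).trans (hfs.const_smul c)⟩ }
  have hM : ∀ s (hs : s ∈ S), (hS s hs).toLp s ∈ M := fun s hs => ⟨s, hs, MemLp.coeFn_toLp _⟩
  let K := M.topologicalClosure
  have : CompleteSpace K := M.isClosed_topologicalClosure.completeSpace_coe
  set u : Lp V 2 μ := hU.toLp U with hu
  set w : Lp V 2 μ := K.starProjection u with hw
  have huU : u =ᵐ[μ] U := hU.coeFn_toLp
  have hsub : (u - w : Lp V 2 μ) =ᵐ[μ] U - w := (Lp.coeFn_sub u w).trans (huU.sub (ae_eq_refl _))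
  have hwK : w ∈ K := Submodule.starProjection_apply_mem K u
  have horth : u - w ∈ Kᗮ := Submodule.sub_starProjection_mem_orthogonal u
  have hinner : ∀ (f g : Lp V 2 μ) (f' g' : α → V), f =ᵐ[μ] f' → g =ᵐ[μ] g' →
      inner ℝ f g = ∫ x, inner ℝ (f' x) (g' x) ∂μ := by
    intro f g f' g' hf hg
    rw [L2.inner_def]
    refine integral_congr_ae ?_
    filter_upwards [hf, hg] with x h1 h2
    rw [h1, h2]
  have hnorm : ∀ (f g : Lp V 2 μ), ‖f‖ ≤ ‖g‖ → eLpNorm f 2 μ ≤ eLpNorm g 2 μ := by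
    intro f g h
    rw [Lp.norm_def, Lp.norm_def] at h
    exact (ENNReal.toReal_le_toReal (Lp.eLpNorm_ne_top f) (Lp.eLpNorm_ne_top g)).1 h
  refine ⟨w, Lp.memLp w, ?_, ?_, ?_, ?_, ?_⟩
  · rw [← eLpNorm_congr_ae huU]
    exact hnorm _ _ (Submodule.norm_starProjection_apply_le K u)
  · rw [← eLpNorm_congr_ae huU, ← eLpNorm_congr_ae hsub]
    refine hnorm _ _ ?_
    have h1 : inner ℝ w (u - w) = (0 : ℝ) := horth w hwK
    have h2 := norm_add_sq_eq_norm_sq_add_norm_sq_of_inner_eq_zero w (u - w) h1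
    rw [add_sub_cancel] at h2
    nlinarith [norm_nonneg w, norm_nonneg u, norm_nonneg (u - w)]
  · intro s hs
    rw [← hinner (u - w) ((hS s hs).toLp s) _ _ hsub (MemLp.coeFn_toLp _), real_inner_comm]
    exact horth _ (M.le_topologicalClosure (hM s hs))
  · intro G hG h
    rw [← hinner w (hG.toLp G) _ _ (ae_eq_refl _) (MemLp.coeFn_toLp _)]
    have hclosed : IsClosed {f : Lp V 2 μ | inner ℝ f (hG.toLp G) = (0 : ℝ)} :=
      isClosed_eq (by fun_prop) continuous_const
    have : closure (M : Set (Lp V 2 μ)) ⊆ {f : Lp V 2 μ | inner ℝ f (hG.toLp G) = (0 : ℝ)} := by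
      refine closure_minimal ?_ hclosed
      rintro f ⟨s, hs, hfs⟩
      change inner ℝ f (hG.toLp G) = (0 : ℝ)
      rw [hinner f (hG.toLp G) _ _ hfs (MemLp.coeFn_toLp _)]
      exact h s hs
    exact this hwK
  · obtain ⟨x, hx, hlim⟩ := mem_closure_iff_seq_limit.1
      (show w ∈ closure (M : Set (Lp V 2 μ)) from hwK)
    choose s hs hxs using hx
    refine ⟨s, hs, ?_⟩
    rw [Lp.tendsto_Lp_iff_tendsto_eLpNorm'] at hlim
    refine hlim.congr fun n => eLpNorm_congr_ae ?_
    exact (hxs n).sub (ae_eq_refl _)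

end Projection

/-! ### Components of square integrable vector fields -/

section Components

variable {α : Type*} [MeasurableSpace α] {μ : Measure α} {n : ℕ}

lemma memLp_euclidean_iff {u : α → EuclideanSpace ℝ (Fin n)} {p : ℝ≥0∞} :
    MemLp u p μ ↔ ∀ i, MemLp (fun x => u x i) p μ := by
  have h := memLp_pi_iff (μ := μ) (p := p) (f := fun x i => u x i)
  rw [← h]
  constructor
  · intro hu
    exact hu.continuousLinearMap_comp (𝕜 := ℝ) (EuclideanSpace.equiv (Fin n) ℝ).toContinuousLinearMap
  · intro hu
    exact hu.continuousLinearMap_comp (𝕜 := ℝ)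
      (EuclideanSpace.equiv (Fin n) ℝ).symm.toContinuousLinearMap

lemma eLpNorm_euclidean_sq {u : α → EuclideanSpace ℝ (Fin n)} (hu : AEStronglyMeasurable u μ) :
    eLpNorm u 2 μ ^ 2 = ∑ i, eLpNorm (fun x => u x i) 2 μ ^ 2 := by
  simp only [eLpNorm_two_sq]
  have hm : ∀ i, AEStronglyMeasurable (fun x => u x i) μ := fun i =>
    (EuclideanSpace.proj (𝕜 := ℝ) i).continuous.comp_aestronglyMeasurable hu
  rw [← lintegral_finsetSum' _ (fun i _ => (hm i).enorm.pow_const 2)]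
  congr 1
  funext x
  rw [← ofReal_norm, ← ENNReal.ofReal_pow (norm_nonneg _), EuclideanSpace.norm_sq_eq,
    ENNReal.ofReal_sum_of_nonneg (fun _ _ => sq_nonneg _)]
  refine Finset.sum_congr rfl fun i _ => ?_
  rw [← ofReal_norm, ENNReal.ofReal_pow (norm_nonneg _)]

lemma eLpNorm_component_le (u : α → EuclideanSpace ℝ (Fin n)) (i : Fin n) (p : ℝ≥0∞) :
    eLpNorm (fun x => u x i) p μ ≤ eLpNorm u p μ :=
  eLpNorm_mono fun x => PiLp.norm_apply_le (u x) i

lemma inner_euclidean (x y : EuclideanSpace ℝ (Fin n)) : inner ℝ x y = ∑ i, x i * y i := by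
  simp [PiLp.inner_apply, mul_comm]

lemma integral_inner_euclidean {u v : α → EuclideanSpace ℝ (Fin n)} (hu : MemLp u 2 μ)
    (hv : MemLp v 2 μ) :
    ∫ x, inner ℝ (u x) (v x) ∂μ = ∑ i, ∫ x, u x i * v x i ∂μ := by
  simp only [inner_euclidean]
  exact integral_finsetSum _ fun i _ =>
    (memLp_euclidean_iff.1 hu i).integrable_mul (memLp_euclidean_iff.1 hv i)

end Components

/-! ### Leray projection, and uniqueness for the div-curl system -/

variable {L : ℝ} [Fact (0 < L)]

lemma IsTest.integral_partialDeriv_mul {φ ψ : Omega L → ℝ} (hφ : IsTest φ) (hψ : IsTest ψ)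
    (i : Fin 3) : ∫ p, partialDeriv i φ p * ψ p = -∫ p, φ p * partialDeriv i ψ p := by
  have h := (hφ.isSmooth.mul_test hψ).integral_partialDeriv i
  simp only [hφ.isSmooth.partialDeriv_mul hψ.isSmooth] at h
  rw [integral_add ((hψ.integrable_mul (hφ.isTest_partialDeriv i).continuous.locallyIntegrable))
    ((hψ.isTest_partialDeriv i).integrable_mul hφ.continuous.locallyIntegrable)] at h
  linarith

lemma IsTest.integral_partialDeriv_mul_symm {φ ψ : Omega L → ℝ} (hφ : IsTest φ) (hψ : IsTest ψ)
    (i j : Fin 3) :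
    ∫ p, partialDeriv i φ p * partialDeriv j ψ p = ∫ p, partialDeriv j φ p * partialDeriv i ψ p := by
  rw [hφ.integral_partialDeriv_mul (hψ.isTest_partialDeriv j),
    hφ.integral_partialDeriv_mul (hψ.isTest_partialDeriv i), hψ.isSmooth.partialDeriv_comm]

/-- The classical gradient, as a vector field. -/
noncomputable def gradField (φ : Omega L → ℝ) (p : Omega L) : Vec :=
  WithLp.toLp 2 fun i => partialDeriv i φ p

lemma IsTest.memLp_gradField {φ : Omega L → ℝ} (h : IsTest φ) (q : ℝ≥0∞) : MemLp (gradField φ) q :=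
  memLp_euclidean_iff.2 fun i => (h.isTest_partialDeriv i).memLp q

lemma locallyIntegrable_component {u : Omega L → Vec} (hu : LocallyIntegrable u) (i : Fin 3) :
    LocallyIntegrable fun p => u p i := by
  intro x
  obtain ⟨s, hs, h⟩ := hu x
  refine ⟨s, hs, ?_⟩
  exact (EuclideanSpace.proj (𝕜 := ℝ) i).integrable_comp h

lemma isDivFree_iff {u : Omega L → Vec} (hu : LocallyIntegrable u) :
    IsDivFree u ↔ ∀ φ, IsTest φ → ∑ i, ∫ p, u p i * partialDeriv i φ p = 0 := by
  constructor
  · intro h φ hφ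
    have := h.div_eq_zero φ hφ
    simpa [distDeriv, Finset.sum_neg_distrib] using this
  · intro h
    refine ⟨hu, fun φ hφ => ?_⟩
    simpa [distDeriv, Finset.sum_neg_distrib] using h φ hφ

/-- The Leray projection: a square integrable field can be made divergence free without changing
its curl. -/
lemma exists_divFree_of_hasCurl {u ω : Omega L → Vec} (hu : MemLp u 2) (h : HasCurl u ω) :
    ∃ v : Omega L → Vec, MemLp v 2 ∧ eLpNorm v 2 volume ≤ eLpNorm u 2 volume ∧ IsDivFree v ∧
      HasCurl v ω := by
  obtain ⟨W, hW, -, hle, horth, hann, -⟩ := exists_projection (μ := (volume : Measure (Omega L)))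
    {s | ∃ φ : Omega L → ℝ, IsTest φ ∧ s = gradField φ}
    ⟨fun _ => 0, isTest_zero, by funext p; ext i; simp [gradField, partialDeriv]⟩
    (by
      rintro _ ⟨φ, hφ, rfl⟩ _ ⟨ψ, hψ, rfl⟩
      refine ⟨_, hφ.add hψ, ?_⟩
      funext p; ext i
      simp [gradField, hφ.isSmooth.partialDeriv_add hψ.isSmooth])
    (by
      rintro c _ ⟨φ, hφ, rfl⟩
      refine ⟨_, hφ.const_mul c, ?_⟩
      funext p; ext i
      simp [gradField, partialDeriv_const_mul])
    (by rintro _ ⟨φ, hφ, rfl⟩; exact hφ.memLp_gradField 2) hu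
  have hv : MemLp (u - W) 2 := hu.sub hW
  have hvl : LocallyIntegrable (u - W) := hv.locallyIntegrable one_le_two
  -- The subtracted part `W` is curl free: the field with `∂_j ψ` in slot `i` and `-∂_i ψ` in slot
  -- `j` is orthogonal to every gradient of a test function, hence to `W`.
  have hW0 : ∀ (ψ : Omega L → ℝ), IsTest ψ → ∀ i j : Fin 3, i ≠ j →
      ∫ p, W p i * partialDeriv j ψ p = ∫ p, W p j * partialDeriv i ψ p := by
    intro ψ hψ i j hij
    let G : Omega L → Vec := fun p => WithLp.toLp 2 fun k =>
      if k = i then partialDeriv j ψ p else if k = j then -partialDeriv i ψ p else 0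
    have hG : MemLp G 2 := memLp_euclidean_iff.2 fun k => by
      simp only [G]
      by_cases h1 : k = i
      · simpa [h1] using (hψ.isTest_partialDeriv j).memLp 2
      · by_cases h2 : k = j
        · simp only [h2, hij.symm, if_true, if_false]
          exact ((hψ.isTest_partialDeriv i).memLp 2).neg
        · simp [h1, h2]
    have e : ∀ (s : Omega L → Vec), MemLp s 2 → ∫ p, inner ℝ (s p) (G p) =
        (∫ p, s p i * partialDeriv j ψ p) - ∫ p, s p j * partialDeriv i ψ p := by
      intro s hs
      rw [integral_inner_euclidean hs hG, Fintype.sum_eq_add i j hij]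
      · simp [G, hij.symm, integral_neg, sub_eq_add_neg]
      · rintro k ⟨h1, h2⟩
        simp [G, h1, h2]
    have := hann G hG (by
      rintro _ ⟨φ, hφ, rfl⟩
      rw [e _ (hφ.memLp_gradField 2), sub_eq_zero]
      exact hφ.integral_partialDeriv_mul_symm hψ i j)
    rwa [e W hW, sub_eq_zero] at this
  have hsub : ∀ (ψ : Omega L → ℝ), IsTest ψ → ∀ i : Fin 3,
      ∫ p, (u - W) p i * ψ p = (∫ p, u p i * ψ p) - ∫ p, W p i * ψ p := by
    intro ψ hψ i
    rw [← integral_sub (hψ.integrable_mul (locallyIntegrable_component h.locallyIntegrable i))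
      (hψ.integrable_mul (locallyIntegrable_component (hW.locallyIntegrable one_le_two) i))]
    simp [sub_mul]
  have hcurl : ∀ (ψ : Omega L → ℝ), IsTest ψ → ∀ i j : Fin 3, i ≠ j →
      distDeriv i (fun p => (u - W) p j) ψ - distDeriv j (fun p => (u - W) p i) ψ =
      distDeriv i (fun p => u p j) ψ - distDeriv j (fun p => u p i) ψ := by
    intro ψ hψ i j hij
    simp only [distDeriv, hsub _ (hψ.isTest_partialDeriv _), hW0 ψ hψ i j hij]
    ring
  refine ⟨u - W, hv, hle, (isDivFree_iff hvl).2 fun φ hφ => ?_, hvl, h.locallyIntegrable_curl,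
    ?_, ?_, ?_⟩
  · rw [← horth _ ⟨φ, hφ, rfl⟩, integral_inner_euclidean hv (hφ.memLp_gradField 2)]
    rfl
  · intro φ hφ
    rw [hcurl φ hφ 1 2 (by decide), h.curl_x φ hφ]
  · intro φ hφ
    rw [hcurl φ hφ 2 0 (by decide), h.curl_y φ hφ]
  · intro φ hφ
    rw [hcurl φ hφ 0 1 (by decide), h.curl_z φ hφ]

/-- The components of the field paired with `∇ φ` in `∫ v_j Δ φ`, for a solenoidal field `v` with
curl `ω`. -/
noncomputable def curlSource (ω : Omega L → Vec) : Fin 3 → Fin 3 → Omega L → ℝ :=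
  ![![0, fun p => ω p 2, fun p => -ω p 1], ![fun p => -ω p 2, 0, fun p => ω p 0],
    ![fun p => ω p 1, fun p => -ω p 0, 0]]

lemma integral_lap {f φ : Omega L → ℝ} (hf : LocallyIntegrable f) (hφ : IsTest φ) :
    ∫ p, f p * lap φ p = ∑ i, ∫ p, f p * partialDeriv i (partialDeriv i φ) p := by
  simp only [lap, Finset.mul_sum]
  exact integral_finsetSum _ fun i _ =>
    ((hφ.isTest_partialDeriv i).isTest_partialDeriv i).integrable_mul hf

/-- Weak form of `Δv = ∇ div v - rot rot v`, obtained by using derivatives of `φ` as test functions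
in the divergence and curl equations. -/
lemma integral_lap_of_curl {v ω : Omega L → Vec} (hd : IsDivFree v) (h : HasCurl v ω)
    {φ : Omega L → ℝ} (hφ : IsTest φ) (j : Fin 3) :
    ∫ p, v p j * lap φ p = ∑ i, ∫ p, curlSource ω j i p * partialDeriv i φ p := by
  rw [integral_lap (locallyIntegrable_component hd.locallyIntegrable j) hφ]
  have ht := hφ.isTest_partialDeriv
  have hD : ∀ j, ∑ i, ∫ p, v p i * partialDeriv i (partialDeriv j φ) p = 0 := fun j =>
    (isDivFree_iff hd.locallyIntegrable).1 hd _ (ht j)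
  have hx := fun j => h.curl_x _ (ht j)
  have hy := fun j => h.curl_y _ (ht j)
  have hz := fun j => h.curl_z _ (ht j)
  simp only [distDeriv, Fin.sum_univ_three] at hD hx hy hz ⊢
  have c10 := hφ.isSmooth.partialDeriv_comm 1 0
  have c20 := hφ.isSmooth.partialDeriv_comm 2 0
  have c21 := hφ.isSmooth.partialDeriv_comm 2 1
  fin_cases j
  · have h0 := hD 0
    have h1 := hz 1
    have h2 := hy 2
    simp only [c10, c20] at h0 h1 h2
    simp [curlSource, integral_neg]
    linarith
  · have h0 := hD 1
    have h1 := hz 0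
    have h2 := hx 2
    simp only [c10, c21] at h0 h1 h2
    simp [curlSource, integral_neg]
    linarith
  · have h0 := hD 2
    have h1 := hy 0
    have h2 := hx 1
    simp only [c20, c21] at h0 h1 h2
    simp [curlSource, integral_neg]
    linarith

/-- A field in `L^p` is determined by its divergence and curl. -/
lemma ae_eq_of_curl_eq {v w ω : Omega L → Vec} {p : ℝ≥0∞} (q : ℝ≥0∞)
    [ENNReal.HolderConjugate p q] (hp : p ≠ ∞) (hv : MemLp v p) (hw : MemLp w p)
    (hvd : IsDivFree v) (hwd : IsDivFree w) (hvc : HasCurl v ω) (hwc : HasCurl w ω) :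
    v =ᵐ[volume] w := by
  have hj : ∀ j : Fin 3, (fun x => v x j - w x j) =ᵐ[volume] 0 := by
    intro j
    refine ae_eq_zero_of_lap (p := p) q hp
      ((memLp_euclidean_iff.1 hv j).sub (memLp_euclidean_iff.1 hw j)) le_rfl fun φ hφ => ?_
    have h1 := integral_lap_of_curl hvd hvc hφ j
    have h2 := integral_lap_of_curl hwd hwc hφ j
    have hlap := hφ.isTest_lap
    simp only [sub_mul, zero_mul]
    rw [integral_sub (hlap.integrable_mul (locallyIntegrable_component hvd.locallyIntegrable j))
      (hlap.integrable_mul (locallyIntegrable_component hwd.locallyIntegrable j)), h1, h2, sub_self]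
  filter_upwards [hj 0, hj 1, hj 2] with x h0 h1 h2
  ext i
  fin_cases i
  · exact sub_eq_zero.1 h0
  · exact sub_eq_zero.1 h1
  · exact sub_eq_zero.1 h2

end HelicalOseen

namespace HelicalOseen

variable {L : ℝ} [Fact (0 < L)]

/-! ### The Sobolev inequality for test functions -/

/-- Accounts for a cutoff that equals one on one period and is supported in three. -/
lemma lintegral_three_slabs_le (g : Omega L → ℝ≥0∞) (hg : Measurable g) :
    ∫⁻ q in (Set.univ : Set Plane) ×ˢ Set.Ioc (-(2 * Real.pi * L)) (2 * (2 * Real.pi * L)),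
      g (cover L q) ≤ 3 * ∫⁻ p, g p := by
  set T := 2 * Real.pi * L with hT
  have hTpos : 0 < T := (fact_period_pos L).out
  have h : ∀ t : ℝ, ∫⁻ q in (Set.univ : Set Plane) ×ˢ Set.Ioc t (t + T), g (cover L q) =
      ∫⁻ p, g p := fun t => (measurePreserving_cover t).lintegral_comp hg
  have hsub : (Set.univ : Set Plane) ×ˢ Set.Ioc (-T) (2 * T) ⊆
      ((Set.univ : Set Plane) ×ˢ Set.Ioc (-T) (-T + T) ∪
        (Set.univ : Set Plane) ×ˢ Set.Ioc 0 (0 + T)) ∪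
        (Set.univ : Set Plane) ×ˢ Set.Ioc T (T + T) := by
    rintro ⟨x, z⟩ ⟨-, h1, h2⟩
    simp only [Set.mem_union, Set.mem_prod, Set.mem_univ, true_and, Set.mem_Ioc] at *
    by_cases ha : z ≤ 0
    · exact Or.inl (Or.inl ⟨h1, by linarith⟩)
    · by_cases hb : z ≤ T
      · exact Or.inl (Or.inr ⟨by linarith, by linarith⟩)
      · exact Or.inr ⟨by linarith, by linarith⟩
  calc _ ≤ _ := lintegral_mono_set hsub
    _ ≤ _ := lintegral_union_le _ _ _
    _ ≤ _ := add_le_add_left (lintegral_union_le _ _ _) _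
    _ = _ := by rw [h, h, h]; ring

lemma norm_clm_le_sum_basisVec (A : Plane × ℝ →L[ℝ] ℝ) :
    ‖A‖ ≤ |A (basisVec 0)| + |A (basisVec 1)| + |A (basisVec 2)| := by
  refine A.opNorm_le_bound (by positivity) fun v => ?_
  rw [fderiv_basis_apply A v, Real.norm_eq_abs]
  have h0 : |v.1 0| ≤ ‖v‖ := (PiLp.norm_apply_le v.1 0).trans (norm_fst_le v)
  have h1 : |v.1 1| ≤ ‖v‖ := (PiLp.norm_apply_le v.1 1).trans (norm_fst_le v)
  have h2 : |v.2| ≤ ‖v‖ := norm_snd_le v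
  calc _ ≤ |v.1 0 * A (basisVec 0)| + |v.1 1 * A (basisVec 1)| + |v.2 * A (basisVec 2)| :=
        abs_add_three _ _ _
    _ ≤ ‖v‖ * |A (basisVec 0)| + ‖v‖ * |A (basisVec 1)| + ‖v‖ * |A (basisVec 2)| := by
        simp only [abs_mul]
        gcongr
    _ = _ := by ring

instance : (volume : Measure (Plane × ℝ)).IsAddHaarMeasure :=
  inferInstanceAs (Measure.IsAddHaarMeasure ((volume : Measure Plane).prod (volume : Measure ℝ)))

/-- Multiply the lift of `φ` by a vertical cutoff `χ` equal to one on a full period. The product has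
compact support in a three-dimensional space, where the Gagliardo-Nirenberg-Sobolev inequality takes
`L²` gradients to `L⁶`. Differentiating `χ` produces the `L²` norm of `φ` on the right. -/
lemma exists_sobolev_const (L : ℝ) [Fact (0 < L)] : ∃ C : ℝ≥0∞, C ≠ ∞ ∧ ∀ φ : Omega L → ℝ, IsTest φ →
    eLpNorm φ 6 volume ≤
      C * (eLpNorm φ 2 volume + ∑ i, eLpNorm (partialDeriv i φ) 2 volume) := by
  set T := 2 * Real.pi * L with hT
  have hTpos : 0 < T := (fact_period_pos L).out
  let χ : ContDiffBump (T / 2 : ℝ) := ⟨T / 2, 3 * T / 2, by positivity, by linarith⟩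
  have hχs : ContDiff ℝ ((⊤ : ℕ∞) : WithTop ℕ∞) χ := χ.contDiff
  have hχc : HasCompactSupport χ := χ.hasCompactSupport
  obtain ⟨M, hM⟩ := (hχs.continuous_deriv (by simp)).bounded_above_of_compact_support hχc.deriv
  have hM0 : 0 ≤ M := (norm_nonneg _).trans (hM 0)
  set N : NNReal := SNormLESNormFDerivOfEqConst ℝ (volume : Measure (Plane × ℝ)) ((2 : NNReal) : ℝ)
    with hN
  refine ⟨N * (2 * ENNReal.ofReal (1 + M)), by finiteness, fun φ hφ => ?_⟩
  let u : Plane × ℝ → ℝ := fun q => χ q.2 * φ (cover L q)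
  have hsl : ContDiff ℝ ((⊤ : ℕ∞) : WithTop ℕ∞) (fun q : Plane × ℝ => φ (cover L q)) := hφ.smooth
  have hu : ContDiff ℝ ((⊤ : ℕ∞) : WithTop ℕ∞) u := (hχs.comp contDiff_snd).mul hsl
  have huc : HasCompactSupport u := by
    refine HasCompactSupport.intro
      ((hφ.compact_support.isCompact.image continuous_fst).prod hχc.isCompact) ?_
    intro q hq
    by_contra hne
    refine hq ⟨⟨cover L q, subset_tsupport _ (right_ne_zero_of_mul hne), rfl⟩,
      subset_tsupport _ (left_ne_zero_of_mul hne)⟩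
  have hfin : Module.finrank ℝ (Plane × ℝ) = 3 := by simp
  have hGNS := eLpNorm_le_eLpNorm_fderiv_of_eq (volume : Measure (Plane × ℝ))
    (hu.of_le (by simp)) huc (p := 2) (p' := 6) (by norm_num) (by rw [hfin]; norm_num)
    (by rw [hfin]; norm_num)
  let h : Omega L → ℝ := fun p => |φ p| + ∑ i, |partialDeriv i φ p|
  have hhc : Continuous h := by
    have := fun i => (hφ.isTest_partialDeriv i).continuous
    have := hφ.continuous
    fun_prop
  have hd : ∀ q, HasFDerivAt u (χ q.2 • fderiv ℝ (fun q => φ (cover L q)) q +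
      φ (cover L q) • (deriv χ q.2 • ContinuousLinearMap.snd ℝ Plane ℝ)) q := by
    intro q
    have h1 : HasFDerivAt (fun q : Plane × ℝ => χ q.2)
        (deriv χ q.2 • ContinuousLinearMap.snd ℝ Plane ℝ) q :=
      (hχs.differentiable (by simp) q.2).hasDerivAt.comp_hasFDerivAt q hasFDerivAt_snd
    have h2 := (hsl.differentiable (by simp) q).hasFDerivAt
    exact h1.mul h2
  have hpt : ∀ q, ‖fderiv ℝ u q‖ ≤ (1 + M) * h (cover L q) := by
    intro q
    rw [(hd q).fderiv]
    refine (norm_clm_le_sum_basisVec _).trans ?_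
    simp only [add_apply, smul_apply,
      ← hφ.isSmooth.partialDeriv_cover, ContinuousLinearMap.coe_snd', smul_eq_mul]
    have hb : ∀ i, |χ q.2 * partialDeriv i φ (cover L q)| ≤ |partialDeriv i φ (cover L q)| := by
      intro i
      rw [abs_mul, abs_of_nonneg χ.nonneg]
      exact mul_le_of_le_one_left (abs_nonneg _) χ.le_one
    have hb2 : |φ (cover L q) * deriv χ q.2| ≤ M * |φ (cover L q)| := by
      rw [abs_mul, mul_comm]
      exact mul_le_mul_of_nonneg_right (hM _) (abs_nonneg _)
    have e0 : (basisVec 0).2 = 0 := rfl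
    have e1 : (basisVec 1).2 = 0 := rfl
    have e2 : (basisVec 2).2 = 1 := rfl
    simp only [e0, e1, e2, mul_zero, add_zero, mul_one, h, Fin.sum_univ_three]
    have hb3 := abs_add_le (χ q.2 * partialDeriv 2 φ (cover L q)) (φ (cover L q) * deriv χ q.2)
    have := hb 0
    have := hb 1
    have := hb 2
    nlinarith [abs_nonneg (φ (cover L q)), abs_nonneg (partialDeriv 0 φ (cover L q)),
      abs_nonneg (partialDeriv 1 φ (cover L q)), abs_nonneg (partialDeriv 2 φ (cover L q))]
  have hsupp : ∀ q : Plane × ℝ, q ∉ (Set.univ : Set Plane) ×ˢ Set.Ioc (-T) (2 * T) →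
      fderiv ℝ u q = 0 := by
    intro q hq
    have hz : q.2 ∉ Metric.ball (T / 2) (3 * T / 2) := by
      intro hz
      rw [Metric.mem_ball, Real.dist_eq, abs_lt] at hz
      exact hq ⟨trivial, by linarith [hz.1], by linarith [hz.2]⟩
    have hχ0 : χ q.2 = 0 := by
      have : q.2 ∉ Function.support χ := by rwa [χ.support_eq]
      simpa using this
    have hmin : IsLocalMin χ q.2 := .of_forall fun z => by rw [hχ0]; exact χ.nonneg
    rw [(hd q).fderiv, hχ0, hmin.deriv_eq_zero]
    simp
  -- The factor `2` absorbs the `√3` coming from the three periods.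
  have hL2 : eLpNorm (fderiv ℝ u) 2 volume ≤ 2 * ENNReal.ofReal (1 + M) * eLpNorm h 2 volume := by
    have hsq : eLpNorm (fderiv ℝ u) 2 volume ^ 2 ≤
        (2 * ENNReal.ofReal (1 + M) * eLpNorm h 2 volume) ^ 2 := by
      rw [mul_pow, mul_pow, eLpNorm_two_sq, eLpNorm_two_sq]
      calc ∫⁻ q, ‖fderiv ℝ u q‖ₑ ^ 2
          = ∫⁻ q in (Set.univ : Set Plane) ×ˢ Set.Ioc (-T) (2 * T), ‖fderiv ℝ u q‖ₑ ^ 2 := by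
            rw [setLIntegral_eq_of_support_subset]
            intro q hq
            by_contra hq'
            refine hq ?_
            change ‖fderiv ℝ u q‖ₑ ^ 2 = 0
            rw [← ofReal_norm, hsupp q hq', norm_zero]
            simp
        _ ≤ ∫⁻ q in (Set.univ : Set Plane) ×ˢ Set.Ioc (-T) (2 * T),
              ENNReal.ofReal (1 + M) ^ 2 * ‖h (cover L q)‖ₑ ^ 2 := by
            refine lintegral_mono fun q => ?_
            rw [← mul_pow]
            refine pow_le_pow_left' ?_ 2
            rw [← ofReal_norm, ← ofReal_norm (h _), ← ENNReal.ofReal_mul (by positivity)]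
            refine ENNReal.ofReal_le_ofReal ((hpt q).trans ?_)
            exact mul_le_mul_of_nonneg_left (le_abs_self _) (by positivity)
        _ ≤ 3 * ∫⁻ p, ENNReal.ofReal (1 + M) ^ 2 * ‖h p‖ₑ ^ 2 :=
            lintegral_three_slabs_le (fun p => ENNReal.ofReal (1 + M) ^ 2 * ‖h p‖ₑ ^ 2)
              (by have := hhc.measurable; fun_prop)
        _ ≤ 2 ^ 2 * ENNReal.ofReal (1 + M) ^ 2 * ∫⁻ p, ‖h p‖ₑ ^ 2 := by
            have hm : Measurable fun p => ‖h p‖ₑ ^ 2 := by have := hhc.measurable; fun_prop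
            rw [lintegral_const_mul _ hm, ← mul_assoc]
            gcongr
            norm_num
    exact (ENNReal.pow_le_pow_left_iff two_ne_zero).1 hsq
  have hh2 : eLpNorm h 2 volume ≤ eLpNorm φ 2 volume + ∑ i, eLpNorm (partialDeriv i φ) 2 volume := by
    have hc := fun i => (hφ.isTest_partialDeriv i).continuous
    have e : h = (fun p => |φ p|) + ∑ i, fun p => |partialDeriv i φ p| := by
      funext p
      simp [h]
    rw [e]
    refine (eLpNorm_add_le hφ.continuous.abs.aestronglyMeasurable
      (Finset.aestronglyMeasurable_sum _ fun i _ => (hc i).abs.aestronglyMeasurable)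
      one_le_two).trans ?_
    refine add_le_add ?_ ((eLpNorm_sum_le (fun i _ => (hc i).abs.aestronglyMeasurable)
      one_le_two).trans (Finset.sum_le_sum fun i _ => ?_))
    · exact (eLpNorm_norm φ).le
    · exact (eLpNorm_norm (partialDeriv i φ)).le
  have hφ6 : eLpNorm φ 6 volume ≤ eLpNorm u 6 volume := by
    rw [← eLpNorm_comp_measurePreserving hφ.continuous.aestronglyMeasurable
      (measurePreserving_cover (L := L) 0)]
    have e : eLpNorm (φ ∘ cover L) 6 (volume.restrict ((Set.univ : Set Plane) ×ˢ
        Set.Ioc 0 (0 + 2 * Real.pi * L))) = eLpNorm u 6 (volume.restrict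
        ((Set.univ : Set Plane) ×ˢ Set.Ioc 0 (0 + 2 * Real.pi * L))) := by
      refine eLpNorm_congr_ae ?_
      refine (ae_restrict_iff' (MeasurableSet.univ.prod measurableSet_Ioc)).2 (.of_forall ?_)
      rintro q ⟨-, h1, h2⟩
      have : χ q.2 = 1 := χ.one_of_mem_closedBall (by
        rw [Metric.mem_closedBall, Real.dist_eq, abs_le]
        constructor <;> simp only [χ] <;> linarith)
      simp [u, this]
    rw [e]
    exact eLpNorm_mono_measure _ Measure.restrict_le_self
  calc eLpNorm φ 6 volume ≤ eLpNorm u 6 volume := hφ6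
    _ ≤ N * eLpNorm (fderiv ℝ u) 2 volume := by exact_mod_cast hGNS
    _ ≤ N * (2 * ENNReal.ofReal (1 + M) *
        (eLpNorm φ 2 volume + ∑ i, eLpNorm (partialDeriv i φ) 2 volume)) := by
        gcongr
        exact hL2.trans (by gcongr)
    _ = _ := by ring

/-! ### Regularity -/

/-- A function together with its gradient, as a map to `ℝ⁴`. -/
noncomputable def jet (φ : Omega L → ℝ) (p : Omega L) : EuclideanSpace ℝ (Fin 4) :=
  WithLp.toLp 2 (Fin.cons (φ p) fun i => partialDeriv i φ p)

lemma memLp_cons {f : Omega L → ℝ} {h : Fin 3 → Omega L → ℝ} (hf : MemLp f 2)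
    (hh : ∀ i, MemLp (h i) 2) :
    MemLp (fun p => WithLp.toLp 2 (Fin.cons (f p) fun i => h i p) : Omega L →
      EuclideanSpace ℝ (Fin 4)) 2 :=
  memLp_euclidean_iff.2 fun k => by
    refine Fin.cases ?_ (fun i => ?_) k
    · simpa using hf
    · simpa using hh i

lemma IsTest.memLp_jet {φ : Omega L → ℝ} (h : IsTest φ) : MemLp (jet φ) 2 :=
  memLp_cons (h.memLp 2) fun i => (h.isTest_partialDeriv i).memLp 2

/-- If `v ∈ L²` and `Δ v = - div h` with `h ∈ L²`, then `v ∈ H¹ ∩ L⁶`. -/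
lemma exists_weakGradient_of_lap {v : Omega L → ℝ} {h : Fin 3 → Omega L → ℝ} (hv : MemLp v 2)
    (hh : ∀ i, MemLp (h i) 2)
    (heq : ∀ φ, IsTest φ → ∫ p, v p * lap φ p = ∑ i, ∫ p, h i p * partialDeriv i φ p) :
    MemLp v 6 ∧ ∃ G : Fin 3 → Omega L → ℝ, (∀ i, MemLp (G i) 2) ∧
      (∀ φ, IsTest φ → ∀ i, distDeriv i v φ = ∫ p, G i p * φ p) ∧
      ∑ i, eLpNorm (G i) 2 volume ^ 2 ≤
        eLpNorm v 2 volume ^ 2 + ∑ i, eLpNorm (h i) 2 volume ^ 2 := by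
  -- Projecting `(v, -h)` onto the closure of the jets `(φ, ∇φ)` is the variational solution of `w -
  -- Δw = v + div h`, an equation which `v` also satisfies. The contraction property of the
  -- projection is the gradient bound.
  let U : Omega L → EuclideanSpace ℝ (Fin 4) := fun p =>
    WithLp.toLp 2 (Fin.cons (v p) fun i => -h i p)
  have hU : MemLp U 2 := memLp_cons hv fun i => (hh i).neg
  obtain ⟨W, hW, hle, -, horth, hann, s, hs, hlim⟩ :=
    exists_projection (μ := (volume : Measure (Omega L)))
    {s | ∃ φ : Omega L → ℝ, IsTest φ ∧ s = jet φ}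
    ⟨fun _ => 0, isTest_zero, by
      funext p; ext k
      refine Fin.cases ?_ (fun i => ?_) k <;> simp [jet, partialDeriv]⟩
    (by
      rintro _ ⟨φ, hφ, rfl⟩ _ ⟨ψ, hψ, rfl⟩
      refine ⟨_, hφ.add hψ, ?_⟩
      funext p; ext k
      refine Fin.cases ?_ (fun i => ?_) k <;>
        simp [jet, hφ.isSmooth.partialDeriv_add hψ.isSmooth])
    (by
      rintro c _ ⟨φ, hφ, rfl⟩
      refine ⟨_, hφ.const_mul c, ?_⟩
      funext p; ext k
      refine Fin.cases ?_ (fun i => ?_) k <;> simp [jet, partialDeriv_const_mul])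
    (by rintro _ ⟨φ, hφ, rfl⟩; exact hφ.memLp_jet) hU
  have hWk := memLp_euclidean_iff.1 hW
  have hvl : LocallyIntegrable v := hv.locallyIntegrable one_le_two
  have hWl : ∀ k, LocallyIntegrable fun p => W p k := fun k =>
    (hWk k).locallyIntegrable one_le_two
  have hweak : ∀ ψ, IsTest ψ → ∀ i : Fin 3,
      (∫ p, W p 0 * partialDeriv i ψ p) = -∫ p, W p i.succ * ψ p := by
    intro ψ hψ i
    let G : Omega L → EuclideanSpace ℝ (Fin 4) := fun p =>
      WithLp.toLp 2 (Fin.cons (partialDeriv i ψ p) fun j => if j = i then ψ p else 0)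
    have hG : MemLp G 2 := memLp_cons ((hψ.isTest_partialDeriv i).memLp 2)
      (h := fun j p => if j = i then ψ p else 0) fun j => by
        by_cases hj : j = i
        · simpa [hj] using hψ.memLp 2
        · simp [hj]
    have e : ∀ (s : Omega L → EuclideanSpace ℝ (Fin 4)), MemLp s 2 → ∫ p, inner ℝ (s p) (G p) =
        (∫ p, s p 0 * partialDeriv i ψ p) + ∫ p, s p i.succ * ψ p := by
      intro s hs
      rw [integral_inner_euclidean hs hG, Fin.sum_univ_succ, Fintype.sum_eq_single i]
      · simp [G]
      · intro j hj
        simp [G, hj]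
    have := hann G hG (by
      rintro _ ⟨φ, hφ, rfl⟩
      rw [e _ hφ.memLp_jet]
      simp only [jet, Fin.cons_zero, Fin.cons_succ]
      rw [hφ.integral_partialDeriv_mul hψ]
      ring)
    rw [e W hW] at this
    linarith
  -- The difference `v - w` is an `L²` solution of `Δf = f`, so it vanishes by the Liouville theorem
  -- with `c = 1`.
  have hvW : v =ᵐ[volume] fun p => W p 0 := by
    have hz : (fun p => v p - W p 0) =ᵐ[volume] 0 := by
      refine ae_eq_zero_of_lap (p := 2) 2 (by simp) (hv.sub (hWk 0)) zero_le_one fun φ hφ => ?_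
      have h1 := horth _ ⟨φ, hφ, rfl⟩
      rw [integral_inner_euclidean (hU.sub hW) hφ.memLp_jet, Fin.sum_univ_succ] at h1
      simp only [Pi.sub_apply, PiLp.sub_apply, U, jet, Fin.cons_zero, Fin.cons_succ] at h1
      have h2 : ∀ i : Fin 3, ∫ p, (-h i p - W p i.succ) * partialDeriv i φ p =
          -(∫ p, h i p * partialDeriv i φ p) +
            ∫ p, W p 0 * partialDeriv i (partialDeriv i φ) p := by
        intro i
        rw [hweak _ (hφ.isTest_partialDeriv i) i]
        simp only [sub_mul, neg_mul]
        rw [integral_sub, integral_neg]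
        · ring
        · exact ((hφ.isTest_partialDeriv i).integrable_mul
            ((hh i).locallyIntegrable one_le_two)).neg
        · exact (hφ.isTest_partialDeriv i).integrable_mul (hWl _)
      simp only [h2, Finset.sum_add_distrib, Finset.sum_neg_distrib] at h1
      rw [← heq φ hφ, ← integral_lap (hWl 0) hφ] at h1
      simp only [sub_mul] at h1 ⊢
      rw [integral_sub (hφ.integrable_mul hvl) (hφ.integrable_mul (hWl 0))] at h1 ⊢
      rw [integral_sub (hφ.isTest_lap.integrable_mul hvl) (hφ.isTest_lap.integrable_mul (hWl 0))]
      linarith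
    filter_upwards [hz] with p hp using sub_eq_zero.1 hp
  refine ⟨?_, fun i p => W p i.succ, fun i => hWk _, fun φ hφ i => ?_, ?_⟩
  · rw [memLp_congr_ae hvW]
    refine ⟨(hWk 0).1, ?_⟩
    obtain ⟨C, hC, hsob⟩ := exists_sobolev_const L
    have hcomp : Filter.Tendsto (fun n => eLpNorm ((fun p => s n p 0) - fun p => W p 0) 2 volume)
        Filter.atTop (nhds 0) :=
      tendsto_of_tendsto_of_tendsto_of_le_of_le tendsto_const_nhds hlim (fun _ => zero_le)
        fun n => eLpNorm_component_le (s n - W) 0 2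
    have hsL : ∀ n, MemLp (s n) 2 := fun n => by
      obtain ⟨φ, hφ, e⟩ := hs n
      rw [e]
      exact hφ.memLp_jet
    obtain ⟨ns, hns, hae⟩ := (tendstoInMeasure_of_tendsto_eLpNorm two_ne_zero
      (fun n => (memLp_euclidean_iff.1 (hsL n) 0).1) (hWk 0).1 hcomp).exists_seq_tendsto_ae
    -- The `L⁶` bound passes to the limit by Fatou, along an almost everywhere convergent
    -- subsequence of the approximating jets; Sobolev bounds these uniformly.
    have hfat := Lp.eLpNorm_lim_le_liminf_eLpNorm (p := 6)
      (fun n => (memLp_euclidean_iff.1 (hsL (ns n)) 0).1) (fun p => W p 0) hae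
    refine hfat.trans_lt ?_
    have hev : ∀ᶠ n in Filter.atTop, eLpNorm (fun p => s (ns n) p 0) 6 volume ≤
        C * (4 * (1 + eLpNorm W 2 volume)) := by
      have h1 : ∀ᶠ n in Filter.atTop, eLpNorm (s (ns n) - W) 2 volume ≤ 1 :=
        (hlim.comp hns.tendsto_atTop).eventually_le_const one_pos
      filter_upwards [h1] with n hn
      have hsn : eLpNorm (s (ns n)) 2 volume ≤ 1 + eLpNorm W 2 volume := by
        have : s (ns n) = (s (ns n) - W) + W := by simp
        rw [this]
        exact (eLpNorm_add_le ((hsL _).1.sub hW.1) hW.1 one_le_two).trans (by gcongr)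
      obtain ⟨φ, hφ, e⟩ := hs (ns n)
      rw [e] at hsn ⊢
      refine (hsob φ hφ).trans ?_
      gcongr
      have hk := fun k => (eLpNorm_component_le (μ := volume) (jet φ) k 2).trans hsn
      have h0 := hk 0
      have hi := fun i : Fin 3 => hk i.succ
      simp only [jet, Fin.cons_zero, Fin.cons_succ] at h0 hi
      calc _ ≤ (1 + eLpNorm W 2 volume) + ∑ _i : Fin 3, (1 + eLpNorm W 2 volume) :=
            add_le_add h0 (Finset.sum_le_sum fun i _ => hi i)
        _ = _ := by simp; ring
    refine (Filter.liminf_le_of_frequently_le hev.frequently).trans_lt ?_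
    have := hW.2.ne
    finiteness
  · have e : distDeriv i v φ = -∫ p, W p 0 * partialDeriv i φ p := by
      unfold distDeriv
      congr 1
      refine integral_congr_ae ?_
      filter_upwards [hvW] with p hp
      rw [hp]
    rw [e, hweak φ hφ, neg_neg]
  · have h1 := pow_le_pow_left' hle 2
    rw [eLpNorm_euclidean_sq hW.1, eLpNorm_euclidean_sq hU.1, 
      Fin.sum_univ_succ (fun k => eLpNorm (fun p => W p k) 2 volume ^ 2),
      Fin.sum_univ_succ (fun k => eLpNorm (fun p => U p k) 2 volume ^ 2)] at h1
    simp only [U, Fin.cons_zero, Fin.cons_succ] at h1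
    refine le_add_self.trans (h1.trans (le_of_eq ?_))
    congr 1
    refine Finset.sum_congr rfl fun i _ => ?_
    exact congrArg (· ^ 2) (eLpNorm_neg (h i) 2 volume)

end HelicalOseen

namespace HelicalOseen

variable {L : ℝ}

/-! ### Rotations and screw motions -/

/-- The rotation by `α`, as a linear isometry of the plane. -/
noncomputable def rotIso (α : ℝ) : Plane ≃ₗᵢ[ℝ] Plane where
  toFun := rotate α
  invFun := rotate (-α)
  map_add' x y := by ext i; fin_cases i <;> simp [rotate] <;> ring
  map_smul' a x := by ext i; fin_cases i <;> simp [rotate] <;> ring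
  left_inv x := by
    have h := Real.sin_sq_add_cos_sq α
    ext i
    fin_cases i
    · simp [rotate]
      linear_combination x 0 * h
    · simp [rotate]
      linear_combination x 1 * h
  right_inv x := by
    have h := Real.sin_sq_add_cos_sq α
    ext i
    fin_cases i
    · simp [rotate]
      linear_combination x 0 * h
    · simp [rotate]
      linear_combination x 1 * h
  norm_map' x := by
    have h := Real.sin_sq_add_cos_sq α
    rw [← sq_eq_sq₀ (norm_nonneg _) (norm_nonneg _), EuclideanSpace.norm_sq_eq,
      EuclideanSpace.norm_sq_eq]
    simp [rotate]
    linear_combination (x 0 ^ 2 + x 1 ^ 2) * h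

lemma rotIso_apply (α : ℝ) (x : Plane) : rotIso α x = rotate α x := rfl

lemma norm_rotate (α : ℝ) (x : Plane) : ‖rotate α x‖ = ‖x‖ := (rotIso α).norm_map x

/-- The rigid motion `(x, z) ↦ (R_α x, z) + c`. -/
noncomputable def rigid (α : ℝ) (c : Omega L) : Omega L ≃ₜ Omega L :=
  affineHomeo (rotIso α).toContinuousLinearEquiv c

lemma rigid_apply (α : ℝ) (c p : Omega L) : rigid α c p = (rotate α p.1, p.2) + c := rfl

lemma screw_eq_rigid (α : ℝ) (p : Omega L) :
    screw L α p = rigid α (0, ((L * α : ℝ) : AddCircle (2 * Real.pi * L))) p := by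
  simp [screw, rigid_apply]

/-- The pull-back of a vector field by a screw motion. -/
noncomputable def pull (α : ℝ) (v : Omega L → Vec) (p : Omega L) : Vec :=
  !₂[Real.cos α * v (screw L α p) 0 + Real.sin α * v (screw L α p) 1,
    -Real.sin α * v (screw L α p) 0 + Real.cos α * v (screw L α p) 1, v (screw L α p) 2]

/-- Off the axis the frame `(e_r, e_θ)` at the screwed point is the rotated frame at `p`. This
replaces cylindrical components by a Cartesian pull-back, which is compatible with distributional
derivatives. -/
lemma components_eq_iff (α : ℝ) (v : Omega L → Vec) {p : Omega L} (hp : p.1 ≠ 0) :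
    pull α v p = v p ↔
      (inner ℝ (v (screw L α p)) (eR (screw L α p)) = inner ℝ (v p) (eR p) ∧
      inner ℝ (v (screw L α p)) (eTheta (screw L α p)) = inner ℝ (v p) (eTheta p) ∧
      inner ℝ (v (screw L α p)) eZ = inner ℝ (v p) eZ) := by
  have hr : (0 : ℝ) < ‖p.1‖ := norm_pos_iff.2 hp
  have hr2 : ‖p.1‖ ^ 2 = p.1 0 ^ 2 + p.1 1 ^ 2 := by
    rw [EuclideanSpace.norm_sq_eq]; simp
  have h := Real.sin_sq_add_cos_sq α
  set r := ‖p.1‖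
  set c := Real.cos α with hc
  set s := Real.sin α with hs
  set a := v (screw L α p)
  set b := v p
  have hrad : radius (screw L α p) = r := norm_rotate α p.1
  have hrad' : radius p = r := rfl
  have e0 : (screw L α p).1 0 = c * p.1 0 - s * p.1 1 := by simp [screw, rotate, hc, hs]
  have e1 : (screw L α p).1 1 = s * p.1 0 + c * p.1 1 := by simp [screw, rotate, hc, hs]
  simp only [inner_euclidean, Fin.sum_univ_three, eR, eTheta, eZ, hrad, hrad', e0, e1]
  simp only [Matrix.cons_val_zero, Matrix.cons_val_one, Matrix.cons_val_two, Matrix.tail_cons,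
    Matrix.head_cons, mul_zero, add_zero, zero_add, mul_one]
  have hpull : pull α v p = b ↔ (c * a 0 + s * a 1 = b 0 ∧ -s * a 0 + c * a 1 = b 1 ∧
      a 2 = b 2) := by
    rw [← WithLp.ofLp_injective 2 |>.eq_iff, funext_iff, Fin.forall_fin_succ, Fin.forall_fin_succ, Fin.forall_fin_one]
    rfl
  rw [hpull, ← and_assoc, ← and_assoc]
  refine and_congr_left' ?_
  set x := p.1 0
  set y := p.1 1
  constructor
  · rintro ⟨h1, h2⟩
    constructor
    · rw [← h1, ← h2]; ring
    · rw [← h1, ← h2]; ring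
  · rintro ⟨h1, h2⟩
    field_simp at h1 h2
    have hd : r ^ 2 ≠ 0 := by positivity
    constructor
    · apply mul_left_cancel₀ hd
      rw [hr2]
      linear_combination x * h1 - y * h2
    · apply mul_left_cancel₀ hd
      rw [hr2]
      linear_combination y * h1 + x * h2

/-- Supplies the test function for changing variables in weak identities: `ψ` is `φ` composed with
the inverse screw motion, and the formulas are the chain rule. -/
lemma exists_comp_screw {φ : Omega L → ℝ} (hφ : IsTest φ) (α : ℝ) :
    ∃ ψ : Omega L → ℝ, IsTest ψ ∧ (∀ p, φ p = ψ (screw L α p)) ∧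
      (∀ p, partialDeriv 0 φ p = Real.cos α * partialDeriv 0 ψ (screw L α p) +
        Real.sin α * partialDeriv 1 ψ (screw L α p)) ∧
      (∀ p, partialDeriv 1 φ p = -Real.sin α * partialDeriv 0 ψ (screw L α p) +
        Real.cos α * partialDeriv 1 ψ (screw L α p)) ∧
      (∀ p, partialDeriv 2 φ p = partialDeriv 2 ψ (screw L α p)) := by
  set c : Omega L := (0, ((L * α : ℝ) : AddCircle (2 * Real.pi * L))) with hc
  have hψ := hφ.comp_affine (rotIso (-α)).toContinuousLinearEquiv (-c)
  have hinv : ∀ p : Omega L, affineHomeo (rotIso (-α)).toContinuousLinearEquiv (-c)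
      (screw L α p) = p := by
    intro p
    refine Prod.ext ?_ ?_
    · simp only [affineHomeo_apply, screw, hc, Prod.fst_add, Prod.fst_neg, neg_zero, add_zero]
      exact (rotIso α).symm_apply_apply p.1
    · simp [affineHomeo_apply, screw, hc]
  have hφψ : φ = fun p => (fun p => φ (affineHomeo (rotIso (-α)).toContinuousLinearEquiv (-c) p))
      (affineHomeo (rotIso α).toContinuousLinearEquiv c p) := by
    funext p
    have := hinv p
    rw [screw_eq_rigid] at this
    exact (congrArg φ this).symm
  refine ⟨_, hψ, fun p => by rw [hinv], fun p => ?_, fun p => ?_, fun p => ?_⟩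
  · conv_lhs => rw [hφψ]
    rw [hψ.isSmooth.partialDeriv_comp_affine, screw_eq_rigid]
    simp [basisVec, rotIso_apply, rotate, rigid, hc]
  · conv_lhs => rw [hφψ]
    rw [hψ.isSmooth.partialDeriv_comp_affine, screw_eq_rigid]
    simp [basisVec, rotIso_apply, rotate, rigid, hc]
  · conv_lhs => rw [hφψ]
    rw [hψ.isSmooth.partialDeriv_comp_affine, screw_eq_rigid]
    simp [basisVec, rotIso_apply, rotate, rigid, hc]

/-! ### Screw motions preserve the measure and act on divergence and curl -/

variable [Fact (0 < L)]

lemma measurePreserving_rigid (α : ℝ) (c : Omega L) : MeasurePreserving (rigid α c) := by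
  have h1 := ((rotIso α).measurePreserving).prod
    (MeasurePreserving.id (volume : Measure (AddCircle (2 * Real.pi * L))))
  exact (measurePreserving_add_right (volume : Measure (Omega L)) c).comp h1

lemma integral_comp_rigid (α : ℝ) (c : Omega L) (f : Omega L → ℝ) :
    ∫ p, f (rigid α c p) = ∫ p, f p :=
  (measurePreserving_rigid α c).integral_comp (rigid α c).measurableEmbedding f

lemma ae_ne_axis : ∀ᵐ p : Omega L, p.1 ≠ 0 := by
  have h : ∀ᵐ x : Plane, x ≠ 0 := by simp [ae_iff]
  exact (Measure.quasiMeasurePreserving_fst (μ := (volume : Measure Plane))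
    (ν := (volume : Measure (AddCircle (2 * Real.pi * L))))).ae h

lemma isHelical_iff {v : Omega L → Vec} : IsHelical v ↔ ∀ α, pull α v =ᵐ[volume] v := by
  constructor
  · rintro ⟨h1, h2, h3⟩ α
    filter_upwards [h1 α, h2 α, h3 α, ae_ne_axis] with p a b c hp
    exact (components_eq_iff α v hp).2 ⟨a, b, c⟩
  · intro h
    refine ⟨fun α => ?_, fun α => ?_, fun α => ?_⟩
    · filter_upwards [h α, ae_ne_axis] with p a hp
      exact ((components_eq_iff α v hp).1 a).1
    · filter_upwards [h α, ae_ne_axis] with p a hp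
      exact ((components_eq_iff α v hp).1 a).2.1
    · filter_upwards [h α, ae_ne_axis] with p a hp
      exact ((components_eq_iff α v hp).1 a).2.2

lemma measurePreserving_screw (α : ℝ) : MeasurePreserving (screw L α) := by
  have e : screw L α = rigid α (0, ((L * α : ℝ) : AddCircle (2 * Real.pi * L))) :=
    funext (screw_eq_rigid α)
  rw [e]
  exact measurePreserving_rigid _ _

lemma pull_congr {v w : Omega L → Vec} (h : v =ᵐ[volume] w) (α : ℝ) :
    pull α v =ᵐ[volume] pull α w := by
  filter_upwards [(measurePreserving_screw α).quasiMeasurePreserving.ae h] with p hp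
  simp only [pull, hp]

lemma isHelical_congr {v w : Omega L → Vec} (h : v =ᵐ[volume] w) (hv : IsHelical v) :
    IsHelical w :=
  isHelical_iff.2 fun α => (pull_congr h α).symm.trans ((isHelical_iff.1 hv α).trans h)

lemma IsHelical.add {v w : Omega L → Vec} (hv : IsHelical v) (hw : IsHelical w) :
    IsHelical (fun p => v p + w p) := by
  rw [isHelical_iff] at *
  intro α
  filter_upwards [hv α, hw α] with p h1 h2
  rw [← h1, ← h2]
  ext i
  fin_cases i <;> simp [pull] <;> ring

lemma IsHelical.const_smul {v : Omega L → Vec} (hv : IsHelical v) (a : ℝ) :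
    IsHelical (fun p => a • v p) := by
  rw [isHelical_iff] at *
  intro α
  filter_upwards [hv α] with p h1
  rw [← h1]
  ext i
  fin_cases i <;> simp [pull] <;> ring

lemma memLp_pull {v : Omega L → Vec} {q : ℝ≥0∞} (hv : MemLp v q) (α : ℝ) :
    MemLp (pull α v) q := by
  have h := memLp_euclidean_iff.1 (hv.comp_measurePreserving (measurePreserving_screw α))
  refine memLp_euclidean_iff.2 fun i => ?_
  fin_cases i
  · exact ((h 0).const_mul _).add ((h 1).const_mul _)
  · exact ((h 0).const_mul _).add ((h 1).const_mul _)
  · exact h 2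

lemma integral_bilinear {f₁ f₂ g₁ g₂ : Omega L → ℝ} (hf₁ : LocallyIntegrable f₁)
    (hf₂ : LocallyIntegrable f₂) (hg₁ : IsTest g₁) (hg₂ : IsTest g₂) (a b c d : ℝ) :
    ∫ p, (a * f₁ p + b * f₂ p) * (c * g₁ p + d * g₂ p) =
      a * c * (∫ p, f₁ p * g₁ p) + a * d * (∫ p, f₁ p * g₂ p) +
        b * c * (∫ p, f₂ p * g₁ p) + b * d * (∫ p, f₂ p * g₂ p) := by
  have e : ∀ p, (a * f₁ p + b * f₂ p) * (c * g₁ p + d * g₂ p) =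
      a * c * (f₁ p * g₁ p) + a * d * (f₁ p * g₂ p) + b * c * (f₂ p * g₁ p) +
        b * d * (f₂ p * g₂ p) := fun p => by ring
  simp only [e]
  have h11 := (hg₁.integrable_mul hf₁).const_mul (a * c)
  have h12 := (hg₂.integrable_mul hf₁).const_mul (a * d)
  have h21 := (hg₁.integrable_mul hf₂).const_mul (b * c)
  have h22 := (hg₂.integrable_mul hf₂).const_mul (b * d)
  have h1 : Integrable fun p => a * c * (f₁ p * g₁ p) + a * d * (f₁ p * g₂ p) := h11.add h12
  have h2 : Integrable fun p => a * c * (f₁ p * g₁ p) + a * d * (f₁ p * g₂ p) +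
      b * c * (f₂ p * g₁ p) := h1.add h21
  rw [integral_add h2 h22, integral_add h1 h21, integral_add h11 h12]
  simp only [integral_const_mul]

lemma integral_comp_screw (α : ℝ) (f : Omega L → ℝ) :
    ∫ p, f (screw L α p) = ∫ p, f p := by
  simp only [screw_eq_rigid]
  exact integral_comp_rigid _ _ f

lemma integral_pull {v : Omega L → Vec} (hv : LocallyIntegrable v) {g₁ g₂ : Omega L → ℝ}
    (hg₁ : IsTest g₁) (hg₂ : IsTest g₂) (α c d : ℝ) :
    (∫ p, pull α v p 0 * (c * g₁ (screw L α p) + d * g₂ (screw L α p)) =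
      Real.cos α * c * (∫ p, v p 0 * g₁ p) + Real.cos α * d * (∫ p, v p 0 * g₂ p) +
        Real.sin α * c * (∫ p, v p 1 * g₁ p) + Real.sin α * d * (∫ p, v p 1 * g₂ p)) ∧
    (∫ p, pull α v p 1 * (c * g₁ (screw L α p) + d * g₂ (screw L α p)) =
      -Real.sin α * c * (∫ p, v p 0 * g₁ p) + -Real.sin α * d * (∫ p, v p 0 * g₂ p) +
        Real.cos α * c * (∫ p, v p 1 * g₁ p) + Real.cos α * d * (∫ p, v p 1 * g₂ p)) ∧
    (∫ p, pull α v p 2 * (c * g₁ (screw L α p) + d * g₂ (screw L α p)) =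
      c * (∫ p, v p 2 * g₁ p) + d * (∫ p, v p 2 * g₂ p)) := by
  have hl := locallyIntegrable_component hv
  refine ⟨?_, ?_, ?_⟩
  · rw [← integral_bilinear (hl 0) (hl 1) hg₁ hg₂]
    exact integral_comp_screw α fun p => (Real.cos α * v p 0 + Real.sin α * v p 1) *
      (c * g₁ p + d * g₂ p)
  · rw [← integral_bilinear (hl 0) (hl 1) hg₁ hg₂]
    exact integral_comp_screw α fun p => (-Real.sin α * v p 0 + Real.cos α * v p 1) *
      (c * g₁ p + d * g₂ p)
  · have := integral_bilinear (hl 2) (hl 2) hg₁ hg₂ 1 0 c d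
    simp only [one_mul, zero_mul, add_zero] at this
    rw [← this]
    exact integral_comp_screw α fun p => v p 2 * (c * g₁ p + d * g₂ p)

/-- After the change of variables the rotation matrices on `v` and on the gradient of the test
function cancel, through `sin² + cos² = 1`. -/
lemma isDivFree_pull {v : Omega L → Vec} (hv : IsDivFree v) (α : ℝ)
    (hl : LocallyIntegrable (pull α v)) : IsDivFree (pull α v) := by
  rw [isDivFree_iff hl]
  intro φ hφ
  obtain ⟨ψ, hψ, e, e0, e1, e2⟩ := exists_comp_screw hφ α
  have ht := hψ.isTest_partialDeriv
  have h := (isDivFree_iff hv.locallyIntegrable).1 hv ψ hψ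
  rw [Fin.sum_univ_three] at h ⊢
  have e2' : ∀ p, partialDeriv 2 φ p = 1 * partialDeriv 2 ψ (screw L α p) +
      0 * partialDeriv 2 ψ (screw L α p) := fun p => by rw [e2]; ring
  simp only [e0, e1, e2']
  rw [(integral_pull hv.locallyIntegrable (ht 0) (ht 1) α _ _).1,
    (integral_pull hv.locallyIntegrable (ht 0) (ht 1) α _ _).2.1,
    (integral_pull hv.locallyIntegrable (ht 2) (ht 2) α _ _).2.2]
  linear_combination h + ((∫ p, v p 0 * partialDeriv 0 ψ p) +
    ∫ p, v p 1 * partialDeriv 1 ψ p) * Real.sin_sq_add_cos_sq α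

/-- The curl commutes with proper rotations: the two horizontal equations are mixed by the rotation
and the vertical one is unchanged. -/
lemma hasCurl_pull {v ω : Omega L → Vec} (hv : HasCurl v ω) (α : ℝ)
    (hl : LocallyIntegrable (pull α v)) (hl' : LocallyIntegrable (pull α ω)) :
    HasCurl (pull α v) (pull α ω) := by
  have key : ∀ φ, IsTest φ →
      ((-∫ p, pull α v p 2 * partialDeriv 1 φ p) - (-∫ p, pull α v p 1 * partialDeriv 2 φ p) =
        ∫ p, pull α ω p 0 * φ p) ∧
      ((-∫ p, pull α v p 0 * partialDeriv 2 φ p) - (-∫ p, pull α v p 2 * partialDeriv 0 φ p) =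
        ∫ p, pull α ω p 1 * φ p) ∧
      ((-∫ p, pull α v p 1 * partialDeriv 0 φ p) - (-∫ p, pull α v p 0 * partialDeriv 1 φ p) =
        ∫ p, pull α ω p 2 * φ p) := fun φ hφ => by
    obtain ⟨ψ, hψ, e, e0, e1, e2⟩ := exists_comp_screw hφ α
    have ht := hψ.isTest_partialDeriv
    have hx := hv.curl_x ψ hψ
    have hy := hv.curl_y ψ hψ
    have hz := hv.curl_z ψ hψ
    have e2' : ∀ p, partialDeriv 2 φ p = 1 * partialDeriv 2 ψ (screw L α p) +
        0 * partialDeriv 2 ψ (screw L α p) := fun p => by rw [e2]; ring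
    have e' : ∀ p, φ p = 1 * ψ (screw L α p) + 0 * ψ (screw L α p) := fun p => by rw [e]; ring
    have i01 := integral_pull hv.locallyIntegrable (ht 0) (ht 1) α
    have i2 := integral_pull hv.locallyIntegrable (ht 2) (ht 2) α
    have iω := integral_pull hv.locallyIntegrable_curl hψ hψ α
    have h := Real.sin_sq_add_cos_sq α
    simp only [distDeriv] at hx hy hz
    refine ⟨?_, ?_, ?_⟩
    · simp only [e', e1, e2']
      rw [(i01 _ _).2.2, (i2 _ _).2.1, (iω _ _).1]
      linear_combination Real.cos α * hx + Real.sin α * hy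
    · simp only [e', e0, e2']
      rw [(i01 _ _).2.2, (i2 _ _).1, (iω _ _).2.1]
      linear_combination -Real.sin α * hx + Real.cos α * hy
    · simp only [e', e0, e1]
      rw [(i01 _ _).1, (i01 _ _).2.1, (iω _ _).2.2]
      linear_combination hz + ((∫ p, v p 0 * partialDeriv 1 ψ p) -
        ∫ p, v p 1 * partialDeriv 0 ψ p) * h
  exact ⟨hl, hl', fun φ hφ => (key φ hφ).1, fun φ hφ => (key φ hφ).2.1, fun φ hφ => (key φ hφ).2.2⟩

lemma HasCurl.congr_right {v ω ω' : Omega L → Vec} (h : HasCurl v ω) (hω : ω =ᵐ[volume] ω') :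
    HasCurl v ω' := by
  have e : ∀ (φ : Omega L → ℝ) i, ∫ p, ω p i * φ p = ∫ p, ω' p i * φ p := fun φ i => by
    refine integral_congr_ae ?_
    filter_upwards [hω] with p hp
    rw [hp]
  refine ⟨h.locallyIntegrable, h.locallyIntegrable_curl.congr hω, fun φ hφ => ?_, fun φ hφ => ?_,
    fun φ hφ => ?_⟩
  · rw [h.curl_x φ hφ, e]
  · rw [h.curl_y φ hφ, e]
  · rw [h.curl_z φ hφ, e]

/-- A square integrable solenoidal field with helical curl is helical. -/
lemma isHelical_of_curl {v ω : Omega L → Vec} (hv : MemLp v 2) (hd : IsDivFree v)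
    (hc : HasCurl v ω) (hω : MemLp ω 2) (hh : IsHelical ω) : IsHelical v := by
  rw [isHelical_iff] at *
  intro α
  have hpv := memLp_pull hv α
  have hl := hpv.locallyIntegrable one_le_two
  -- Since `ω` is helical, `pull α v` solves the same div-curl system as `v`.
  refine ae_eq_of_curl_eq (p := 2) 2 (by simp) hpv hv (isDivFree_pull hd α hl) hd ?_ hc
  exact (hasCurl_pull hc α hl ((memLp_pull hω α).locallyIntegrable one_le_two)).congr_right (hh α)

end HelicalOseen

namespace HelicalOseen

/-! ### From a square integrable field with prescribed curl to an element of `H` -/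

variable {L : ℝ} [Fact (0 < L)]

lemma ennreal_sqrt_le (a b : ℝ≥0∞) : (2 * a ^ 2 + 2 * b ^ 2) ^ (1 / 2 : ℝ) ≤ 2 * (a + b) := by
  have h : 2 * a ^ 2 + 2 * b ^ 2 ≤ (2 * (a + b)) ^ 2 := by
    calc 2 * a ^ 2 + 2 * b ^ 2 ≤ 2 * a ^ 2 + 2 * b ^ 2 + (2 * a ^ 2 + 8 * (a * b) + 2 * b ^ 2) :=
          le_self_add
      _ = _ := by ring
  calc _ ≤ ((2 * (a + b)) ^ 2) ^ (1 / 2 : ℝ) := ENNReal.rpow_le_rpow h (by norm_num)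
    _ = _ := by rw [← ENNReal.rpow_natCast, ← ENNReal.rpow_mul]; norm_num

/-- Solenoidal fields with square integrable curl are in `H¹ ∩ L⁶`. -/
lemma memH1_of_curl {v ω : Omega L → Vec} (hv : MemLp v 2) (hd : IsDivFree v)
    (hc : HasCurl v ω) (hω : MemLp ω 2) :
    MemH1 v ∧ MemLp v 6 ∧
      h1Norm v ≤ 2 * (eLpNorm v 2 volume + eLpNorm ω 2 volume) := by
  have hvj := memLp_euclidean_iff.1 hv
  have hωj := memLp_euclidean_iff.1 hω
  have hsrc : ∀ j i, MemLp (curlSource ω j i) 2 := by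
    intro j i
    fin_cases j <;> fin_cases i
    · exact MemLp.zero
    · exact hωj 2
    · exact (hωj 1).neg
    · exact (hωj 2).neg
    · exact MemLp.zero
    · exact hωj 0
    · exact hωj 1
    · exact (hωj 0).neg
    · exact MemLp.zero
  have key := fun j => exists_weakGradient_of_lap (hvj j) (hsrc j)
    fun φ hφ => integral_lap_of_curl hd hc hφ j
  choose h6 G hG hGφ hGn using key
  let D : Fin 3 → Omega L → Vec := fun i p => WithLp.toLp 2 fun j => G j i p
  have hD : ∀ i, MemLp (D i) 2 := fun i => memLp_euclidean_iff.2 fun j => hG j i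
  have hgrad : IsWeakGradient v D :=
    ⟨hv.locallyIntegrable one_le_two, fun i => (hD i).locallyIntegrable one_le_two,
      fun φ hφ i j => hGφ j φ hφ i⟩
  refine ⟨⟨hv, D, hgrad, hD⟩, memLp_euclidean_iff.2 h6, ?_⟩
  refine (iInf₂_le D hgrad).trans ((ENNReal.rpow_le_rpow ?_ (by norm_num)).trans
    (ennreal_sqrt_le _ _))
  have e1 : ∑ i, eLpNorm (D i) 2 volume ^ 2 = ∑ j, ∑ i, eLpNorm (G j i) 2 volume ^ 2 := by
    rw [Finset.sum_comm]
    exact Finset.sum_congr rfl fun i _ => eLpNorm_euclidean_sq (hD i).1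
  -- Each component of `ω` occurs twice in the antisymmetric array.
  have e2 : ∑ j, ∑ i, eLpNorm (curlSource ω j i) 2 volume ^ 2 = 2 * eLpNorm ω 2 volume ^ 2 := by
    rw [eLpNorm_euclidean_sq hω.1]
    have hneg : ∀ k : Fin 3, eLpNorm (fun p => -ω p k) 2 volume = eLpNorm (fun p => ω p k) 2 volume :=
      fun k => eLpNorm_neg (fun p => ω p k) 2 volume
    simp [Fin.sum_univ_three, curlSource, hneg]
    ring
  rw [e1, two_mul (eLpNorm v 2 volume ^ 2), add_assoc]
  gcongr
  calc _ ≤ ∑ j, (eLpNorm (fun p => v p j) 2 volume ^ 2 +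
        ∑ i, eLpNorm (curlSource ω j i) 2 volume ^ 2) := Finset.sum_le_sum fun j _ => hGn j
    _ = _ := by rw [Finset.sum_add_distrib, e2, ← eLpNorm_euclidean_sq hv.1]

/-- From a square integrable field with helical curl to a field in `H`. -/
lemma exists_memH_of_curl {u ω : Omega L → Vec} (hu : MemLp u 2) (hc : HasCurl u ω)
    (hω : MemLp ω 2) (hh : IsHelical ω) :
    ∃ v : Omega L → Vec, MemH v ∧ MemLp v 6 ∧ HasCurl v ω ∧
      h1Norm v ≤ 2 * (eLpNorm u 2 volume + eLpNorm ω 2 volume) := by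
  obtain ⟨v, hv, hle, hd, hvc⟩ := exists_divFree_of_hasCurl hu hc
  obtain ⟨h1, h6, hn⟩ := memH1_of_curl hv hd hvc hω
  exact ⟨v, ⟨h1, hd, isHelical_of_curl hv hd hvc hω hh⟩, h6, hvc, hn.trans (by gcongr)⟩

/-! ### Superpositions -/

section Minkowski

variable {α β : Type*} [MeasurableSpace α] [MeasurableSpace β] {μ : Measure α} {ν : Measure β}

lemma lintegral_mul_le_of_sq_le {f g : α → ℝ≥0∞} (hf : Measurable f) (hg : Measurable g)
    {a b : ℝ≥0∞} (ha : ∫⁻ x, f x ^ 2 ∂μ ≤ a ^ 2) (hb : ∫⁻ x, g x ^ 2 ∂μ ≤ b ^ 2) :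
    ∫⁻ x, f x * g x ∂μ ≤ a * b := by
  have h := ENNReal.lintegral_mul_le_Lp_mul_Lq μ Real.HolderConjugate.two_two hf.aemeasurable
    hg.aemeasurable
  simp only [ENNReal.rpow_ofNat] at h
  refine h.trans ?_
  have hs : ∀ c : ℝ≥0∞, (c ^ 2) ^ (1 / 2 : ℝ) = c := fun c => by
    rw [← ENNReal.rpow_natCast, ← ENNReal.rpow_mul]; norm_num
  rw [← hs a, ← hs b]
  gcongr

variable [SFinite μ] [SFinite ν]

/-- Minkowski's integral inequality in `L²`. -/
lemma lintegral_lintegral_sq_le {g : β → α → ℝ≥0∞} (hg : Measurable (Function.uncurry g))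
    {B : β → ℝ≥0∞} (hBm : AEMeasurable B ν) (hB : ∀ᵐ s ∂ν, ∫⁻ x, g s x ^ 2 ∂μ ≤ B s ^ 2) :
    ∫⁻ x, (∫⁻ s, g s x ∂ν) ^ 2 ∂μ ≤ (∫⁻ s, B s ∂ν) ^ 2 := by
  have hg1 : ∀ s, Measurable (g s) := fun s => hg.comp (by fun_prop : Measurable fun x => (s, x))
  have hg2 : ∀ x, Measurable fun s => g s x := fun x =>
    hg.comp (by fun_prop : Measurable fun s => (s, x))
  have hI : Measurable fun x => ∫⁻ s, g s x ∂ν := by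
    exact Measurable.lintegral_prod_left' hg
  -- The square is expanded into a double integral over `s` and `t`, and Cauchy-Schwarz in `x` is
  -- applied for each pair.
  calc ∫⁻ x, (∫⁻ s, g s x ∂ν) ^ 2 ∂μ
      = ∫⁻ x, ∫⁻ s, g s x * ∫⁻ t, g t x ∂ν ∂ν ∂μ := by
        refine lintegral_congr fun x => ?_
        rw [lintegral_mul_const _ (hg2 x), sq]
    _ = ∫⁻ s, ∫⁻ x, g s x * ∫⁻ t, g t x ∂ν ∂μ ∂ν := by
        rw [lintegral_lintegral_swap]
        refine Measurable.aemeasurable ?_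
        exact (hg.comp measurable_swap).mul (hI.comp measurable_fst)
    _ = ∫⁻ s, ∫⁻ t, ∫⁻ x, g s x * g t x ∂μ ∂ν ∂ν := by
        refine lintegral_congr fun s => ?_
        rw [lintegral_lintegral_swap]
        · refine lintegral_congr fun x => ?_
          rw [lintegral_const_mul _ (hg2 x)]
        · refine Measurable.aemeasurable ?_
          exact ((hg1 s).comp measurable_snd).mul hg
    _ ≤ ∫⁻ s, ∫⁻ t, B s * B t ∂ν ∂ν := by
        refine lintegral_mono_ae ?_
        filter_upwards [hB] with s hs
        refine lintegral_mono_ae ?_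
        filter_upwards [hB] with t ht
        exact lintegral_mul_le_of_sq_le (hg1 s) (hg1 t) hs ht
    _ = (∫⁻ s, B s ∂ν) ^ 2 := by
        simp only [lintegral_const_mul'' _ hBm]
        rw [lintegral_mul_const'' _ hBm, sq]

end Minkowski

/-- A family of transformations `τ s` of `Ω`, with inverses `σ s`, which scale the volume by
`(j s)⁻²`, together with a weight `w` such that `w * j` is integrable. -/
structure IsSuperposition (ν : Measure ℝ) (w j : ℝ → ℝ) (τ σ : ℝ → Omega L → Omega L) : Prop where
  measurable_w : Measurable w
  measurable_j : Measurable j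
  measurable_τ : Measurable (Function.uncurry τ)
  measurable_σ : Measurable (Function.uncurry σ)
  inv : ∀ᵐ s ∂ν, ∀ p, σ s (τ s p) = p
  nonneg : ∀ᵐ s ∂ν, 0 ≤ j s
  map_eq : ∀ᵐ s ∂ν, Measure.map (τ s) volume = ENNReal.ofReal (j s ^ 2) • volume
  integrable : Integrable (fun s => w s * j s) ν

/-- The superposition `∫ w(s) f ∘ τ s ds`. -/
noncomputable def superpose (ν : Measure ℝ) (w : ℝ → ℝ) (τ : ℝ → Omega L → Omega L)
    (f : Omega L → ℝ) (p : Omega L) : ℝ := ∫ s, w s * f (τ s p) ∂ν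

namespace IsSuperposition

variable {ν : Measure ℝ} {w j : ℝ → ℝ} {τ σ : ℝ → Omega L → Omega L}
  (h : IsSuperposition ν w j τ σ)
include h

lemma lintegral_comp : ∀ᵐ s ∂ν, ∀ g : Omega L → ℝ≥0∞, Measurable g →
    ∫⁻ p, g (τ s p) = ENNReal.ofReal (j s ^ 2) * ∫⁻ p, g p := by
  filter_upwards [h.map_eq] with s hs g hg
  have hτ : Measurable (τ s) := h.measurable_τ.comp (by fun_prop : Measurable fun p => (s, p))
  rw [← lintegral_map hg hτ, hs, lintegral_smul_measure, smul_eq_mul]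

/-- Scaling the measure by `j²` scales `L²` norms by `j`; this is why `w * j` is the function
required to be integrable. -/
lemma sq_le {f : Omega L → ℝ} (hf : Measurable f) : ∀ᵐ s ∂ν,
    ∫⁻ p, (‖w s‖ₑ * ‖f (τ s p)‖ₑ) ^ 2 ≤ (‖w s * j s‖ₑ * eLpNorm f 2 volume) ^ 2 := by
  filter_upwards [h.lintegral_comp, h.nonneg] with s hs hj
  have hm : Measurable fun q => (‖w s‖ₑ * ‖f q‖ₑ) ^ 2 := by fun_prop
  rw [hs _ hm]
  simp only [mul_pow]
  rw [lintegral_const_mul _ (by fun_prop), ← eLpNorm_two_sq, enorm_mul, mul_pow,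
    ENNReal.ofReal_pow hj, ← Real.enorm_of_nonneg hj]
  exact le_of_eq (by ring)

lemma integral_slice {f φ : Omega L → ℝ} (hf : Measurable f) (hφ : Measurable φ) :
    ∀ᵐ s ∂ν, ∫ p, w s * f (τ s p) * φ p = w s * j s ^ 2 * ∫ q, f q * φ (σ s q) := by
  filter_upwards [h.map_eq, h.inv] with s hs hi
  have hτ : Measurable (τ s) := h.measurable_τ.comp (by fun_prop : Measurable fun p => (s, p))
  have hσ : Measurable (σ s) := h.measurable_σ.comp (by fun_prop : Measurable fun p => (s, p))
  have hg : Measurable fun q => f q * φ (σ s q) := hf.mul (hφ.comp hσ)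
  have h1 := integral_map (μ := volume) hτ.aemeasurable (f := fun q => f q * φ (σ s q))
    hg.aestronglyMeasurable
  rw [hs, integral_smul_measure, ENNReal.toReal_ofReal (sq_nonneg _), smul_eq_mul] at h1
  simp only [hi] at h1
  simp only [mul_assoc]
  rw [h1, integral_const_mul]

variable [SFinite ν]

lemma measurable_superpose {f : Omega L → ℝ} (hf : Measurable f) :
    Measurable (superpose ν w τ f) := by
  have hm : Measurable fun x : Omega L × ℝ => w x.2 * f (τ x.2 x.1) :=
    (h.measurable_w.comp measurable_snd).mul (hf.comp (h.measurable_τ.comp measurable_swap))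
  exact hm.stronglyMeasurable.integral_prod_right'.measurable

lemma eLpNorm_superpose_le {f : Omega L → ℝ} (hf : Measurable f) :
    eLpNorm (superpose ν w τ f) 2 volume ≤ (∫⁻ s, ‖w s * j s‖ₑ ∂ν) * eLpNorm f 2 volume := by
  have hwj : Measurable fun s => ‖w s * j s‖ₑ := (h.measurable_w.mul h.measurable_j).enorm
  rw [← ENNReal.pow_le_pow_left_iff two_ne_zero, eLpNorm_two_sq, ← lintegral_mul_const _ hwj]
  refine le_trans (lintegral_mono fun p => ?_) (lintegral_lintegral_sq_le
    (g := fun s p => ‖w s‖ₑ * ‖f (τ s p)‖ₑ) ?_ (hwj.mul_const _).aemeasurable (h.sq_le hf))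
  · refine pow_le_pow_left' ((enorm_integral_le_lintegral_enorm _).trans (le_of_eq ?_)) 2
    simp only [enorm_mul]
  · exact (h.measurable_w.comp measurable_fst).enorm.mul (hf.comp h.measurable_τ).enorm

lemma memLp_superpose {f : Omega L → ℝ} (hf : Measurable f) (hf2 : MemLp f 2) :
    MemLp (superpose ν w τ f) 2 := by
  refine ⟨(h.measurable_superpose hf).aestronglyMeasurable,
    (h.eLpNorm_superpose_le hf).trans_lt ?_⟩
  exact ENNReal.mul_lt_top h.integrable.2 hf2.2

lemma integrable_prod {f φ : Omega L → ℝ} (hf : Measurable f) (hf2 : MemLp f 2)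
    (hφ : Measurable φ) (hφ2 : MemLp φ 2) :
    Integrable (fun x : ℝ × Omega L => w x.1 * f (τ x.1 x.2) * φ x.2) (ν.prod volume) := by
  have hm : Measurable (fun x : ℝ × Omega L => w x.1 * f (τ x.1 x.2) * φ x.2) :=
    ((h.measurable_w.comp measurable_fst).mul (hf.comp h.measurable_τ)).mul
      (hφ.comp measurable_snd)
  have hwj : Measurable fun s => ‖w s * j s‖ₑ := (h.measurable_w.mul h.measurable_j).enorm
  refine ⟨hm.aestronglyMeasurable, ?_⟩
  rw [HasFiniteIntegral, lintegral_prod _ hm.enorm.aemeasurable]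
  calc _ ≤ ∫⁻ s, ‖w s * j s‖ₑ * eLpNorm f 2 volume * eLpNorm φ 2 volume ∂ν := by
        refine lintegral_mono_ae ?_
        filter_upwards [h.sq_le hf] with s hs
        simp only [enorm_mul] at hs ⊢
        have hτ : Measurable (τ s) := h.measurable_τ.comp (by fun_prop : Measurable fun p => (s, p))
        exact lintegral_mul_le_of_sq_le (by fun_prop) (by fun_prop) hs (eLpNorm_two_sq φ).ge
    _ < ∞ := by
        simp only [mul_assoc]
        rw [lintegral_mul_const _ hwj]
        exact ENNReal.mul_lt_top h.integrable.2 (ENNReal.mul_lt_top hf2.2 hφ2.2)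

/-- Moves the transformation to the test function and keeps the `s`-integral outside, so that an
identity known for each fixed `s` can be inserted. `integral_superpose_swap` instead places the
`s`-integral on the test function. -/
lemma integral_superpose {f φ : Omega L → ℝ} (hf : Measurable f) (hf2 : MemLp f 2)
    (hφ : Measurable φ) (hφ2 : MemLp φ 2) :
    Integrable (fun s => w s * j s ^ 2 * ∫ q, f q * φ (σ s q)) ν ∧
    ∫ p, superpose ν w τ f p * φ p = ∫ s, w s * j s ^ 2 * (∫ q, f q * φ (σ s q)) ∂ν := by
  have hint := h.integrable_prod hf hf2 hφ hφ2
  refine ⟨hint.integral_prod_left.congr (h.integral_slice hf hφ), ?_⟩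
  rw [← integral_congr_ae (h.integral_slice hf hφ), integral_integral_swap hint]
  congr 1
  funext p
  rw [superpose, ← integral_mul_const]

lemma integrable_prod_swap {f φ : Omega L → ℝ} (hf : Measurable f) (hf2 : MemLp f 2)
    (hφ : Measurable φ) (hφ2 : MemLp φ 2) :
    Integrable (fun x : ℝ × Omega L => f x.2 * (w x.1 * j x.1 ^ 2 * φ (σ x.1 x.2)))
      (ν.prod volume) := by
  have hm : Measurable (fun x : ℝ × Omega L => f x.2 * (w x.1 * j x.1 ^ 2 * φ (σ x.1 x.2))) :=
    (hf.comp measurable_snd).mul (((h.measurable_w.comp measurable_fst).mul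
      ((h.measurable_j.comp measurable_fst).pow_const 2)).mul (hφ.comp h.measurable_σ))
  refine ⟨hm.aestronglyMeasurable, ?_⟩
  have h0 := (h.integrable_prod hf hf2 hφ hφ2).2
  rw [HasFiniteIntegral, lintegral_prod _ (by
    have : Measurable (fun x : ℝ × Omega L => w x.1 * f (τ x.1 x.2) * φ x.2) :=
      ((h.measurable_w.comp measurable_fst).mul (hf.comp h.measurable_τ)).mul
        (hφ.comp measurable_snd)
    exact this.enorm.aemeasurable)] at h0
  rw [HasFiniteIntegral, lintegral_prod _ hm.enorm.aemeasurable]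
  refine lt_of_eq_of_lt (lintegral_congr_ae ?_) h0
  filter_upwards [h.lintegral_comp, h.inv] with s hs hi
  have hσ : Measurable (σ s) := h.measurable_σ.comp (by fun_prop : Measurable fun p => (s, p))
  have hg : Measurable fun q => ‖w s * (f q * φ (σ s q))‖ₑ :=
    (measurable_const.mul (hf.mul (hφ.comp hσ))).enorm
  have := hs _ hg
  simp only [hi] at this
  simp only [mul_assoc]
  rw [this, ← lintegral_const_mul _ hg]
  refine lintegral_congr fun q => ?_
  simp only [enorm_mul]
  rw [← Real.enorm_of_nonneg (sq_nonneg (j s))]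
  ring

lemma integral_superpose_swap {f φ : Omega L → ℝ} (hf : Measurable f) (hf2 : MemLp f 2)
    (hφ : Measurable φ) (hφ2 : MemLp φ 2) :
    Integrable (fun q => f q * ∫ s, w s * j s ^ 2 * φ (σ s q) ∂ν) ∧
    ∫ p, superpose ν w τ f p * φ p = ∫ q, f q * ∫ s, w s * j s ^ 2 * φ (σ s q) ∂ν := by
  have hint := h.integrable_prod_swap hf hf2 hφ hφ2
  constructor
  · simpa only [integral_const_mul] using hint.integral_prod_right
  · rw [(h.integral_superpose hf hf2 hφ hφ2).2]
    simp only [← integral_const_mul]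
    refine Eq.trans ?_ (integral_integral_swap hint)
    refine integral_congr_ae (.of_forall fun s => ?_)
    refine integral_congr_ae (.of_forall fun q => ?_)
    simp only
    ring

end IsSuperposition

end HelicalOseen

namespace HelicalOseen

variable {L : ℝ} [Fact (0 < L)]

/-! ### Vertical averages -/

/-- The measure on `(0, 2πL]` used for averages along the periodic direction. -/
noncomputable def periodMeasure (L : ℝ) : Measure ℝ :=
  volume.restrict (Set.Ioc 0 (2 * Real.pi * L))

instance : IsFiniteMeasure (periodMeasure L) := by
  unfold periodMeasure
  infer_instance

lemma measurable_translation (i : Fin 3) : Measurable (translation L i) := by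
  have : translation L i = fun t => cover L (t • basisVec i) :=
    funext (translation_eq_cover i)
  rw [this]
  exact (continuous_cover.comp (by fun_prop)).measurable

lemma translation_add (i : Fin 3) (s t : ℝ) :
    translation L i (s + t) = translation L i s + translation L i t := by
  simp only [translation_eq_cover, ← cover_add, add_smul]

lemma translation_neg (i : Fin 3) (s : ℝ) : translation L i (-s) = -translation L i s := by
  rw [eq_neg_iff_add_eq_zero, ← translation_add, neg_add_cancel, translation_zero]

/-- The vertical translations. -/
noncomputable def zshift (s : ℝ) (p : Omega L) : Omega L := p + translation L 2 s

lemma isSuperposition_zshift {w : ℝ → ℝ} (hw : Measurable w) (hi : Integrable w (periodMeasure L)) :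
    IsSuperposition (L := L) (periodMeasure L) w (fun _ => 1) zshift (fun s => zshift (-s)) where
  measurable_w := hw
  measurable_j := measurable_const
  measurable_τ := by
    have := measurable_translation (L := L) 2
    unfold zshift
    simp only [Function.uncurry_def]
    fun_prop
  measurable_σ := by
    have := measurable_translation (L := L) 2
    unfold zshift
    simp only [Function.uncurry_def]
    fun_prop
  inv := .of_forall fun s p => by simp [zshift, translation_neg]
  nonneg := .of_forall fun _ => zero_le_one
  map_eq := .of_forall fun s => by
    rw [one_pow, ENNReal.ofReal_one, one_smul]
    exact (measurePreserving_add_right (volume : Measure (Omega L)) (translation L 2 s)).map_eq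
  integrable := by simpa using hi

/-- The average of `f` over the vertical direction. -/
noncomputable def zMean (f : Omega L → ℝ) : Omega L → ℝ :=
  superpose (periodMeasure L) (fun _ => 1 / (2 * Real.pi * L)) zshift f

/-- The mean-free vertical primitive of `f - zMean f`. -/
noncomputable def zPrim (f : Omega L → ℝ) : Omega L → ℝ :=
  superpose (periodMeasure L) (fun s => s / (2 * Real.pi * L) - 1 / 2) zshift f

lemma isSuperposition_zMean : IsSuperposition (L := L) (periodMeasure L)
    (fun _ => 1 / (2 * Real.pi * L)) (fun _ => 1) zshift (fun s => zshift (-s)) :=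
  isSuperposition_zshift measurable_const (integrable_const _)

lemma isSuperposition_zPrim : IsSuperposition (L := L) (periodMeasure L)
    (fun s => s / (2 * Real.pi * L) - 1 / 2) (fun _ => 1) zshift (fun s => zshift (-s)) := by
  refine isSuperposition_zshift (by fun_prop) ?_
  have hc : Continuous fun s : ℝ => s / (2 * Real.pi * L) - 1 / 2 := by fun_prop
  exact hc.integrableOn_Ioc

lemma IsTest.measurable {φ : Omega L → ℝ} (h : IsTest φ) : Measurable φ := h.continuous.measurable

/-- Weak form of `∂_z (P f) = f - ⟨f⟩`. Integrating the sawtooth kernel `s / T - 1 / 2` by parts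
over a period, its unit jump reproduces `φ` and its slope `1 / T` produces the average. -/
lemma integral_zPrim_partialDeriv {f φ : Omega L → ℝ} (hf : Measurable f) (hf2 : MemLp f 2)
    (hφ : IsTest φ) :
    -(∫ p, zPrim f p * partialDeriv 2 φ p) = (∫ p, f p * φ p) - ∫ p, zMean f p * φ p := by
  have hT : 0 < 2 * Real.pi * L := (fact_period_pos L).out
  have h2 := hφ.isTest_partialDeriv 2
  have e1 := isSuperposition_zPrim.integral_superpose_swap hf hf2 h2.measurable (h2.memLp 2)
  have e2 := isSuperposition_zMean.integral_superpose_swap hf hf2 hφ.measurable (hφ.memLp 2)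
  have hK : ∀ q : Omega L, ∫ s, (s / (2 * Real.pi * L) - 1 / 2) * 1 ^ 2 *
      partialDeriv 2 φ (zshift (-s) q) ∂(periodMeasure L) =
      (∫ s, (1 / (2 * Real.pi * L)) * 1 ^ 2 * φ (zshift (-s) q) ∂(periodMeasure L)) - φ q := by
    intro q
    simp only [periodMeasure, ← intervalIntegral.integral_of_le hT.le, one_pow, mul_one]
    have hd : ∀ s : ℝ, HasDerivAt (fun s => φ (zshift (-s) q))
        (-partialDeriv 2 φ (zshift (-s) q)) s := by
      intro s
      have := (hφ.isSmooth.hasDerivAt 2 q (-s)).scomp s (hasDerivAt_neg s)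
      simpa [zshift, Function.comp_def] using! this
    have hc : Continuous fun s : ℝ => partialDeriv 2 φ (zshift (-s) q) := by
      have hct : Continuous fun s : ℝ => zshift (L := L) (-s) q := by
        simp only [zshift, translation_eq_cover]
        exact continuous_const.add (continuous_cover.comp (by fun_prop))
      exact h2.continuous.comp hct
    have hu : ∀ s : ℝ, HasDerivAt (fun s : ℝ => s / (2 * Real.pi * L) - 1 / 2) (1 / (2 * Real.pi * L)) s := fun s => by
      simpa using ((hasDerivAt_id s).div_const (2 * Real.pi * L)).sub_const (1 / 2)
    have := intervalIntegral.integral_mul_deriv_eq_deriv_mul (a := 0) (b := 2 * Real.pi * L)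
      (u := fun s => s / (2 * Real.pi * L) - 1 / 2) (u' := fun _ => 1 / (2 * Real.pi * L))
      (v := fun s => φ (zshift (-s) q)) (v' := fun s => -partialDeriv 2 φ (zshift (-s) q))
      (fun s _ => hu s) (fun s _ => hd s) intervalIntegrable_const
      (hc.neg.intervalIntegrable 0 (2 * Real.pi * L))
    simp only [mul_neg, intervalIntegral.integral_neg] at this
    have hper : zshift (L := L) (-(2 * Real.pi * L)) q = q := by
      have h0 : ((2 * Real.pi * L : ℝ) : AddCircle (2 * Real.pi * L)) = 0 := AddCircle.coe_period _
      have : translation L 2 (-(2 * Real.pi * L)) = 0 := by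
        rw [translation_neg, neg_eq_zero]
        simp only [translation, Matrix.cons_val]
        exact Prod.ext rfl h0
      rw [zshift, this, add_zero]
    have hper0 : zshift (L := L) (-0) q = q := by
      rw [zshift, neg_zero, translation_zero, add_zero]
    rw [hper, hper0, div_self hT.ne', zero_div] at this
    linear_combination -this
  rw [zPrim, zMean, e1.2, e2.2]
  simp only [hK, mul_sub]
  rw [integral_sub e2.1 (hφ.integrable_mul (hf2.locallyIntegrable one_le_two))]
  ring

/-- Vertical translates of a solenoidal field are solenoidal, hence so are their superpositions.
This is applied to both the average and the primitive. -/
lemma sum_integral_superpose_zshift {ω : Omega L → Vec} (hω : Measurable ω) (hω2 : MemLp ω 2)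
    (hd : IsDivFree ω) {w : ℝ → ℝ} (hw : Measurable w) (hi : Integrable w (periodMeasure L))
    {φ : Omega L → ℝ} (hφ : IsTest φ) :
    ∑ i, ∫ p, superpose (periodMeasure L) w zshift (fun p => ω p i) p * partialDeriv i φ p = 0 := by
  have hs := isSuperposition_zshift (L := L) hw hi
  have hωi : ∀ i, Measurable fun p => ω p i := fun i => by fun_prop
  have key := fun i => hs.integral_superpose (hωi i) (memLp_euclidean_iff.1 hω2 i)
    (hφ.isTest_partialDeriv i).measurable ((hφ.isTest_partialDeriv i).memLp 2)
  simp only [fun i => (key i).2]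
  rw [← integral_finsetSum _ fun i _ => (key i).1]
  refine integral_eq_zero_of_ae (.of_forall fun s => ?_)
  have := (isDivFree_iff hd.locallyIntegrable).1 hd _ (hφ.comp_add (translation L 2 (-s)))
  simp only [partialDeriv_comp_add] at this
  simp only [← Finset.mul_sum, zshift, this, mul_zero, Pi.zero_apply]

/-- Holds at every point, not just almost everywhere, because the integral runs over a full period.
-/
lemma zMean_add_translation (f : Omega L → ℝ) (p : Omega L) (t : ℝ) :
    zMean f (p + translation L 2 t) = zMean f p := by
  have hT : 0 < 2 * Real.pi * L := (fact_period_pos L).out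
  simp only [zMean, superpose, periodMeasure]
  rw [integral_const_mul, integral_const_mul, ← intervalIntegral.integral_of_le hT.le,
    ← intervalIntegral.integral_of_le hT.le]
  congr 1
  have hper : Function.Periodic (fun s => f (zshift s p)) (2 * Real.pi * L) := by
    intro s
    have : translation L 2 (2 * Real.pi * L) = 0 := by
      simp only [translation, Matrix.cons_val]
      exact Prod.ext rfl (AddCircle.coe_period _)
    simp only [zshift, translation_add, this, add_zero]
  have h1 := hper.intervalIntegral_add_eq t 0
  rw [zero_add] at h1
  rw [← h1]
  have h2 := intervalIntegral.integral_comp_add_left (fun s => f (zshift s p)) t (a := 0)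
    (b := 2 * Real.pi * L)
  rw [add_zero] at h2
  rw [← h2]
  simp only [zshift, translation_add, add_assoc]

lemma superpose_zshift_mul (ν : Measure ℝ) (w : ℝ → ℝ) (ρ : Plane → ℝ) (f : Omega L → ℝ)
    (p : Omega L) :
    superpose ν w zshift (fun q => ρ q.1 * f q) p = ρ p.1 * superpose ν w zshift f p := by
  simp only [superpose, zshift]
  rw [← integral_const_mul]
  congr 1
  funext s
  have : (p + translation L 2 s).1 = p.1 := by simp [translation_eq_cover, cover, basisVec]
  rw [this]
  ring

/-! ### Dilations of the plane -/

/-- The horizontal dilation `(x, z) ↦ (s x, z)`. -/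
noncomputable def dil (s : ℝ) (p : Omega L) : Omega L := (s • p.1, p.2)

lemma measurable_dil : Measurable (Function.uncurry (dil (L := L))) := by
  unfold dil
  simp only [Function.uncurry_def]
  fun_prop

lemma measurable_dil_inv : Measurable (Function.uncurry fun (s : ℝ) (p : Omega L) => dil s⁻¹ p) := by
  unfold dil
  simp only [Function.uncurry_def]
  fun_prop

lemma dil_dil_inv {s : ℝ} (hs : s ≠ 0) (p : Omega L) : dil s (dil s⁻¹ p) = p := by
  simp [dil, smul_smul, hs]

lemma map_dil_inv {s : ℝ} (hs : s ≠ 0) :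
    Measure.map (dil s⁻¹) (volume : Measure (Omega L)) = ENNReal.ofReal (s ^ 2) • volume := by
  have h := Measure.map_addHaar_smul (volume : Measure Plane) (inv_ne_zero hs)
  have hm : Measure.map (dil s⁻¹) (volume : Measure (Omega L)) =
      (Measure.map (s⁻¹ • ·) (volume : Measure Plane)).prod
        (Measure.map id (volume : Measure (AddCircle (2 * Real.pi * L)))) := by
    rw [Measure.map_prod_map _ _ (by fun_prop) measurable_id]
    rfl
  rw [hm, h, Measure.map_id, Measure.prod_smul_left]
  congr 2
  simp

lemma isSuperposition_dil {I : Set ℝ} (hI : MeasurableSet I) (hpos : ∀ s ∈ I, 0 < s) {w : ℝ → ℝ}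
    (hw : Measurable w) (hi : IntegrableOn (fun s => w s * s) I) :
    IsSuperposition (L := L) (volume.restrict I) w (fun s => s) (fun s => dil s⁻¹) dil where
  measurable_w := hw
  measurable_j := measurable_id
  measurable_τ := measurable_dil_inv
  measurable_σ := measurable_dil
  inv := (ae_restrict_iff' hI).2 (.of_forall fun s hs p => dil_dil_inv (hpos s hs).ne' p)
  nonneg := (ae_restrict_iff' hI).2 (.of_forall fun s hs => (hpos s hs).le)
  map_eq := (ae_restrict_iff' hI).2 (.of_forall fun s hs => map_dil_inv (hpos s hs).ne')
  integrable := hi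

/-- The horizontal Euler operator `x ∂_x + y ∂_y`. -/
noncomputable def euler (φ : Omega L → ℝ) (p : Omega L) : ℝ :=
  p.1 0 * partialDeriv 0 φ p + p.1 1 * partialDeriv 1 φ p

lemma IsTest.isTest_euler {φ : Omega L → ℝ} (h : IsTest φ) : IsTest (euler φ) :=
  ((isSmooth_coord 0).mul_test (h.isTest_partialDeriv 0)).add
    ((isSmooth_coord 1).mul_test (h.isTest_partialDeriv 1))

lemma IsSmooth.hasDerivAt_dil {φ : Omega L → ℝ} (h : IsSmooth φ) (p : Omega L) (s : ℝ) :
    HasDerivAt (fun s => φ (dil s p))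
      (p.1 0 * partialDeriv 0 φ (dil s p) + p.1 1 * partialDeriv 1 φ (dil s p)) s := by
  obtain ⟨q, rfl⟩ := exists_cover p
  have hc : HasDerivAt (fun s : ℝ => ((s • q.1, q.2) : Plane × ℝ)) (q.1, 0) s := by
    refine HasDerivAt.prodMk ?_ (hasDerivAt_const _ _)
    simpa using (hasDerivAt_id s).smul_const q.1
  have := h.hasDerivAt_curve hc
  simpa [cover, dil] using this

lemma euler_dil (φ : Omega L → ℝ) (p : Omega L) (s : ℝ) :
    euler φ (dil s p) =
      s * (p.1 0 * partialDeriv 0 φ (dil s p) + p.1 1 * partialDeriv 1 φ (dil s p)) := by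
  simp [euler, dil]
  ring

lemma IsTest.comp_dil {φ : Omega L → ℝ} (h : IsTest φ) {s : ℝ} (hs : s ≠ 0) :
    IsTest (fun p => φ (dil s p)) ∧
      (∀ i : Fin 2, ∀ p, partialDeriv i.castSucc (fun p => φ (dil s p)) p =
        s * partialDeriv i.castSucc φ (dil s p)) := by
  let A : Plane ≃L[ℝ] Plane := (LinearEquiv.smulOfNeZero ℝ Plane s hs).toContinuousLinearEquiv
  have e : (fun p => φ (dil s p)) = fun p => φ (affineHomeo A 0 p) := by
    funext p
    rw [affineHomeo_apply, add_zero]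
    rfl
  have hA : ∀ x, A x = s • x := fun _ => rfl
  rw [e]
  refine ⟨h.comp_affine A 0, fun i p => ?_⟩
  have e' : affineHomeo A 0 p = dil s p := by
    rw [affineHomeo_apply, add_zero]
    rfl
  rw [h.isSmooth.partialDeriv_comp_affine, e', hA]
  fin_cases i <;> simp [basisVec]

end HelicalOseen

namespace HelicalOseen

variable {L : ℝ} [Fact (0 < L)]

/-! ### Potentials of horizontal fields -/

lemma continuous_dil (p : Omega L) : Continuous fun s : ℝ => dil s p := by
  unfold dil
  fun_prop

lemma IsSmooth.partialDeriv_coord_mul {φ : Omega L → ℝ} (h : IsSmooth φ) (i : Fin 3) (j : Fin 2)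
    (p : Omega L) : partialDeriv i (fun p => p.1 j * φ p) p =
      (basisVec i).1 j * φ p + p.1 j * partialDeriv i φ p := by
  rw [(isSmooth_coord j).partialDeriv_mul h, partialDeriv_coord]

/-- The radial component of a curl-free field determines the field. -/
lemma integral_radial_partialDeriv {F : Fin 2 → Omega L → ℝ} (hF : ∀ j, LocallyIntegrable (F j))
    (hcurl : ∀ φ : Omega L → ℝ, IsTest φ →
      ∫ p, F 0 p * partialDeriv 1 φ p = ∫ p, F 1 p * partialDeriv 0 φ p)
    {φ : Omega L → ℝ} (hφ : IsTest φ) (j : Fin 2) :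
    ∫ p, (p.1 0 * F 0 p + p.1 1 * F 1 p) * partialDeriv j.castSucc φ p =
      ∫ p, F j p * (euler φ p + φ p) := by
  have hx := fun j : Fin 2 => (isSmooth_coord (L := L) j).mul_test hφ
  have hi : ∀ (k : Fin 2) (i : Fin 3) (l : Fin 2),
      Integrable fun p => F k p * (p.1 l * partialDeriv i φ p) := fun k i l =>
    ((isSmooth_coord l).mul_test (hφ.isTest_partialDeriv i)).integrable_mul (hF k)
  have hi' : ∀ k, Integrable fun p => F k p * φ p := fun k => hφ.integrable_mul (hF k)
  have e1 : ∀ i : Fin 3, ∫ p, (p.1 0 * F 0 p + p.1 1 * F 1 p) * partialDeriv i φ p =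
      (∫ p, F 0 p * (p.1 0 * partialDeriv i φ p)) + ∫ p, F 1 p * (p.1 1 * partialDeriv i φ p) := by
    intro i
    rw [← integral_add (hi _ _ _) (hi _ _ _)]
    congr 1
    funext p
    ring
  have e2 : ∀ k, ∫ p, F k p * (euler φ p + φ p) =
      (∫ p, F k p * (p.1 0 * partialDeriv 0 φ p)) + (∫ p, F k p * (p.1 1 * partialDeriv 1 φ p)) +
        ∫ p, F k p * φ p := by
    intro k
    rw [← integral_add (hi _ _ _) (hi _ _ _)]
    refine Eq.trans ?_ (integral_add ((hi _ _ _).add (hi _ _ _)) (hi' k))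
    congr 1
    funext p
    simp only [euler]
    ring
  -- Testing the curl-free condition with `x φ` and `y φ` exchanges the mixed terms, at the cost of
  -- one term `F_j φ`.
  have c0 := hcurl _ (hx 0)
  have c1 := hcurl _ (hx 1)
  simp only [hφ.isSmooth.partialDeriv_coord_mul, basisVec, Matrix.cons_val,
    PiLp.single_apply] at c0 c1
  simp only [zero_ne_one, one_ne_zero, ↓reduceIte, zero_mul, one_mul, zero_add, mul_add] at c0 c1
  rw [integral_add (hi' _) (hi _ _ _)] at c0 c1
  rw [e2]
  fin_cases j
  · have := e1 0
    simp only [Fin.zero_eta, Fin.castSucc_zero, Fin.isValue] at this ⊢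
    linarith
  · have := e1 1
    simp only [Fin.mk_one, Fin.isValue, Fin.castSucc_one] at this ⊢
    linarith

lemma integral_dil_euler_add {φ : Omega L → ℝ} (hφ : IsTest φ) (q : Omega L) :
    ∫ s in Set.Ioc (0 : ℝ) 1, (euler φ (dil s q) + φ (dil s q)) = φ q := by
  rw [← intervalIntegral.integral_of_le zero_le_one]
  have hd : ∀ s ∈ Set.uIcc (0 : ℝ) 1, HasDerivAt (fun s => s * φ (dil s q))
      (euler φ (dil s q) + φ (dil s q)) s := by
    intro s _
    refine ((hasDerivAt_id s).mul (hφ.isSmooth.hasDerivAt_dil q s)).congr_deriv ?_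
    rw [euler_dil]
    simp
    ring
  have hc : Continuous fun s : ℝ => euler φ (dil s q) + φ (dil s q) :=
    (hφ.isTest_euler.continuous.comp (continuous_dil q)).add
      (hφ.continuous.comp (continuous_dil q))
  rw [intervalIntegral.integral_eq_sub_of_hasDerivAt hd (hc.intervalIntegrable _ _)]
  simp [dil]

/-- Solves `∇k = -F` by integrating along the ray to infinity: with `H = x · F`, `k(x) = ∫_1^∞ x ·
F(t x) dt = ∫_0^1 s⁻¹ H(x / s) ds`. The dilation by `1 / s` multiplies the planar `L²` norm by `s`,
which cancels `s⁻¹` and gives the Hardy bound with constant one. -/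
lemma exists_potential {F : Fin 2 → Omega L → ℝ} (hFm : ∀ j, Measurable (F j))
    (hF : ∀ j, Integrable (F j)) (hH : MemLp (fun p => p.1 0 * F 0 p + p.1 1 * F 1 p) 2)
    (hcurl : ∀ φ : Omega L → ℝ, IsTest φ →
      ∫ p, F 0 p * partialDeriv 1 φ p = ∫ p, F 1 p * partialDeriv 0 φ p)
    (hz : ∀ j p t, F j (p + translation L 2 t) = F j p) :
    ∃ k : Omega L → ℝ, MemLp k 2 ∧
      eLpNorm k 2 volume ≤ eLpNorm (fun p => p.1 0 * F 0 p + p.1 1 * F 1 p) 2 volume ∧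
      (∀ p t, k (p + translation L 2 t) = k p) ∧
      ∀ φ : Omega L → ℝ, IsTest φ → ∀ j : Fin 2,
        ∫ p, k p * partialDeriv j.castSucc φ p = ∫ p, F j p * φ p := by
  set H : Omega L → ℝ := fun p => p.1 0 * F 0 p + p.1 1 * F 1 p with hHdef
  have hHm : Measurable H := by
    have := hFm 0
    have := hFm 1
    fun_prop
  have hone : ∀ s ∈ Set.Ioc (0 : ℝ) 1, s⁻¹ * s = 1 := fun s hs => inv_mul_cancel₀ hs.1.ne'
  have hsup : IsSuperposition (L := L) (volume.restrict (Set.Ioc (0 : ℝ) 1)) (fun s => s⁻¹)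
      (fun s => s) (fun s => dil s⁻¹) dil := by
    refine isSuperposition_dil measurableSet_Ioc (fun s hs => hs.1) measurable_inv ?_
    refine (integrableOn_congr_fun hone measurableSet_Ioc).2 ?_
    exact integrableOn_const (by simp)
  refine ⟨superpose (volume.restrict (Set.Ioc (0 : ℝ) 1)) (fun s => s⁻¹) (fun s => dil s⁻¹) H,
    hsup.memLp_superpose hHm hH, ?_, ?_, ?_⟩
  · refine (hsup.eLpNorm_superpose_le hHm).trans (le_of_eq ?_)
    rw [setLIntegral_congr_fun measurableSet_Ioc (g := fun _ => 1)
      (fun s hs => by simp [hone s hs])]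
    simp
  · intro p t
    have hHz : ∀ s : ℝ, H (dil s⁻¹ (p + translation L 2 t)) = H (dil s⁻¹ p) := by
      intro s
      have e : dil s⁻¹ (p + translation L 2 t) = dil s⁻¹ p + translation L 2 t := by
        simp [dil, translation]
      have e1 : (dil s⁻¹ p + translation L 2 t).1 = (dil s⁻¹ p).1 := by
        simp [translation]
      rw [e]
      simp only [hHdef, hz, e1]
    simp only [superpose, hHz]
  · intro φ hφ j
    have hd := hφ.isTest_partialDeriv j.castSucc
    rw [(hsup.integral_superpose hHm hH hd.measurable (hd.memLp 2)).2]
    set χ : Omega L → ℝ := fun p => euler φ p + φ p with hχ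
    have hχt : IsTest χ := hφ.isTest_euler.add hφ
    -- The radial identity is applied to the dilated test function `φ (s ·)`. The integrand that
    -- appears, `euler φ + φ` at `s q`, is the `s`-derivative of `s φ(s q)`, so that the integral
    -- over `s` returns `φ`.
    have hslice : ∀ s ∈ Set.Ioc (0 : ℝ) 1,
        s⁻¹ * s ^ 2 * ∫ q, H q * partialDeriv j.castSucc φ (dil s q) =
          ∫ q, F j q * χ (dil s q) := by
      intro s hs
      have hc := hφ.comp_dil hs.1.ne'
      have := integral_radial_partialDeriv (fun j => (hF j).locallyIntegrable) hcurl hc.1 j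
      have he : ∀ p, euler (fun p => φ (dil s p)) p = euler φ (dil s p) := by
        intro p
        have h0 := hc.2 0
        have h1 := hc.2 1
        simp only [Fin.castSucc_zero, Fin.castSucc_one] at h0 h1
        rw [euler_dil, euler, h0, h1]
        ring
      simp only [hc.2, he] at this
      rw [← this, ← integral_const_mul]
      congr 1
      funext q
      have := hs.1.ne'
      field_simp
      rw [mul_comm]
    rw [setIntegral_congr_fun measurableSet_Ioc hslice]
    obtain ⟨M, hM⟩ := hχt.continuous.bounded_above_of_compact_support hχt.compact_support
    have hint : Integrable (Function.uncurry fun (s : ℝ) (q : Omega L) => F j q * χ (dil s q))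
        ((volume.restrict (Set.Ioc (0 : ℝ) 1)).prod volume) := by
      refine Integrable.mul_bdd (c := M) ((hF j).comp_snd _) ?_ (.of_forall fun x => hM _)
      exact (hχt.measurable.comp measurable_dil).aestronglyMeasurable
    rw [integral_integral_swap hint]
    congr 1
    funext q
    rw [integral_const_mul, integral_dil_euler_add hφ]

/-! ### Azimuthal fields with prescribed vorticity -/

lemma support_euler_subset (φ : Omega L → ℝ) :
    Function.support (euler φ) ⊆ tsupport φ := by
  intro p hp
  by_contra hn
  have h0 : φ =ᶠ[nhds p] 0 := notMem_tsupport_iff_eventuallyEq.1 hn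
  have hc : ∀ i, Filter.Tendsto (fun t : ℝ => p + translation L i t) (nhds 0) (nhds p) := by
    intro i
    have : Continuous (fun t : ℝ => p + translation L i t) := by
      simp only [translation_eq_cover]
      exact continuous_const.add (continuous_cover.comp (by fun_prop))
    have h2 := this.tendsto 0
    rwa [translation_zero, add_zero] at h2
  have hz : ∀ i, partialDeriv i φ p = 0 := by
    intro i
    have : (fun t : ℝ => φ (p + translation L i t)) =ᶠ[nhds 0] fun _ => 0 := (hc i).eventually h0
    simpa [partialDeriv] using this.deriv_eq
  exact hp (by simp [euler, hz])

/-- The integrand is the derivative of `φ (dil s q)`, and off the axis the dilated point eventually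
leaves the support of `φ`. -/
lemma integral_dil_euler {φ : Omega L → ℝ} (hφ : IsTest φ) {q : Omega L} (hq : q.1 ≠ 0) :
    ∫ s in Set.Ioi (1 : ℝ), s⁻¹ * euler φ (dil s q) = -φ q := by
  obtain ⟨R, hR⟩ := (hφ.compact_support.isCompact.isBounded).exists_norm_le
  have hn : 0 < ‖q.1‖ := norm_pos_iff.2 hq
  have hout : ∀ s : ℝ, R / ‖q.1‖ < s → dil s q ∉ tsupport φ := by
    intro s hs hmem
    have h1 : ‖(dil s q).1‖ ≤ R := (norm_fst_le _).trans (hR _ hmem)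
    rw [dil, norm_smul] at h1
    rw [div_lt_iff₀ hn] at hs
    have := mul_le_mul_of_nonneg_right (le_abs_self s) hn.le
    rw [Real.norm_eq_abs] at h1
    linarith
  have hd : ∀ s ∈ Set.Ioi (1 : ℝ), HasDerivAt (fun s => φ (dil s q)) (s⁻¹ * euler φ (dil s q)) s := by
    intro s hs
    refine (hφ.isSmooth.hasDerivAt_dil q s).congr_deriv ?_
    rw [euler_dil, inv_mul_cancel_left₀ (zero_lt_one.trans hs).ne']
  have hcont : ContinuousWithinAt (fun s => φ (dil s q)) (Set.Ici 1) 1 :=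
    (hφ.continuous.comp (continuous_dil q)).continuousWithinAt
  have hlim : Filter.Tendsto (fun s => φ (dil s q)) Filter.atTop (nhds 0) := by
    refine tendsto_const_nhds.congr' ?_
    filter_upwards [Filter.eventually_gt_atTop (R / ‖q.1‖)] with s hs
    exact (image_eq_zero_of_notMem_tsupport (hout s hs)).symm
  have hcont' : ContinuousOn (fun s : ℝ => s⁻¹ * euler φ (dil s q))
      (Set.Icc 1 (max 1 (R / ‖q.1‖))) := by
    refine ContinuousOn.mul (continuousOn_inv₀.mono ?_)
      (hφ.isTest_euler.continuous.comp (continuous_dil q)).continuousOn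
    intro s hs
    exact (zero_lt_one.trans_le hs.1).ne'
  have hint : IntegrableOn (fun s : ℝ => s⁻¹ * euler φ (dil s q)) (Set.Ioi 1) := by
    rw [← Set.Ioc_union_Ioi_eq_Ioi (le_max_left 1 (R / ‖q.1‖))]
    refine IntegrableOn.union ?_ ?_
    · exact ((ContinuousOn.integrableOn_Icc (μ := volume) hcont').mono_set Set.Ioc_subset_Icc_self)
    · refine (integrableOn_congr_fun (fun s hs => ?_) measurableSet_Ioi).2 integrableOn_zero
      have hs' := hout s ((le_max_right _ _).trans_lt hs)
      have h0 := image_eq_zero_of_notMem_tsupport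
        (fun h => hs' (closure_minimal (support_euler_subset φ) (isClosed_tsupport φ) h))
      rw [h0, mul_zero]
  rw [integral_Ioi_of_hasDerivAt_of_tendsto hcont hd hint hlim]
  simp [dil]

/-- The mean `∫_1^∞ s⁻³ f (x / s) ds = r⁻² ∫_0^r f (t x / r) t dt` of `f` over discs. -/
noncomputable def discMean (f : Omega L → ℝ) : Omega L → ℝ :=
  superpose (volume.restrict (Set.Ioi 1)) (fun s => s⁻¹ ^ 3) (fun s => dil s⁻¹) f

lemma inv_cube_mul_self (s : ℝ) : s⁻¹ ^ 3 * s = s ^ (-2 : ℝ) := by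
  rcases eq_or_ne s 0 with rfl | hs
  · rw [Real.zero_rpow (by norm_num)]
    simp
  · rw [show (-2 : ℝ) = ((-2 : ℤ) : ℝ) by norm_num, Real.rpow_intCast, zpow_neg]
    field_simp

lemma isSuperposition_discMean : IsSuperposition (L := L) (volume.restrict (Set.Ioi (1 : ℝ)))
    (fun s => s⁻¹ ^ 3) (fun s => s) (fun s => dil s⁻¹) dil := by
  refine isSuperposition_dil measurableSet_Ioi (fun s hs => zero_lt_one.trans hs) (by fun_prop) ?_
  simp only [inv_cube_mul_self]
  exact integrableOn_Ioi_rpow_of_lt (by norm_num) one_pos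

lemma eLpNorm_discMean_le {f : Omega L → ℝ} (hf : Measurable f) :
    eLpNorm (discMean f) 2 volume ≤ eLpNorm f 2 volume := by
  refine (isSuperposition_discMean.eLpNorm_superpose_le hf).trans (le_of_eq ?_)
  have h1 : ∫⁻ s in Set.Ioi (1 : ℝ), ‖s⁻¹ ^ 3 * s‖ₑ = 1 := by
    have h2 := integrableOn_Ioi_rpow_of_lt (a := -2) (by norm_num) one_pos
    have h3 : ∀ᵐ s : ℝ ∂volume.restrict (Set.Ioi 1), 0 ≤ s ^ (-2 : ℝ) :=
      (ae_restrict_iff' measurableSet_Ioi).2 (.of_forall fun s hs =>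
        Real.rpow_nonneg (zero_lt_one.trans hs).le _)
    simp only [inv_cube_mul_self]
    rw [← ofReal_integral_norm_eq_lintegral_enorm h2]
    rw [integral_congr_ae (h3.mono fun s hs => Real.norm_of_nonneg hs),
      integral_Ioi_rpow_of_lt (by norm_num) one_pos]
    norm_num
  rw [h1, one_mul]

/-- Weak form of `2 h + x · ∇h = f` for `h = discMean f`; the left side is the vertical component of
`rot (r h e_θ)`. -/
lemma integral_discMean_euler {f φ : Omega L → ℝ} (hf : Measurable f) (hf2 : MemLp f 2)
    (hφ : IsTest φ) : ∫ p, discMean f p * euler φ p = -∫ p, f p * φ p := by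
  have he := hφ.isTest_euler
  rw [discMean, (isSuperposition_discMean.integral_superpose_swap hf hf2 he.measurable
    (he.memLp 2)).2, ← integral_neg]
  refine integral_congr_ae ?_
  filter_upwards [ae_ne_axis] with q hq
  have : ∫ s in Set.Ioi (1 : ℝ), s⁻¹ ^ 3 * s ^ 2 * euler φ (dil s q) = -φ q := by
    rw [← integral_dil_euler hφ hq]
    refine setIntegral_congr_fun measurableSet_Ioi fun s hs => ?_
    have : s ≠ 0 := (zero_lt_one.trans hs).ne'
    field_simp
  rw [this, mul_neg]

end HelicalOseen

namespace HelicalOseen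

variable {L : ℝ} [Fact (0 < L)]

/-! ### Averages and null sets -/

namespace IsSuperposition

variable {ν : Measure ℝ} {w j : ℝ → ℝ} {τ σ : ℝ → Omega L → Omega L}

/-- The exceptional null set may depend on `s`; Fubini exchanges the two quantifiers. -/
lemma superpose_congr [SFinite ν] (h : IsSuperposition ν w j τ σ) {f g : Omega L → ℝ}
    (hf : Measurable f) (hg : Measurable g) (hfg : ∀ᵐ s ∂ν, ∀ᵐ p, f (τ s p) = g p) :
    superpose ν w τ f =ᵐ[volume] fun p => (∫ s, w s ∂ν) * g p := by
  have hm : MeasurableSet {x : ℝ × Omega L | f (τ x.1 x.2) = g x.2} :=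
    measurableSet_eq_fun (hf.comp h.measurable_τ) (hg.comp measurable_snd)
  filter_upwards [(Measure.ae_ae_comm (p := fun s p => f (τ s p) = g p) hm).1 hfg] with p hp
  rw [superpose, ← integral_mul_const]
  refine integral_congr_ae ?_
  filter_upwards [hp] with s hs
  rw [hs]

lemma superpose_congr_ae [SFinite ν] (h : IsSuperposition ν w j τ σ) {f g : Omega L → ℝ}
    (hf : Measurable f) (hg : Measurable g) (hfg : f =ᵐ[volume] g) :
    superpose ν w τ f =ᵐ[volume] superpose ν w τ g := by
  have hm : MeasurableSet {x : ℝ × Omega L | f (τ x.1 x.2) = g (τ x.1 x.2)} :=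
    measurableSet_eq_fun (hf.comp h.measurable_τ) (hg.comp h.measurable_τ)
  have h1 : ∀ᵐ s ∂ν, ∀ᵐ p, f (τ s p) = g (τ s p) := by
    filter_upwards [h.map_eq] with s hs
    have hτ : Measurable (τ s) := h.measurable_τ.comp (by fun_prop : Measurable fun p => (s, p))
    have hq : Measure.QuasiMeasurePreserving (τ s) (volume : Measure (Omega L)) volume :=
      ⟨hτ, hs ▸ Measure.smul_absolutelyContinuous⟩
    exact hq.ae hfg
  filter_upwards [(Measure.ae_ae_comm (p := fun s p => f (τ s p) = g (τ s p)) hm).1 h1] with p hp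
  refine integral_congr_ae ?_
  filter_upwards [hp] with s hs
  rw [hs]

end IsSuperposition

lemma integral_zMean {f : Omega L → ℝ} (hf : Measurable f) (hi : Integrable f) :
    Integrable (zMean f) ∧ ∫ p, zMean f p = ∫ p, f p := by
  have hT : 0 < 2 * Real.pi * L := (fact_period_pos L).out
  have hs := isSuperposition_zMean (L := L)
  have hm : Measurable (fun x : ℝ × Omega L => 1 / (2 * Real.pi * L) * f (zshift x.1 x.2)) :=
    measurable_const.mul (hf.comp hs.measurable_τ)
  have hmp : ∀ s, MeasurePreserving (zshift s : Omega L → Omega L) := fun s =>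
    measurePreserving_add_right (volume : Measure (Omega L)) (translation L 2 s)
  have hint : Integrable (Function.uncurry fun (s : ℝ) (p : Omega L) =>
      1 / (2 * Real.pi * L) * f (zshift s p)) ((periodMeasure L).prod volume) := by
    refine (integrable_prod_iff hm.aestronglyMeasurable).2 ⟨.of_forall fun s => ?_, ?_⟩
    · exact (((hmp s).integrable_comp hf.aestronglyMeasurable).2 hi).const_mul _
    · have : ∀ s : ℝ, ∫ p, ‖1 / (2 * Real.pi * L) * f (zshift s p)‖ =
          ∫ p, ‖1 / (2 * Real.pi * L) * f p‖ := fun s =>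
        integral_add_right_eq_self (fun p => ‖1 / (2 * Real.pi * L) * f p‖) (translation L 2 s)
      simp only [this]
      exact integrable_const _
  refine ⟨hint.integral_prod_right, ?_⟩
  have := integral_integral_swap hint
  simp only [integral_const_mul] at this
  have h1 : ∀ s : ℝ, ∫ p, f (zshift s p) = ∫ p, f p := fun s =>
    integral_add_right_eq_self f (translation L 2 s)
  simp only [zMean, superpose, integral_const_mul]
  rw [← this]
  simp only [h1]
  simp [periodMeasure, integral_const, Measure.real, ENNReal.toReal_ofReal hT.le]
  have hL := (Fact.out : 0 < L).ne'
  field_simp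

/-! ### Radial functions -/

/-- The average of `f` over rotations. -/
noncomputable def rotMean (f : Omega L → ℝ) : Omega L → ℝ :=
  superpose (volume.restrict (Set.Ioc 0 (2 * Real.pi))) (fun _ => 1 / (2 * Real.pi))
    (fun α => rigid α 0) f

lemma rigid_zero_apply (α : ℝ) (p : Omega L) : rigid α 0 p = (rotate α p.1, p.2) := by
  rw [rigid_apply, add_zero]

lemma rotate_add (α β : ℝ) (x : Plane) : rotate (α + β) x = rotate α (rotate β x) := by
  ext i
  fin_cases i <;> simp [rotate, Real.cos_add, Real.sin_add] <;> ring

lemma rotate_zero (x : Plane) : rotate 0 x = x := by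
  ext i
  fin_cases i <;> simp [rotate]

lemma continuous_rotate : Continuous (Function.uncurry rotate) := by
  unfold rotate
  simp only [Function.uncurry_def]
  fun_prop

lemma continuous_rigid : Continuous (Function.uncurry fun (α : ℝ) (p : Omega L) => rigid α 0 p) := by
  simp only [Function.uncurry_def, rigid_zero_apply]
  exact (continuous_rotate.comp (by fun_prop : Continuous fun x : ℝ × Omega L => (x.1, x.2.1))).prodMk
    (by fun_prop)

lemma rigid_neg_rigid (α : ℝ) (p : Omega L) : rigid (-α) 0 (rigid α 0 p) = p := by
  simp only [rigid_zero_apply, ← rotate_add, neg_add_cancel, rotate_zero]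

lemma isSuperposition_rotMean :
    IsSuperposition (L := L) (volume.restrict (Set.Ioc 0 (2 * Real.pi))) (fun _ => 1 / (2 * Real.pi))
      (fun _ => 1) (fun α => rigid α 0) (fun α => rigid (-α) 0) where
  measurable_w := measurable_const
  measurable_j := measurable_const
  measurable_τ := continuous_rigid.measurable
  measurable_σ := (continuous_rigid.comp
    (by fun_prop : Continuous fun x : ℝ × Omega L => (-x.1, x.2))).measurable
  inv := .of_forall fun α p => rigid_neg_rigid α p
  nonneg := .of_forall fun _ => zero_le_one
  map_eq := .of_forall fun α => by
    rw [one_pow, ENNReal.ofReal_one, one_smul]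
    exact (measurePreserving_rigid α 0).map_eq
  integrable := integrable_const _

lemma rotMean_rigid (f : Omega L → ℝ) (β : ℝ) (p : Omega L) :
    rotMean f (rigid β 0 p) = rotMean f p := by
  simp only [rotMean, superpose]
  rw [integral_const_mul, integral_const_mul, ← intervalIntegral.integral_of_le Real.two_pi_pos.le,
    ← intervalIntegral.integral_of_le Real.two_pi_pos.le]
  congr 1
  have hper : Function.Periodic (fun α => f (rigid α 0 p)) (2 * Real.pi) := by
    intro α
    simp only [rigid_zero_apply, rotate, Real.cos_add_two_pi, Real.sin_add_two_pi]
  have h1 := hper.intervalIntegral_add_eq β 0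
  rw [zero_add] at h1
  rw [← h1]
  have h2 := intervalIntegral.integral_comp_add_right (fun α => f (rigid α 0 p)) β (a := 0)
    (b := 2 * Real.pi)
  rw [zero_add, add_comm (2 * Real.pi)] at h2
  rw [← h2]
  simp only [rigid_zero_apply, rotate_add]

lemma exists_rotate (x : Plane) : ∃ α, rotate α !₂[‖x‖, 0] = x := by
  let z : ℂ := ⟨x 0, x 1⟩
  have hz : ‖z‖ = ‖x‖ := by
    rw [← sq_eq_sq₀ (norm_nonneg _) (norm_nonneg _), EuclideanSpace.norm_sq_eq,
      Complex.sq_norm, Complex.normSq_apply]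
    simp [z]
    ring
  refine ⟨z.arg, ?_⟩
  ext i
  fin_cases i
  · simp [rotate, ← hz, mul_comm, z]
  · simp [rotate, ← hz, mul_comm, z]

/-- A vertically invariant function which is almost everywhere invariant under rotations is a
function of the distance to the axis. -/
lemma exists_radial {f : Omega L → ℝ} (hf : Measurable f)
    (hz : ∀ p t, f (p + translation L 2 t) = f p)
    (hrot : ∀ α, ∀ᵐ p, f (rigid α 0 p) = f p) :
    ∃ Φ : ℝ → ℝ, Measurable Φ ∧ f =ᵐ[volume] fun p => Φ (radius p) := by
  have hm : Measurable (rotMean f) := isSuperposition_rotMean.measurable_superpose hf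
  -- The rotational mean equals `f` almost everywhere but is invariant at every point, so it is
  -- determined by its values on a single half-line.
  refine ⟨fun r => rotMean f (!₂[r, 0], 0), hm.comp ?_, ?_⟩
  · fun_prop
  have hR : ∀ p, rotMean f p = rotMean f (!₂[radius p, 0], 0) := by
    intro p
    obtain ⟨α, hα⟩ := exists_rotate p.1
    obtain ⟨t, ht⟩ := QuotientAddGroup.mk_surjective p.2
    rw [← rotMean_rigid f α (!₂[radius p, 0], 0), rigid_zero_apply]
    have hz' : ∀ q, rotMean f (q + translation L 2 t) = rotMean f q := by
      intro q
      have e : ∀ α, rigid α 0 (q + translation L 2 t) = rigid α 0 q + translation L 2 t := by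
        intro α
        simp [rigid_zero_apply, translation]
      simp only [rotMean, superpose, e, hz]
    rw [← hz' (rotate α !₂[radius p, 0], 0)]
    congr 1
    refine Prod.ext ?_ ?_
    · simpa [translation, radius] using hα.symm
    · simpa [translation] using! ht.symm
  have h1 := isSuperposition_rotMean.superpose_congr hf hf
    (.of_forall fun α => hrot α : ∀ᵐ α ∂(volume.restrict (Set.Ioc 0 (2 * Real.pi))),
      ∀ᵐ p, f (rigid α 0 p) = f p)
  filter_upwards [h1] with p hp
  rw [← hR, rotMean, hp]
  simp [integral_const, Measure.real, Real.pi_pos.le]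
  field_simp

lemma integral_radial {Φ : ℝ → ℝ} (hi : Integrable fun p : Omega L => Φ (radius p)) :
    IntegrableOn (fun t => t * Φ t) (Set.Ioi 0) ∧
      ∫ p : Omega L, Φ (radius p) = (2 * Real.pi * L) * (2 * Real.pi) * ∫ t in Set.Ioi 0, t * Φ t := by
  have hT : 0 < 2 * Real.pi * L := (fact_period_pos L).out
  have h1 : Integrable (fun x : Plane => Φ ‖x‖) := by
    have := Integrable.prod_left_ae hi
    exact this.exists.choose_spec
  refine ⟨by simpa using (integrable_fun_norm_addHaar (volume : Measure Plane)).1 h1, ?_⟩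
  have h2 := integral_fun_fst (μ := (volume : Measure Plane))
    (ν := (volume : Measure (AddCircle (2 * Real.pi * L)))) (fun x : Plane => Φ ‖x‖)
  rw [integral_fun_norm_addHaar] at h2
  refine h2.trans ?_
  have hL : 0 ≤ L := (Fact.out : 0 < L).le
  simp [Measure.real, Real.pi_pos.le, hL]
  ring

/-- The substitution `t = 1 / s` turns the integral over all `s > 0` into `∫ t Φ(r t) dt = 0`. The
mean over the disc is thus minus an integral over its exterior, where the decay of `Φ` can be used.
-/
lemma integral_dil_radial {Φ : ℝ → ℝ} (hi : IntegrableOn (fun t => t * Φ t) (Set.Ioi 0))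
    (h0 : ∫ t in Set.Ioi 0, t * Φ t = 0) {r : ℝ} (hr : 0 < r) :
    ∫ s in Set.Ioi 1, s⁻¹ ^ 3 * Φ (s⁻¹ * r) = -∫ s in Set.Ioc 0 1, s⁻¹ ^ 3 * Φ (s⁻¹ * r) := by
  have e1 : ∀ s ∈ Set.Ioi (0 : ℝ), (|(-1 : ℝ)| * s ^ ((-1 : ℝ) - 1)) • (s ^ (-1 : ℝ) * Φ (r * s ^ (-1 : ℝ))) =
      s⁻¹ ^ 3 * Φ (s⁻¹ * r) := by
    intro s hs
    have hs0 : s ≠ 0 := ne_of_gt hs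
    rw [Real.rpow_neg_one, show ((-1 : ℝ) - 1) = ((-2 : ℤ) : ℝ) by norm_num, Real.rpow_intCast, smul_eq_mul,
      mul_comm r, abs_neg, abs_one, one_mul]
    rw [← mul_assoc]
    congr 1
    field_simp
  have e2 : ∀ t, t * Φ (r * t) = r⁻¹ * ((r * t) * Φ (r * t)) := fun t => by field_simp
  have hg : IntegrableOn (fun t => t * Φ (r * t)) (Set.Ioi 0) := by
    simp only [e2]
    have := (integrableOn_Ioi_comp_mul_left_iff (fun t => t * Φ t) 0 hr).2 (by simpa using hi)
    exact this.const_mul _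
  have hg0 : ∫ t in Set.Ioi 0, t * Φ (r * t) = 0 := by
    simp only [e2]
    rw [integral_const_mul, integral_comp_mul_left_Ioi (fun t => t * Φ t) 0 hr, mul_zero, h0]
    simp
  have hS := (integrableOn_Ioi_comp_rpow_iff (fun t => t * Φ (r * t)) (p := -1) (by norm_num)).2 hg
  have hS0 := integral_comp_rpow_Ioi (fun t => t * Φ (r * t)) (p := -1) (by norm_num)
  rw [hg0, setIntegral_congr_fun measurableSet_Ioi e1] at hS0
  replace hS := (integrableOn_congr_fun e1 measurableSet_Ioi).1 hS
  rw [← Set.Ioc_union_Ioi_eq_Ioi (zero_le_one : (0:ℝ) ≤ 1)] at hS hS0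
  rw [setIntegral_union (Set.Ioc_disjoint_Ioi le_rfl) measurableSet_Ioi
    (hS.mono_set Set.subset_union_left) (hS.mono_set Set.subset_union_right)] at hS0
  linarith

/-- The kernel of the exterior integral conjugated by `r^m`. With the `L²` scaling factor `s` its
mass is `∫_0^1 s^(m-2) ds`, finite exactly for `m > 1`. -/
lemma isSuperposition_rpow {m : ℝ} (hm : 1 < m) :
    IsSuperposition (L := L) (volume.restrict (Set.Ioc (0 : ℝ) 1)) (fun s => s ^ (m - 3))
      (fun s => s) (fun s => dil s⁻¹) dil ∧
    ∫⁻ s in Set.Ioc (0 : ℝ) 1, ‖s ^ (m - 3) * s‖ₑ = ENNReal.ofReal (1 / (m - 1)) := by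
  have e : ∀ s ∈ Set.Ioc (0 : ℝ) 1, s ^ (m - 3) * s = s ^ (m - 2) := fun s hs => by
    rw [← Real.rpow_add_one hs.1.ne']
    ring_nf
  have hi : IntegrableOn (fun s : ℝ => s ^ (m - 2)) (Set.Ioc 0 1) :=
    (intervalIntegrable_iff_integrableOn_Ioc_of_le zero_le_one).1
      (intervalIntegral.intervalIntegrable_rpow' (by linarith))
  refine ⟨isSuperposition_dil measurableSet_Ioc (fun s hs => hs.1) (by fun_prop)
    ((integrableOn_congr_fun e measurableSet_Ioc).2 hi), ?_⟩
  rw [setLIntegral_congr_fun measurableSet_Ioc (fun s hs => by rw [e s hs]),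
    ← ofReal_integral_norm_eq_lintegral_enorm hi]
  congr 1
  rw [setIntegral_congr_fun measurableSet_Ioc
    (fun s hs => Real.norm_of_nonneg (Real.rpow_nonneg hs.1.le (m - 2))),
    ← intervalIntegral.integral_of_le zero_le_one, integral_rpow (.inl (by linarith))]
  rw [show m - 2 + 1 = m - 1 by ring, Real.one_rpow, Real.zero_rpow (by linarith), sub_zero]

lemma measurable_radius : Measurable (radius : Omega L → ℝ) := measurable_fst.norm

lemma radius_nonneg (p : Omega L) : 0 ≤ radius p := norm_nonneg _

lemma radius_dil {s : ℝ} (hs : 0 ≤ s) (p : Omega L) : radius (dil s p) = s * radius p := by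
  simp [radius, dil, norm_smul, abs_of_nonneg hs]

/-- The velocity of a radial vorticity of vanishing mean decays at infinity. -/
lemma eLpNorm_radius_rpow_mul_discMean_le {m : ℝ} (hm : 1 < m) {Φ : ℝ → ℝ} (hΦ : Measurable Φ)
    (hi : Integrable fun p : Omega L => Φ (radius p)) (h0 : ∫ p : Omega L, Φ (radius p) = 0) :
    eLpNorm (fun p : Omega L => radius p ^ m * discMean (fun p => Φ (radius p)) p) 2 volume ≤
      ENNReal.ofReal (1 / (m - 1)) *
        eLpNorm (fun p : Omega L => radius p ^ m * Φ (radius p)) 2 volume := by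
  have hT : 0 < 2 * Real.pi * L := (fact_period_pos L).out
  obtain ⟨hI, hI0⟩ := integral_radial hi
  rw [h0, eq_comm, mul_eq_zero] at hI0
  have hI0 := hI0.resolve_left (mul_pos hT Real.two_pi_pos).ne'
  obtain ⟨hs, hsn⟩ := isSuperposition_rpow (L := L) hm
  have hg : Measurable fun p : Omega L => radius p ^ m * Φ (radius p) :=
    (measurable_radius.pow_const m).mul (hΦ.comp measurable_radius)
  rw [← hsn]
  -- Distributing `r^m = s^m (r / s)^m` under the exterior integral exhibits the left side, up to
  -- sign, as a superposition of dilates of `r^m Φ`.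
  refine le_trans (le_of_eq ?_) (hs.eLpNorm_superpose_le hg)
  rw [← eLpNorm_neg (f := superpose _ _ _ _)]
  refine eLpNorm_congr_ae ?_
  filter_upwards [ae_ne_axis] with p hp
  have hr : 0 < radius p := norm_pos_iff.2 hp
  have e1 : discMean (fun p : Omega L => Φ (radius p)) p =
      ∫ s in Set.Ioi 1, s⁻¹ ^ 3 * Φ (s⁻¹ * radius p) := by
    refine setIntegral_congr_fun measurableSet_Ioi fun s hs => ?_
    simp only [radius_dil (inv_nonneg.2 (zero_le_one.trans (le_of_lt hs)))]
  rw [e1, integral_dil_radial hI hI0 hr, Pi.neg_apply, mul_neg, superpose, ← integral_const_mul]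
  congr 1
  refine setIntegral_congr_fun measurableSet_Ioc fun s hs => ?_
  have hs0 : 0 < s := hs.1
  simp only [radius_dil (inv_nonneg.2 hs0.le)]
  rw [Real.mul_rpow (inv_nonneg.2 hs0.le) hr.le, Real.inv_rpow hs0.le, Real.rpow_sub hs0]
  have := (Real.rpow_pos_of_pos hs0 m).ne'
  field_simp
  norm_cast
  rw [mul_comm]

end HelicalOseen

namespace HelicalOseen

variable {L : ℝ} [Fact (0 < L)]

/-! ### Linearity of divergence and curl -/

lemma locallyIntegrable_add_smul {v w : Omega L → Vec} (hv : LocallyIntegrable v)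
    (hw : LocallyIntegrable w) (a : ℝ) : LocallyIntegrable fun p => v p + a • w p :=
  hv.add (hw.smul a)

lemma integral_add_smul_mul {v w : Omega L → Vec} (hv : LocallyIntegrable v)
    (hw : LocallyIntegrable w) (a : ℝ) (i : Fin 3) {φ : Omega L → ℝ} (hφ : IsTest φ) :
    ∫ p, (v p + a • w p) i * φ p = (∫ p, v p i * φ p) + a * ∫ p, w p i * φ p := by
  rw [← integral_const_mul, ← integral_add (hφ.integrable_mul (locallyIntegrable_component hv i))
    ((hφ.integrable_mul (locallyIntegrable_component hw i)).const_mul a)]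
  congr 1
  funext p
  simp
  ring

lemma IsDivFree.add_smul {v w : Omega L → Vec} (hv : IsDivFree v) (hw : IsDivFree w) (a : ℝ) :
    IsDivFree fun p => v p + a • w p := by
  have hl := locallyIntegrable_add_smul hv.locallyIntegrable hw.locallyIntegrable a
  refine (isDivFree_iff hl).2 fun φ hφ => ?_
  have h1 := (isDivFree_iff hv.locallyIntegrable).1 hv φ hφ
  have h2 := (isDivFree_iff hw.locallyIntegrable).1 hw φ hφ
  simp only [fun i => integral_add_smul_mul hv.locallyIntegrable hw.locallyIntegrable a i
    (hφ.isTest_partialDeriv i), Finset.sum_add_distrib, ← Finset.mul_sum, h1, h2, mul_zero,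
    add_zero]

lemma HasCurl.add_smul {v w ω ω' : Omega L → Vec} (hv : HasCurl v ω) (hw : HasCurl w ω') (a : ℝ) :
    HasCurl (fun p => v p + a • w p) (fun p => ω p + a • ω' p) := by
  have key := fun i (φ : Omega L → ℝ) (hφ : IsTest φ) =>
    integral_add_smul_mul hv.locallyIntegrable hw.locallyIntegrable a i hφ
  have key' := fun i (φ : Omega L → ℝ) (hφ : IsTest φ) =>
    integral_add_smul_mul hv.locallyIntegrable_curl hw.locallyIntegrable_curl a i hφ
  refine ⟨locallyIntegrable_add_smul hv.locallyIntegrable hw.locallyIntegrable a,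
    locallyIntegrable_add_smul hv.locallyIntegrable_curl hw.locallyIntegrable_curl a,
    fun φ hφ => ?_, fun φ hφ => ?_, fun φ hφ => ?_⟩
  · have h1 := hv.curl_x φ hφ
    have h2 := hw.curl_x φ hφ
    simp only [distDeriv, key _ _ (hφ.isTest_partialDeriv _), key' _ _ hφ] at h1 h2 ⊢
    linear_combination h1 + a * h2
  · have h1 := hv.curl_y φ hφ
    have h2 := hw.curl_y φ hφ
    simp only [distDeriv, key _ _ (hφ.isTest_partialDeriv _), key' _ _ hφ] at h1 h2 ⊢
    linear_combination h1 + a * h2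
  · have h1 := hv.curl_z φ hφ
    have h2 := hw.curl_z φ hφ
    simp only [distDeriv, key _ _ (hφ.isTest_partialDeriv _), key' _ _ hφ] at h1 h2 ⊢
    linear_combination h1 + a * h2

/-! ### Azimuthal fields -/

/-- The azimuthal field `r h e_θ`. -/
noncomputable def azimuthal (h : Omega L → ℝ) (p : Omega L) : Vec := !₂[-(p.1 1) * h p, p.1 0 * h p, 0]

/-- The vertical field `f e_z`. -/
noncomputable def vertical (f : Omega L → ℝ) (p : Omega L) : Vec := !₂[0, 0, f p]

lemma locallyIntegrable_of_components {u : Omega L → Vec}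
    (hu : ∀ i, LocallyIntegrable fun p => u p i) : LocallyIntegrable u := by
  have : u = fun p => ∑ i, u p i • EuclideanSpace.single i (1 : ℝ) := by
    funext p
    ext j
    fin_cases j <;> simp [Fin.sum_univ_three]
  rw [this]
  have h : ∀ i, LocallyIntegrable fun p => u p i • (EuclideanSpace.single i (1 : ℝ) : Vec) := by
    intro i x
    obtain ⟨s, hs, hi⟩ := hu i x
    exact ⟨s, hs, Integrable.smul_const hi _⟩
  simp only [Fin.sum_univ_three]
  exact ((h 0).add (h 1)).add (h 2)

lemma locallyIntegrable_azimuthal {h : Omega L → ℝ} (hh : LocallyIntegrable h) :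
    LocallyIntegrable (azimuthal h) := by
  have h0 : ∀ i : Fin 2, Continuous fun p : Omega L => p.1 i := fun i => by fun_prop
  have key : ∀ g : Omega L → ℝ, Continuous g → LocallyIntegrable fun p => g p * h p := by
    intro g hg
    exact (hh.locallyIntegrableOn _).continuousOn_mul hg.continuousOn isOpen_univ.isLocallyClosed
      |> locallyIntegrableOn_univ.1
  refine locallyIntegrable_of_components fun i => ?_
  fin_cases i
  · exact key _ (h0 1).neg
  · exact key _ (h0 0)
  · exact locallyIntegrable_zero

lemma locallyIntegrable_vertical {f : Omega L → ℝ} (hf : LocallyIntegrable f) :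
    LocallyIntegrable (vertical f) := by
  refine locallyIntegrable_of_components fun i => ?_
  fin_cases i
  · exact locallyIntegrable_zero
  · exact locallyIntegrable_zero
  · exact hf

lemma discMean_add_translation {f : Omega L → ℝ} (hz : ∀ p t, f (p + translation L 2 t) = f p)
    (p : Omega L) (t : ℝ) : discMean f (p + translation L 2 t) = discMean f p := by
  have e : ∀ s : ℝ, dil s⁻¹ (p + translation L 2 t) = dil s⁻¹ p + translation L 2 t := by
    intro s
    simp [dil, translation]
  simp only [discMean, superpose, e, hz]

/-- Vertical invariance kills the `∂_z` terms in the horizontal components; the vertical one is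
`integral_discMean_euler`. No radial symmetry of `f` is needed for the curl. -/
lemma hasCurl_azimuthal {f : Omega L → ℝ} (hf : Measurable f) (hf2 : MemLp f 2)
    (hz : ∀ p t, f (p + translation L 2 t) = f p) :
    HasCurl (azimuthal (discMean f)) (vertical f) := by
  have hh2 : MemLp (discMean f) 2 := isSuperposition_discMean.memLp_superpose hf hf2
  have hhl := hh2.locallyIntegrable one_le_two
  have hl := locallyIntegrable_azimuthal hhl
  have hzero : ∀ i : Fin 3, ∀ φ : Omega L → ℝ, IsTest φ →
      ∫ p, azimuthal (discMean f) p i * partialDeriv 2 φ p = 0 := by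
    intro i φ hφ
    refine integral_partialDeriv_of_invariant hφ (locallyIntegrable_component hl i) 2 fun t p => ?_
    have e1 : (p + translation L 2 t).1 = p.1 := by simp [translation]
    simp only [azimuthal, discMean_add_translation hz, e1]
  refine ⟨hl, locallyIntegrable_vertical (hf2.locallyIntegrable one_le_two),
    fun φ hφ => ?_, fun φ hφ => ?_, fun φ hφ => ?_⟩
  · simp only [distDeriv, hzero 1 φ hφ]
    simp [azimuthal, vertical]
  · simp only [distDeriv, hzero 0 φ hφ]
    simp [azimuthal, vertical]
  · have h1 := integral_discMean_euler hf hf2 hφ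
    have hi0 := (hφ.isTest_partialDeriv 0).integrable_mul (locallyIntegrable_component hl 1)
    have hi1 := (hφ.isTest_partialDeriv 1).integrable_mul (locallyIntegrable_component hl 0)
    have h2 : ∫ p, discMean f p * euler φ p =
        (∫ p, azimuthal (discMean f) p 1 * partialDeriv 0 φ p) -
          ∫ p, azimuthal (discMean f) p 0 * partialDeriv 1 φ p := by
      rw [← integral_sub hi0 hi1]
      congr 1
      funext p
      simp [azimuthal, euler]
      ring
    simp only [distDeriv]
    rw [h2] at h1
    have h3 : ∫ p, vertical f p 2 * φ p = ∫ p, f p * φ p := rfl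
    linarith

lemma radius_screw (α : ℝ) (p : Omega L) : radius (screw L α p) = radius p := norm_rotate α p.1

lemma radius_sq (p : Omega L) : radius p ^ 2 = p.1 0 ^ 2 + p.1 1 ^ 2 := by
  rw [radius, EuclideanSpace.norm_sq_eq]
  simp

lemma isHelical_azimuthal (H : ℝ → ℝ) : IsHelical (azimuthal fun p : Omega L => H (radius p)) := by
  have h0 : ∀ p : Omega L, inner ℝ (azimuthal (fun p : Omega L => H (radius p)) p) (eR p) = 0 := by
    intro p
    simp [inner_euclidean, Fin.sum_univ_three, azimuthal, eR]
    ring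
  have h1 : ∀ p : Omega L, inner ℝ (azimuthal (fun p : Omega L => H (radius p)) p) (eTheta p) =
      H (radius p) * (radius p ^ 2 / radius p) := by
    intro p
    simp [inner_euclidean, Fin.sum_univ_three, azimuthal, eTheta, radius_sq]
    ring
  have h2 : ∀ p : Omega L, inner ℝ (azimuthal (fun p : Omega L => H (radius p)) p) eZ = 0 := by
    intro p
    simp [inner_euclidean, Fin.sum_univ_three, azimuthal, eZ]
  refine ⟨fun α => .of_forall fun p => ?_, fun α => .of_forall fun p => ?_,
    fun α => .of_forall fun p => ?_⟩
  · simp only [h0]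
  · simp only [h1, radius_screw]
  · simp only [h2]

lemma isHelical_vertical (H : ℝ → ℝ) : IsHelical (vertical fun p : Omega L => H (radius p)) := by
  refine ⟨fun α => .of_forall fun p => ?_, fun α => .of_forall fun p => ?_,
    fun α => .of_forall fun p => ?_⟩ <;>
  simp [inner_euclidean, Fin.sum_univ_three, vertical, eR, eTheta, eZ, radius_screw]

/-- The operator `-y ∂_x + x ∂_y` generates rotations, which preserve both the volume and `H(r)`, so
the pairing of `H(r)` with a rotated test function has derivative zero. -/
lemma isDivFree_azimuthal {H : ℝ → ℝ} (hH : LocallyIntegrable fun p : Omega L => H (radius p)) :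
    IsDivFree (azimuthal fun p : Omega L => H (radius p)) := by
  have hl := locallyIntegrable_azimuthal hH
  refine (isDivFree_iff hl).2 fun φ hφ => ?_
  have hψ : IsTest fun p : Omega L => -1 * (p.1 1 * partialDeriv 0 φ p) + p.1 0 * partialDeriv 1 φ p :=
    (((isSmooth_coord 1).mul_test (hφ.isTest_partialDeriv 0)).const_mul _).add
      ((isSmooth_coord 0).mul_test (hφ.isTest_partialDeriv 1))
  have hd : ∀ (p : Omega L) (t : ℝ), HasDerivAt (fun t => φ (rigid t 0 p))
      ((fun p : Omega L => -1 * (p.1 1 * partialDeriv 0 φ p) + p.1 0 * partialDeriv 1 φ p) (rigid t 0 p)) t := by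
    intro p t
    obtain ⟨q, rfl⟩ := exists_cover p
    have hc : HasDerivAt (fun t : ℝ => ((rotate t q.1, q.2) : Plane × ℝ))
        (!₂[-(rotate t q.1 1), rotate t q.1 0], 0) t := by
      refine HasDerivAt.prodMk ?_ (hasDerivAt_const _ _)
      have e : (fun t => rotate t q.1) =
          fun t => Real.cos t • q.1 + Real.sin t • (!₂[-(q.1 1), q.1 0] : Plane) := by
        funext t
        ext i
        fin_cases i <;> simp [rotate] <;> ring
      rw [e]
      refine (((Real.hasDerivAt_cos t).smul_const q.1).add
        ((Real.hasDerivAt_sin t).smul_const (!₂[-(q.1 1), q.1 0] : Plane))).congr_deriv ?_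
      ext i
      fin_cases i <;> simp [rotate] <;> ring
    have := hφ.isSmooth.hasDerivAt_curve hc
    simpa [cover, rigid_zero_apply] using this
  have hflow := hasDerivAt_integral_flow hH hφ.continuous hφ.compact_support hψ.continuous
    hψ.compact_support (Φ := fun t p => rigid t 0 p) continuous_rigid rigid_neg_rigid hd 0
  have hconst : (fun t : ℝ => ∫ p : Omega L, H (radius p) * φ (rigid t 0 p)) =
      fun _ => ∫ p : Omega L, H (radius p) * φ p := by
    funext t
    rw [← integral_comp_rigid t 0 fun p => H (radius p) * φ p]
    have : ∀ p : Omega L, radius (rigid t 0 p) = radius p := fun p => by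
      rw [rigid_zero_apply]
      exact norm_rotate t p.1
    simp only [this]
  rw [hconst] at hflow
  have h0 := hflow.unique (hasDerivAt_const _ _)
  have hr0 : ∀ p : Omega L, rigid 0 0 p = p := fun p => by rw [rigid_zero_apply, rotate_zero]
  simp only [hr0] at h0
  rw [Fin.sum_univ_three, ← integral_add ((hφ.isTest_partialDeriv 0).integrable_mul
      (locallyIntegrable_component hl 0)) ((hφ.isTest_partialDeriv 1).integrable_mul
      (locallyIntegrable_component hl 1))]
  have h2 : ∫ p, azimuthal (fun p : Omega L => H (radius p)) p 2 * partialDeriv 2 φ p = 0 := by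
    simp [azimuthal]
  rw [h2, add_zero, ← h0]
  congr 1
  funext p
  simp [azimuthal]
  ring

end HelicalOseen

namespace HelicalOseen

variable {L : ℝ} [Fact (0 < L)]

/-! ### Weights -/

lemma one_add_sq_pos (r : ℝ) : 0 < 1 + r ^ 2 := by positivity

/-- The threshold is that of the plane; the circle has finite measure and does not affect it. -/
lemma memLp_weight {s : ℝ} {p : ℝ≥0∞} (hp0 : p ≠ 0) (hp : p ≠ ∞) (h : 2 < s * p.toReal) :
    MemLp (fun q : Omega L => (1 + radius q ^ 2) ^ (-s / 2)) p := by
  have hm : Measurable fun q : Omega L => (1 + radius q ^ 2) ^ (-s / 2) :=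
    (measurable_const.add (measurable_radius.pow_const 2)).pow_const _
  refine (integrable_norm_rpow_iff hm.aestronglyMeasurable hp0 hp).1 ?_
  have h1 : Integrable (fun x : Plane => (1 + ‖x‖ ^ 2) ^ (-(s * p.toReal) / 2)) :=
    integrable_rpow_neg_one_add_norm_sq (by simpa using h)
  have h2 : Integrable (fun q : Omega L => (1 + ‖q.1‖ ^ 2) ^ (-(s * p.toReal) / 2)) :=
    h1.comp_fst _
  refine h2.congr (.of_forall fun q => ?_)
  have := one_add_sq_pos ‖q.1‖
  simp only [radius]
  rw [Real.norm_of_nonneg (Real.rpow_nonneg this.le _), ← Real.rpow_mul this.le]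
  congr 1
  ring

/-! ### The Lamb-Oseen vortex -/

/-- The radial profile of the vorticity of the Lamb-Oseen vortex. -/
noncomputable def gauss (r : ℝ) : ℝ := 1 / (4 * Real.pi) * Real.exp (-(r ^ 2) / 4)

lemma gauss_nonneg (r : ℝ) : 0 ≤ gauss r := by
  have := Real.pi_pos
  unfold gauss
  positivity

lemma measurable_gauss : Measurable gauss := by
  unfold gauss
  fun_prop

lemma exists_rpow_mul_gauss_le {m : ℝ} (hm : 0 < m) :
    ∃ C : ℝ, 0 ≤ C ∧ ∀ r : ℝ, (1 + r ^ 2) ^ m * gauss r ≤ C := by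
  refine ⟨(4 * m) ^ m * (Real.exp (1 / 4) * (1 / (4 * Real.pi))), by positivity, fun r => ?_⟩
  have h0 := one_add_sq_pos r
  have h1 : (1 + r ^ 2) / (4 * m) ≤ Real.exp ((1 + r ^ 2) / (4 * m)) :=
    (le_add_of_nonneg_right zero_le_one).trans (Real.add_one_le_exp _)
  have h2 := Real.rpow_le_rpow (by positivity) h1 hm.le
  rw [← Real.exp_mul, Real.div_rpow h0.le (by positivity), div_le_iff₀ (by positivity)] at h2
  have h3 : (1 + r ^ 2) / (4 * m) * m = 1 / 4 + r ^ 2 / 4 := by field_simp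
  rw [h3, Real.exp_add] at h2
  have hpos : (0 : ℝ) < Real.exp (-(r ^ 2) / 4) := Real.exp_pos _
  have h4 : Real.exp (r ^ 2 / 4) * Real.exp (-(r ^ 2) / 4) = 1 := by
    rw [← Real.exp_add]
    simp [neg_div]
  calc (1 + r ^ 2) ^ m * gauss r
      ≤ (Real.exp (1 / 4) * Real.exp (r ^ 2 / 4) * (4 * m) ^ m) * gauss r :=
        mul_le_mul_of_nonneg_right h2 (gauss_nonneg r)
    _ = (4 * m) ^ m * (Real.exp (1 / 4) * (1 / (4 * Real.pi))) *
          (Real.exp (r ^ 2 / 4) * Real.exp (-(r ^ 2) / 4)) := by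
        unfold gauss
        ring
    _ = _ := by rw [h4, mul_one]

lemma measurable_gauss_radius : Measurable fun p : Omega L => gauss (radius p) :=
  measurable_gauss.comp measurable_radius

lemma memLp_weight_mul_gauss {m : ℝ} (hm : 1 < m) :
    MemLp (fun p : Omega L => (1 + radius p ^ 2) ^ (m / 2) * gauss (radius p)) 2 := by
  obtain ⟨C, hC0, hC⟩ := exists_rpow_mul_gauss_le (zero_lt_one.trans hm)
  have hw := (memLp_weight (L := L) (s := m) (p := 2) (by simp) (by simp)
    (by simp; linarith)).const_mul C
  have hmeas : Measurable fun p : Omega L => (1 + radius p ^ 2) ^ (m / 2) * gauss (radius p) :=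
    ((measurable_const.add (measurable_radius.pow_const 2)).pow_const _).mul measurable_gauss_radius
  refine hw.mono hmeas.aestronglyMeasurable (.of_forall fun p => ?_)
  have h0 := one_add_sq_pos (radius p)
  rw [Real.norm_of_nonneg (mul_nonneg (Real.rpow_nonneg h0.le _) (gauss_nonneg _)),
    Real.norm_of_nonneg (mul_nonneg hC0 (Real.rpow_nonneg h0.le _))]
  have e : (1 + radius p ^ 2) ^ (m / 2) =
      (1 + radius p ^ 2) ^ m * (1 + radius p ^ 2) ^ (-m / 2) := by
    rw [← Real.rpow_add h0]
    ring_nf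
  rw [e]
  calc _ = ((1 + radius p ^ 2) ^ m * gauss (radius p)) * (1 + radius p ^ 2) ^ (-m / 2) := by ring
    _ ≤ _ := mul_le_mul_of_nonneg_right (hC _) (Real.rpow_nonneg h0.le _)

lemma memLp_gauss {p : ℝ≥0∞} (h1 : 1 ≤ p) (hp : p ≠ ∞) :
    MemLp (fun q : Omega L => gauss (radius q)) p := by
  obtain ⟨C, hC0, hC⟩ := exists_rpow_mul_gauss_le (m := 2) two_pos
  have hp1 : 1 ≤ p.toReal := by
    simpa using (ENNReal.toReal_le_toReal ENNReal.one_ne_top hp).2 h1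
  have hw := (memLp_weight (L := L) (s := 4) (p := p) (zero_lt_one.trans_le h1).ne' hp
    (by linarith)).const_mul C
  refine hw.mono measurable_gauss_radius.aestronglyMeasurable (.of_forall fun q => ?_)
  have h0 := one_add_sq_pos (radius q)
  rw [Real.norm_of_nonneg (gauss_nonneg _),
    Real.norm_of_nonneg (mul_nonneg hC0 (Real.rpow_nonneg h0.le _))]
  have e : gauss (radius q) = ((1 + radius q ^ 2) ^ (2 : ℝ) * gauss (radius q)) *
      (1 + radius q ^ 2) ^ ((-4 : ℝ) / 2) := by
    rw [mul_right_comm, ← Real.rpow_add h0]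
    norm_num
  rw [e]
  exact mul_le_mul_of_nonneg_right (hC _) (Real.rpow_nonneg h0.le _)

lemma integrable_gauss : Integrable fun q : Omega L => gauss (radius q) :=
  memLp_one_iff_integrable.1 (memLp_gauss le_rfl ENNReal.one_ne_top)

/-- This normalisation gives the vortex circulation one, so subtracting `a` times it removes the
mean of the vertical vorticity. -/
lemma integral_gauss : ∫ p : Omega L, gauss (radius p) = 2 * Real.pi * L := by
  rw [(integral_radial integrable_gauss).2]
  have hd : ∀ t ∈ Set.Ici (0 : ℝ), HasDerivAt (fun t : ℝ => -(1 / (2 * Real.pi)) * Real.exp (-(t ^ 2) / 4))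
      (t * gauss t) t := by
    intro t _
    have h1 : HasDerivAt (fun t : ℝ => -(t ^ 2) / 4) (-(2 * t) / 4) t := by
      simpa using ((hasDerivAt_pow 2 t).neg).div_const 4
    refine (h1.exp.const_mul _).congr_deriv ?_
    unfold gauss
    field_simp
  have hlim : Filter.Tendsto (fun t : ℝ => -(1 / (2 * Real.pi)) * Real.exp (-(t ^ 2) / 4))
      Filter.atTop (nhds 0) := by
    have h1 : Filter.Tendsto (fun t : ℝ => -(t ^ 2) / 4) Filter.atTop Filter.atBot :=
      (Filter.tendsto_neg_atTop_atBot.comp (Filter.tendsto_pow_atTop two_ne_zero)).atBot_div_const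
        (by norm_num)
    simpa using (Real.tendsto_exp_atBot.comp h1).const_mul (-(1 / (2 * Real.pi)))
  rw [integral_Ioi_of_hasDerivAt_of_nonneg' hd
    (fun t ht => mul_nonneg (le_of_lt ht) (gauss_nonneg t)) hlim]
  have := Real.pi_ne_zero
  simp
  field_simp

/-- The angular velocity of the Lamb-Oseen vortex. -/
noncomputable def oseenAngular (r : ℝ) : ℝ :=
  1 / (2 * Real.pi * r) * (1 - Real.exp (-(r ^ 2) / 4)) / r

lemma oseenVelocity_eq : oseenVelocity (L := L) 0 = azimuthal fun p => oseenAngular (radius p) := by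
  funext p
  ext i
  fin_cases i <;> simp [oseenVelocity, azimuthal, oseenAngular, eTheta] <;> ring

/-- In the variable `s` the integrand has the primitive `exp (-(r / s)² / 4) / (2π r²)`. -/
lemma discMean_gauss {p : Omega L} (hp : p.1 ≠ 0) :
    discMean (fun p => gauss (radius p)) p = oseenAngular (radius p) := by
  have hr : 0 < radius p := norm_pos_iff.2 hp
  set r := radius p with hrdef
  have e1 : discMean (fun p : Omega L => gauss (radius p)) p =
      ∫ s in Set.Ioi 1, s⁻¹ ^ 3 * gauss (s⁻¹ * r) := by
    refine setIntegral_congr_fun measurableSet_Ioi fun s hs => ?_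
    simp only [radius_dil (inv_nonneg.2 (zero_le_one.trans (le_of_lt hs))), hrdef]
  have hd : ∀ s ∈ Set.Ici (1 : ℝ), HasDerivAt
      (fun s : ℝ => 1 / (2 * Real.pi * r ^ 2) * Real.exp (-((s⁻¹ * r) ^ 2) / 4))
      (s⁻¹ ^ 3 * gauss (s⁻¹ * r)) s := by
    intro s hs
    have hs0 : s ≠ 0 := (zero_lt_one.trans_le hs).ne'
    have h1 : HasDerivAt (fun s : ℝ => -((s⁻¹ * r) ^ 2) / 4)
        (-(2 * (s⁻¹ * r) * (-(s ^ 2)⁻¹ * r)) / 4) s := by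
      simpa using ((((hasDerivAt_inv hs0).mul_const r).pow 2).neg).div_const 4
    refine (h1.exp.const_mul _).congr_deriv ?_
    unfold gauss
    field_simp
  have hlim : Filter.Tendsto
      (fun s : ℝ => 1 / (2 * Real.pi * r ^ 2) * Real.exp (-((s⁻¹ * r) ^ 2) / 4))
      Filter.atTop (nhds (1 / (2 * Real.pi * r ^ 2))) := by
    have h1 : Filter.Tendsto (fun s : ℝ => -((s⁻¹ * r) ^ 2) / 4) Filter.atTop (nhds 0) := by
      simpa using ((((tendsto_inv_atTop_zero (𝕜 := ℝ)).mul_const r).pow 2).neg).div_const 4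
    have h2 := ((Real.continuous_exp.tendsto 0).comp h1).const_mul (1 / (2 * Real.pi * r ^ 2))
    rw [Real.exp_zero, mul_one] at h2
    exact h2
  rw [e1, integral_Ioi_of_hasDerivAt_of_nonneg' hd (fun s hs => mul_nonneg
    (pow_nonneg (inv_nonneg.2 (zero_le_one.trans (le_of_lt hs))) 3) (gauss_nonneg _)) hlim]
  unfold oseenAngular
  rw [inv_one, one_mul]
  field_simp

lemma discMean_gauss_ae : discMean (fun p : Omega L => gauss (radius p)) =ᵐ[volume]
    fun p => oseenAngular (radius p) := by
  filter_upwards [ae_ne_axis] with p hp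
  exact discMean_gauss hp

lemma HasCurl.congr_left {v v' ω : Omega L → Vec} (h : HasCurl v ω) (hv : v =ᵐ[volume] v') :
    HasCurl v' ω := by
  have hl : LocallyIntegrable v' := by
    intro x
    obtain ⟨s, hs, hi⟩ := h.locallyIntegrable x
    exact ⟨s, hs, hi.congr (ae_restrict_of_ae hv)⟩
  have key : ∀ (i : Fin 3) (ψ : Omega L → ℝ), ∫ p, v' p i * ψ p = ∫ p, v p i * ψ p := by
    intro i ψ
    refine integral_congr_ae ?_
    filter_upwards [hv] with p hp
    rw [hp]
  refine ⟨hl, h.locallyIntegrable_curl, fun φ hφ => ?_, fun φ hφ => ?_, fun φ hφ => ?_⟩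
  · simpa only [distDeriv, key] using h.curl_x φ hφ
  · simpa only [distDeriv, key] using h.curl_y φ hφ
  · simpa only [distDeriv, key] using h.curl_z φ hφ

lemma hasCurl_oseenVelocity :
    HasCurl (L := L) (oseenVelocity 0) (vertical fun p => gauss (radius p)) := by
  rw [oseenVelocity_eq]
  have hz : ∀ (p : Omega L) (t : ℝ), gauss (radius (p + translation L 2 t)) = gauss (radius p) := by
    intro p t
    have e1 : (p + translation L 2 t).1 = p.1 := by simp [translation]
    simp only [radius, e1]
  refine (hasCurl_azimuthal measurable_gauss_radius
    (memLp_gauss one_le_two ENNReal.ofNat_ne_top) hz).congr_left ?_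
  filter_upwards [discMean_gauss_ae] with p hp
  simp only [azimuthal, hp]

lemma isHelical_oseenVelocity : IsHelical (L := L) (oseenVelocity 0) := by
  rw [oseenVelocity_eq]
  exact isHelical_azimuthal _

lemma isDivFree_oseenVelocity : IsDivFree (L := L) (oseenVelocity 0) := by
  rw [oseenVelocity_eq]
  refine isDivFree_azimuthal ?_
  have h2 : MemLp (discMean fun p : Omega L => gauss (radius p)) 2 :=
    isSuperposition_discMean.memLp_superpose measurable_gauss_radius
      (memLp_gauss one_le_two ENNReal.ofNat_ne_top)
  exact ((memLp_congr_ae discMean_gauss_ae).1 h2).locallyIntegrable one_le_two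

lemma norm_azimuthal (h : Omega L → ℝ) (p : Omega L) : ‖azimuthal h p‖ = radius p * |h p| := by
  rw [← sq_eq_sq₀ (norm_nonneg _) (mul_nonneg (radius_nonneg p) (abs_nonneg _)),
    EuclideanSpace.norm_sq_eq, mul_pow, radius_sq, sq_abs]
  simp [Fin.sum_univ_three, azimuthal]
  ring

/-- Uses `1 - exp (-r² / 4) ≤ min 1 (r² / 4)`: the quadratic bound for `r ≤ 1`, the constant one for
`r ≥ 1`. -/
lemma abs_mul_oseenAngular_le {r : ℝ} (hr : 0 ≤ r) :
    r * |oseenAngular r| ≤ (1 + r ^ 2) ^ (-(1 : ℝ) / 2) := by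
  rcases hr.eq_or_lt with rfl | hr
  · rw [zero_mul]
    positivity
  have hπ := Real.pi_gt_three
  have h1 : 0 ≤ 1 - Real.exp (-(r ^ 2) / 4) :=
    sub_nonneg.2 (Real.exp_le_one_iff.2 (by nlinarith))
  have e : r * |oseenAngular r| = (1 - Real.exp (-(r ^ 2) / 4)) / (2 * Real.pi * r) := by
    rw [abs_of_nonneg (by unfold oseenAngular; positivity), oseenAngular]
    field_simp
  have h2 : 1 - Real.exp (-(r ^ 2) / 4) ≤ r ^ 2 / 4 := by
    have := Real.add_one_le_exp (-(r ^ 2) / 4)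
    linarith
  have h3 : 1 - Real.exp (-(r ^ 2) / 4) ≤ 1 := by
    have := Real.exp_pos (-(r ^ 2) / 4)
    linarith
  have hs : 0 < 1 + r ^ 2 := one_add_sq_pos r
  have e2 : (1 + r ^ 2) ^ (-(1 : ℝ) / 2) = (Real.sqrt (1 + r ^ 2))⁻¹ := by
    rw [neg_div, Real.rpow_neg hs.le, Real.sqrt_eq_rpow]
  have h4 : Real.sqrt (1 + r ^ 2) ≤ 1 + r :=
    Real.sqrt_le_iff.2 ⟨by positivity, by nlinarith⟩
  rw [e, e2, div_le_iff₀ (by positivity), inv_mul_eq_div, le_div_iff₀ (Real.sqrt_pos.2 hs)]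
  calc _ ≤ (1 - Real.exp (-(r ^ 2) / 4)) * (1 + r) := mul_le_mul_of_nonneg_left h4 h1
    _ ≤ 2 * 3 * r := by
        rcases le_total r 1 with hr1 | hr1
        · nlinarith
        · nlinarith
    _ ≤ _ := by nlinarith

/-- Decay like `1 / r` in the plane suffices for `L⁶` because `6 > 2`. -/
lemma memLp_oseenVelocity : MemLp (oseenVelocity (L := L) 0) 6 := by
  have hw := memLp_weight (L := L) (s := 1) (p := 6) (by simp) (by simp) (by norm_num)
  refine hw.mono isDivFree_oseenVelocity.locallyIntegrable.aestronglyMeasurable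
    (.of_forall fun p => ?_)
  rw [oseenVelocity_eq, norm_azimuthal,
    Real.norm_of_nonneg (Real.rpow_nonneg (one_add_sq_pos _).le _)]
  exact abs_mul_oseenAngular_le (radius_nonneg p)

end HelicalOseen

namespace HelicalOseen

variable {L : ℝ} [Fact (0 < L)]

/-! ### Weighted estimates -/

/-- The weight `(1 + r²)^{m/2}`. -/
noncomputable def weight (m : ℝ) (p : Omega L) : ℝ := (1 + radius p ^ 2) ^ (m / 2)

lemma measurable_weight (m : ℝ) : Measurable (weight (L := L) m) :=
  (measurable_const.add (measurable_radius.pow_const 2)).pow_const _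

lemma weight_pos (m : ℝ) (p : Omega L) : 0 < weight m p := Real.rpow_pos_of_pos (one_add_sq_pos _) _

lemma one_le_weight {m : ℝ} (hm : 1 < m) (p : Omega L) : 1 ≤ weight m p :=
  Real.one_le_rpow (le_add_of_nonneg_right (sq_nonneg _)) (by linarith)

lemma radius_rpow_le_weight {m : ℝ} (hm : 1 < m) (p : Omega L) : radius p ^ m ≤ weight m p := by
  have h : radius p ^ m = (radius p ^ 2) ^ (m / 2) := by
    rw [← Real.rpow_natCast, ← Real.rpow_mul (radius_nonneg p)]
    congr 1
    push_cast
    ring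
  rw [h]
  exact Real.rpow_le_rpow (sq_nonneg _) (by linarith) (by linarith)

lemma radius_le_one_add_rpow {m : ℝ} (hm : 1 < m) (p : Omega L) : radius p ≤ 1 + radius p ^ m := by
  rcases le_total (radius p) 1 with h | h
  · exact h.trans (le_add_of_nonneg_right (Real.rpow_nonneg (radius_nonneg p) m))
  · have := Real.rpow_le_rpow_of_exponent_le h hm.le
    rw [Real.rpow_one] at this
    linarith

lemma radius_le_weight {m : ℝ} (hm : 1 < m) (p : Omega L) : radius p ≤ weight m p := by
  rcases le_total (radius p) 1 with h | h
  · exact h.trans (one_le_weight hm p)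
  · have := Real.rpow_le_rpow_of_exponent_le h hm.le
    rw [Real.rpow_one] at this
    exact this.trans (radius_rpow_le_weight hm p)

lemma eLpNorm_weighted_component_le (m : ℝ) (ω : Omega L → Vec) (i : Fin 3) :
    eLpNorm (fun p => weight m p * ω p i) 2 volume ≤ l2mNorm m ω :=
  eLpNorm_component_le (weighted m ω) i 2

lemma eLpNorm_le_of_weighted {m : ℝ} (hm : 1 < m) (f : Omega L → ℝ) :
    eLpNorm f 2 volume ≤ eLpNorm (fun p => weight m p * f p) 2 volume := by
  refine eLpNorm_mono fun p => ?_
  rw [norm_mul, Real.norm_of_nonneg (weight_pos m p).le]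
  exact le_mul_of_one_le_left (norm_nonneg _) (one_le_weight hm p)

lemma eLpNorm_le_l2mNorm {m : ℝ} (hm : 1 < m) (ω : Omega L → Vec) :
    eLpNorm ω 2 volume ≤ l2mNorm m ω := by
  refine eLpNorm_mono fun p => ?_
  have e : weighted m ω p = weight m p • ω p := rfl
  rw [e, norm_smul, Real.norm_of_nonneg (weight_pos m p).le]
  exact le_mul_of_one_le_left (norm_nonneg _) (one_le_weight hm p)

lemma memLp_inv_weight {m : ℝ} (hm : 1 < m) : MemLp (fun p : Omega L => (weight m p)⁻¹) 2 := by
  have h := memLp_weight (L := L) (s := m) (p := 2) (by simp) (by simp) (by simp; linarith)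
  refine (memLp_congr_ae (.of_forall fun p => ?_)).1 h
  simp only [weight]
  rw [← Real.rpow_neg (one_add_sq_pos _).le, neg_div]

/-- Cauchy-Schwarz against the inverse weight, which is square integrable in the plane because `m >
1`. This makes the circulation a bounded linear form. -/
lemma integrable_of_weighted {m : ℝ} (hm : 1 < m) {f : Omega L → ℝ}
    (hf : MemLp (fun p => weight m p * f p) 2) :
    Integrable f ∧ ‖∫ p, f p‖ₑ ≤ eLpNorm (fun p : Omega L => (weight m p)⁻¹) 2 volume *
      eLpNorm (fun p => weight m p * f p) 2 volume := by
  have hw := memLp_inv_weight (L := L) hm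
  have e : ∀ p, (weight m p)⁻¹ * (weight m p * f p) = f p := fun p =>
    inv_mul_cancel_left₀ (weight_pos m p).ne' _
  constructor
  · exact (hw.integrable_mul hf).congr (.of_forall e)
  · have := enorm_integral_mul_le (p := 2) (q := 2) hw.1 hf.1
    simpa only [e] using this

/-- The velocity of a radial vorticity of vanishing mean is square integrable. -/
lemma eLpNorm_azimuthal_le {m : ℝ} (hm : 1 < m) {Φ : ℝ → ℝ} (hΦ : Measurable Φ)
    (hw : MemLp (fun p : Omega L => weight m p * Φ (radius p)) 2)
    (h0 : ∫ p : Omega L, Φ (radius p) = 0) :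
    eLpNorm (azimuthal (discMean fun p : Omega L => Φ (radius p))) 2 volume ≤
      (1 + ENNReal.ofReal (1 / (m - 1))) *
        eLpNorm (fun p : Omega L => weight m p * Φ (radius p)) 2 volume := by
  have hf : Measurable fun p : Omega L => Φ (radius p) := hΦ.comp measurable_radius
  have hh := isSuperposition_discMean.measurable_superpose hf
  set h := discMean fun p : Omega L => Φ (radius p) with hdef
  have hrm : Measurable fun p : Omega L => radius p ^ m * h p :=
    (measurable_radius.pow_const m).mul hh
  -- Since `r ≤ 1 + r^m`, the velocity `r |h|` splits into a part bounded by the `L²` contraction of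
  -- disc means and a part bounded by the weighted estimate for zero mean.
  have h1 : eLpNorm (azimuthal h) 2 volume ≤ eLpNorm ((fun p => ‖h p‖) +
      fun p => ‖radius p ^ m * h p‖) 2 volume := by
    refine eLpNorm_mono fun p => ?_
    rw [norm_azimuthal, Pi.add_apply, Real.norm_of_nonneg (by positivity), norm_mul,
      Real.norm_of_nonneg (Real.rpow_nonneg (radius_nonneg p) m), Real.norm_eq_abs]
    have := mul_le_mul_of_nonneg_right (radius_le_one_add_rpow hm p) (abs_nonneg (h p))
    linarith
  refine h1.trans ((eLpNorm_add_le hh.norm.aestronglyMeasurable hrm.norm.aestronglyMeasurable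
    one_le_two).trans ?_)
  rw [eLpNorm_norm, eLpNorm_norm, add_mul, one_mul]
  refine add_le_add ((eLpNorm_discMean_le hf).trans (eLpNorm_le_of_weighted hm _)) ?_
  refine (eLpNorm_radius_rpow_mul_discMean_le hm hΦ (integrable_of_weighted hm hw).1 h0).trans ?_
  refine mul_le_mul_right ?_ _
  refine eLpNorm_mono fun p => ?_
  rw [norm_mul, norm_mul, Real.norm_of_nonneg (weight_pos m p).le,
    Real.norm_of_nonneg (Real.rpow_nonneg (radius_nonneg p) m)]
  exact mul_le_mul_of_nonneg_right (radius_rpow_le_weight hm p) (norm_nonneg _)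

/-- A screw motion is a rotation followed by a vertical shift, and the vertical average does not see
the shift. -/
lemma zMean_rigid {f : Omega L → ℝ} (hf : Measurable f) (hh : IsHelicalScalar f) (α : ℝ) :
    ∀ᵐ p, zMean f (rigid α 0 p) = zMean f p := by
  have hm : Measurable fun p => f (screw L α p) := by
    have : screw L α = rigid α (0, ((L * α : ℝ) : AddCircle (2 * Real.pi * L))) :=
      funext (screw_eq_rigid α)
    rw [this]
    exact hf.comp (Homeomorph.continuous _).measurable
  filter_upwards [isSuperposition_zMean.superpose_congr_ae hm hf (hh α)] with p hp
  rw [← zMean_add_translation f (rigid α 0 p) (L * α)]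
  refine Eq.trans ?_ hp
  simp only [zMean, superpose]
  congr 1
  funext s
  congr 2
  refine Prod.ext ?_ ?_
  · simp [zshift, translation, screw, rigid_zero_apply]
  · simp [zshift, translation, screw, rigid_zero_apply, add_right_comm]

lemma eLpNorm_weight_mul_zMean_le (m : ℝ) {f : Omega L → ℝ} (hf : Measurable f) :
    eLpNorm (fun p => weight m p * zMean f p) 2 volume ≤
      (∫⁻ _, ‖1 / (2 * Real.pi * L) * 1‖ₑ ∂(periodMeasure L)) *
        eLpNorm (fun p => weight m p * f p) 2 volume := by
  have h := isSuperposition_zMean.eLpNorm_superpose_le ((measurable_weight m).mul hf)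
  refine le_trans (le_of_eq ?_) h
  congr 1
  funext p
  exact (superpose_zshift_mul (periodMeasure L) (fun _ => 1 / (2 * Real.pi * L))
    (fun x => (1 + ‖x‖ ^ 2) ^ (m / 2)) f p).symm

end HelicalOseen

namespace HelicalOseen

variable {L : ℝ} [Fact (0 < L)]

/-! ### A square integrable velocity field -/

lemma eLpNorm_le_sum_components {u : Omega L → Vec} (hu : AEStronglyMeasurable u) :
    eLpNorm u 2 volume ≤ eLpNorm (fun p => u p 0) 2 volume + eLpNorm (fun p => u p 1) 2 volume +
      eLpNorm (fun p => u p 2) 2 volume := by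
  rw [← ENNReal.pow_le_pow_left_iff two_ne_zero, eLpNorm_euclidean_sq hu, Fin.sum_univ_three]
  set a := eLpNorm (fun p => u p 0) 2 volume
  set b := eLpNorm (fun p => u p 1) 2 volume
  set c := eLpNorm (fun p => u p 2) 2 volume
  calc a ^ 2 + b ^ 2 + c ^ 2 ≤ a ^ 2 + b ^ 2 + c ^ 2 + 2 * (a * b + b * c + a * c) := le_self_add
    _ = (a + b + c) ^ 2 := by ring

/-- The norm of the averaging operator `zMean`. -/
noncomputable def zMeanConst (L : ℝ) : ℝ≥0∞ :=
  ∫⁻ _, ‖1 / (2 * Real.pi * L) * 1‖ₑ ∂(periodMeasure L)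

/-- The norm of the primitive operator `zPrim`. -/
noncomputable def zPrimConst (L : ℝ) : ℝ≥0∞ :=
  ∫⁻ s, ‖(s / (2 * Real.pi * L) - 1 / 2) * 1‖ₑ ∂(periodMeasure L)

lemma zMeanConst_lt_top : zMeanConst L < ∞ := (isSuperposition_zMean (L := L)).integrable.2

lemma zPrimConst_lt_top : zPrimConst L < ∞ := (isSuperposition_zPrim (L := L)).integrable.2

lemma measurable_zMean {f : Omega L → ℝ} (hf : Measurable f) : Measurable (zMean f) :=
  isSuperposition_zMean.measurable_superpose hf

lemma memLp_weight_mul_zMean {m : ℝ} {f : Omega L → ℝ} (hf : Measurable f)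
    (hw : MemLp (fun p => weight m p * f p) 2) : MemLp (fun p => weight m p * zMean f p) 2 :=
  ⟨((measurable_weight m).mul (measurable_zMean hf)).aestronglyMeasurable,
    (eLpNorm_weight_mul_zMean_le m hf).trans_lt (ENNReal.mul_lt_top zMeanConst_lt_top hw.2)⟩

lemma memLp_weighted_component {m : ℝ} {ω : Omega L → Vec} (hωm : Measurable ω)
    (hω : l2mNorm m ω < ∞) (i : Fin 3) : MemLp (fun p => weight m p * ω p i) 2 := by
  refine ⟨?_, (eLpNorm_weighted_component_le m ω i).trans_lt hω⟩
  have : Measurable fun p => ω p i := by fun_prop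
  exact ((measurable_weight m).mul this).aestronglyMeasurable

lemma memLp_of_weighted {m : ℝ} (hm : 1 < m) {f : Omega L → ℝ} (hf : Measurable f)
    (hw : MemLp (fun p => weight m p * f p) 2) : MemLp f 2 :=
  ⟨hf.aestronglyMeasurable, (eLpNorm_le_of_weighted hm f).trans_lt hw.2⟩

/-- In the horizontal components `∂_z P` returns the fluctuation of `ω` and the derivatives of `k`
return its mean. In the vertical component `div ω = 0` gives `-P (∂_x ω_x + ∂_y ω_y) = ∂_z P ω_z =
ω_z - ⟨ω_z⟩`. -/
lemma hasCurl_fluctuation {ω : Omega L → Vec} (hωm : Measurable ω) (hω2 : MemLp ω 2)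
    (hd : IsDivFree ω) {k : Omega L → ℝ} (hk2 : MemLp k 2)
    (hkz : ∀ p t, k (p + translation L 2 t) = k p)
    (hk0 : ∀ φ : Omega L → ℝ, IsTest φ →
      ∫ p, k p * partialDeriv 0 φ p = ∫ p, zMean (fun p => ω p 1) p * φ p)
    (hk1 : ∀ φ : Omega L → ℝ, IsTest φ →
      ∫ p, k p * partialDeriv 1 φ p = -∫ p, zMean (fun p => ω p 0) p * φ p) :
    HasCurl (fun p => !₂[zPrim (fun p => ω p 1) p, -zPrim (fun p => ω p 0) p, k p])
      (fun p => ω p + (-1 : ℝ) • vertical (zMean fun p => ω p 2) p) := by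
  have hωi : ∀ i, Measurable fun p => ω p i := fun i => by fun_prop
  have hωi2 : ∀ i, MemLp (fun p => ω p i) 2 := memLp_euclidean_iff.1 hω2
  have hW := fun i => isSuperposition_zPrim.memLp_superpose (hωi i) (hωi2 i)
  have hWl := fun i => (hW i).locallyIntegrable one_le_two
  have hb : ∀ i, MemLp (zMean fun p => ω p i) 2 := fun i =>
    isSuperposition_zMean.memLp_superpose (hωi i) (hωi2 i)
  have hbl := fun i => (hb i).locallyIntegrable one_le_two
  have hprim := fun i (φ : Omega L → ℝ) (hφ : IsTest φ) =>
    integral_zPrim_partialDeriv (hωi i) (hωi2 i) hφ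
  have hkz0 : ∀ φ : Omega L → ℝ, IsTest φ → ∫ p, k p * partialDeriv 2 φ p = 0 := fun φ hφ =>
    integral_partialDeriv_of_invariant hφ (hk2.locallyIntegrable one_le_two) 2 fun t p => hkz p t
  refine ⟨locallyIntegrable_of_components fun i => ?_,
    locallyIntegrable_add_smul hd.locallyIntegrable (locallyIntegrable_vertical (hbl 2)) _,
    fun φ hφ => ?_, fun φ hφ => ?_, fun φ hφ => ?_⟩
  · fin_cases i
    · exact hWl 1
    · exact (hWl 0).neg
    · exact hk2.locallyIntegrable one_le_two
  · have h1 := hprim 0 φ hφ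
    have h2 := hk1 φ hφ
    simp [distDeriv, vertical, integral_neg]
    linarith
  · have h1 := hprim 1 φ hφ
    have h2 := hk0 φ hφ
    simp [distDeriv, vertical]
    linarith
  · have h1 := hprim 2 φ hφ
    have h2 := sum_integral_superpose_zshift hωm hω2 hd
      (w := fun s => s / (2 * Real.pi * L) - 1 / 2) (by fun_prop)
      (by simpa using (isSuperposition_zPrim (L := L)).integrable) hφ
    rw [Fin.sum_univ_three] at h2
    have h3 : ∫ p, (ω p + (-1 : ℝ) • vertical (zMean fun p => ω p 2) p) 2 * φ p =
        (∫ p, ω p 2 * φ p) - ∫ p, zMean (fun p => ω p 2) p * φ p := by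
      rw [integral_add_smul_mul hd.locallyIntegrable (locallyIntegrable_vertical (hbl 2)) _ _ hφ]
      simp [vertical]
      ring
    rw [h3]
    simp only [zPrim] at h1
    simp [distDeriv, integral_neg, zPrim]
    simp at h1 h2
    linarith

lemma exists_hasCurl_fluctuation {m : ℝ} (hm : 1 < m) {ω : Omega L → Vec} (hωm : Measurable ω)
    (hω : MemY m ω) : ∃ u : Omega L → Vec, MemLp u 2 ∧
      HasCurl u (fun p => ω p + (-1 : ℝ) • vertical (zMean fun p => ω p 2) p) ∧
      eLpNorm u 2 volume ≤ 2 * (zPrimConst L + zMeanConst L) * l2mNorm m ω := by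
  have hωi : ∀ i, Measurable fun p => ω p i := fun i => by fun_prop
  have hω2 := hω.memL2m.1
  have hωi2 : ∀ i, MemLp (fun p => ω p i) 2 := memLp_euclidean_iff.1 hω2
  have hw := memLp_weighted_component hωm hω.memL2m.2
  have hb := fun i => memLp_weight_mul_zMean (hωi i) (hw i)
  have hbn : ∀ i, eLpNorm (fun p => weight m p * zMean (fun p => ω p i) p) 2 volume ≤
      zMeanConst L * l2mNorm m ω := fun i =>
    (eLpNorm_weight_mul_zMean_le m (hωi i)).trans
      (mul_le_mul_right (eLpNorm_weighted_component_le m ω i) _)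
  have hbm := fun i => measurable_zMean (hωi i)
  have hbi := fun i => (integrable_of_weighted hm (hb i)).1
  set b : Fin 3 → Omega L → ℝ := fun i => zMean fun p => ω p i with hbdef
  -- The averaged horizontal field turned by a right angle: its curl is the horizontal divergence of
  -- `⟨ω⟩`, which vanishes because `⟨ω_z⟩` does not depend on `z`.
  let F : Fin 2 → Omega L → ℝ := ![b 1, fun p => -b 0 p]
  have hFm : ∀ j, Measurable (F j) := by
    intro j
    fin_cases j
    · exact hbm 1
    · exact (hbm 0).neg
  have hFi : ∀ j, Integrable (F j) := by
    intro j
    fin_cases j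
    · exact hbi 1
    · exact (hbi 0).neg
  have hbz : ∀ i (p : Omega L) (t : ℝ), b i (p + translation L 2 t) = b i p := fun i =>
    zMean_add_translation _
  have hHm : Measurable fun p : Omega L => p.1 0 * F 0 p + p.1 1 * F 1 p := by
    have := hFm 0
    have := hFm 1
    fun_prop
  have hHn : eLpNorm (fun p : Omega L => p.1 0 * F 0 p + p.1 1 * F 1 p) 2 volume ≤
      2 * zMeanConst L * l2mNorm m ω := by
    have h1 : ∀ (j : Fin 2) (p : Omega L), |p.1 j| ≤ weight m p := fun j p =>
      (PiLp.norm_apply_le p.1 j).trans (radius_le_weight hm p)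
    have h2 : eLpNorm (fun p : Omega L => p.1 0 * F 0 p + p.1 1 * F 1 p) 2 volume ≤
        eLpNorm ((fun p => ‖weight m p * b 1 p‖) + fun p => ‖weight m p * b 0 p‖) 2 volume := by
      refine eLpNorm_mono fun p => (norm_add_le _ _).trans ?_
      rw [Pi.add_apply, Real.norm_of_nonneg (add_nonneg (norm_nonneg _) (norm_nonneg _))]
      simp only [norm_mul, Real.norm_of_nonneg (weight_pos m p).le]
      refine add_le_add (mul_le_mul_of_nonneg_right (h1 0 p) (norm_nonneg _)) ?_
      refine (mul_le_mul_of_nonneg_right (h1 1 p) (norm_nonneg _)).trans (le_of_eq ?_)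
      simp [F]
    refine h2.trans ((eLpNorm_add_le (hb 1).1.norm (hb 0).1.norm one_le_two).trans ?_)
    rw [eLpNorm_norm, eLpNorm_norm]
    exact (add_le_add (hbn 1) (hbn 0)).trans (le_of_eq (by ring))
  have hH2 : MemLp (fun p : Omega L => p.1 0 * F 0 p + p.1 1 * F 1 p) 2 :=
    ⟨hHm.aestronglyMeasurable, hHn.trans_lt (ENNReal.mul_lt_top
      (ENNReal.mul_lt_top ENNReal.ofNat_lt_top zMeanConst_lt_top) hω.memL2m.2)⟩
  have hcurl : ∀ φ : Omega L → ℝ, IsTest φ →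
      ∫ p, F 0 p * partialDeriv 1 φ p = ∫ p, F 1 p * partialDeriv 0 φ p := by
    intro φ hφ
    have h1 := sum_integral_superpose_zshift hωm hω2 hω.divFree
      (w := fun _ => 1 / (2 * Real.pi * L)) measurable_const (integrable_const _) hφ
    rw [Fin.sum_univ_three] at h1
    have h2 := integral_partialDeriv_of_invariant hφ (hbi 2).locallyIntegrable 2
      fun t p => hbz 2 p t
    have h3 : ∫ p, F 1 p * partialDeriv 0 φ p = -∫ p, b 0 p * partialDeriv 0 φ p := by
      simp [F, integral_neg]
    rw [h3]
    have h4 : (∫ p, b 0 p * partialDeriv 0 φ p) + (∫ p, b 1 p * partialDeriv 1 φ p) +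
        ∫ p, b 2 p * partialDeriv 2 φ p = 0 := h1
    have h5 : ∫ p, F 0 p * partialDeriv 1 φ p = ∫ p, b 1 p * partialDeriv 1 φ p := rfl
    linarith
  have hFz : ∀ j (p : Omega L) (t : ℝ), F j (p + translation L 2 t) = F j p := by
    intro j p t
    fin_cases j <;> simp [F, hbz]
  obtain ⟨k, hk2, hkn, hkz, hk⟩ := exists_potential hFm hFi hH2 hcurl hFz
  have hcurl' := hasCurl_fluctuation hωm hω2 hω.divFree hk2 hkz (fun φ hφ => hk φ hφ 0)
    (fun φ hφ => (hk φ hφ 1).trans (by simp [F, hbdef, integral_neg]))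
  have hWn : ∀ i, eLpNorm (zPrim fun p => ω p i) 2 volume ≤ zPrimConst L * l2mNorm m ω := fun i =>
    (isSuperposition_zPrim.eLpNorm_superpose_le (hωi i)).trans (mul_le_mul_right
      ((eLpNorm_component_le ω i 2).trans (eLpNorm_le_l2mNorm hm ω)) _)
  have hW2 := fun i => isSuperposition_zPrim.memLp_superpose (hωi i) (hωi2 i)
  have hu2 : MemLp (fun p => (!₂[zPrim (fun p => ω p 1) p, -zPrim (fun p => ω p 0) p, k p] : Vec)) 2 := by
    refine memLp_euclidean_iff.2 fun i => ?_
    fin_cases i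
    · exact hW2 1
    · exact (hW2 0).neg
    · exact hk2
  refine ⟨_, hu2, hcurl', (eLpNorm_le_sum_components hu2.1).trans ?_⟩
  have e0 : eLpNorm (fun p => -zPrim (fun p => ω p 0) p) 2 volume =
      eLpNorm (zPrim fun p => ω p 0) 2 volume := eLpNorm_neg (zPrim fun p => ω p 0) 2 volume
  calc _ = eLpNorm (zPrim fun p => ω p 1) 2 volume + eLpNorm (zPrim fun p => ω p 0) 2 volume +
        eLpNorm k 2 volume := by rw [← e0]; rfl
    _ ≤ _ := (add_le_add (add_le_add (hWn 1) (hWn 0)) (hkn.trans hHn)).trans (le_of_eq (by ring))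

/-- The norm of the circulation, as a linear form on `L²_m`. -/
noncomputable def circulationConst (L m : ℝ) [Fact (0 < L)] : ℝ≥0∞ :=
  ‖1 / (2 * Real.pi * L)‖ₑ * eLpNorm (fun p : Omega L => (weight m p)⁻¹) 2 volume

/-- The norm of the vorticity of the Lamb-Oseen vortex in `L²_m`. -/
noncomputable def gaussConst (L m : ℝ) [Fact (0 < L)] : ℝ≥0∞ :=
  eLpNorm (fun p : Omega L => weight m p * gauss (radius p)) 2 volume

lemma circulationConst_lt_top {m : ℝ} (hm : 1 < m) : circulationConst L m < ∞ :=
  ENNReal.mul_lt_top enorm_lt_top (memLp_inv_weight hm).2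

lemma gaussConst_lt_top {m : ℝ} (hm : 1 < m) : gaussConst L m < ∞ := (memLp_weight_mul_gauss hm).2

lemma enorm_circulation_le {m : ℝ} (hm : 1 < m) {ω : Omega L → Vec} (hωm : Measurable ω)
    (hω : MemY m ω) : ‖circulation ω‖ₑ ≤ circulationConst L m * l2mNorm m ω := by
  have h := (integrable_of_weighted hm (memLp_weighted_component hωm hω.memL2m.2 2)).2
  calc ‖circulation ω‖ₑ = ‖1 / (2 * Real.pi * L)‖ₑ * ‖∫ p, ω p 2‖ₑ := enorm_mul _ _
    _ ≤ ‖1 / (2 * Real.pi * L)‖ₑ *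
        (eLpNorm (fun p : Omega L => (weight m p)⁻¹) 2 volume * l2mNorm m ω) :=
      mul_le_mul_right (h.trans (mul_le_mul_right (eLpNorm_weighted_component_le m ω 2) _)) _
    _ = _ := (mul_assoc _ _ _).symm

lemma exists_hasCurl_mean {m : ℝ} (hm : 1 < m) {ω : Omega L → Vec} (hωm : Measurable ω)
    (hω : MemY m ω) : ∃ u : Omega L → Vec, MemLp u 2 ∧
      HasCurl u (vertical fun p => zMean (fun p => ω p 2) p - circulation ω * gauss (radius p)) ∧
      eLpNorm u 2 volume ≤ (1 + ENNReal.ofReal (1 / (m - 1))) *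
        (zMeanConst L + circulationConst L m * gaussConst L m) * l2mNorm m ω := by
  have hT : 0 < 2 * Real.pi * L := (fact_period_pos L).out
  have hω2m : Measurable fun p => ω p 2 := by fun_prop
  have hw := memLp_weighted_component hωm hω.memL2m.2 2
  have hb := memLp_weight_mul_zMean hω2m hw
  have hbn : eLpNorm (fun p => weight m p * zMean (fun p => ω p 2) p) 2 volume ≤
      zMeanConst L * l2mNorm m ω := (eLpNorm_weight_mul_zMean_le m hω2m).trans
    (mul_le_mul_right (eLpNorm_weighted_component_le m ω 2) _)
  have hhel : IsHelicalScalar fun p => ω p 2 := by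
    intro α
    filter_upwards [hω.helical.2.2 α] with p hp
    simpa [inner_euclidean, Fin.sum_univ_three, eZ] using hp
  -- Helicity of `ω_z` makes its vertical average radial, which permits the explicit azimuthal
  -- velocity.
  obtain ⟨Φ₀, hΦ₀, hΦ₀e⟩ := exists_radial (measurable_zMean hω2m) (zMean_add_translation _)
    (zMean_rigid hω2m hhel)
  set b := zMean fun p => ω p 2 with hbdef
  set a := circulation ω with ha
  have hΦ : Measurable fun r => Φ₀ r - a * gauss r := hΦ₀.sub (measurable_gauss.const_mul a)
  have hfe : (fun p => b p - a * gauss (radius p)) =ᵐ[volume]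
      fun p => Φ₀ (radius p) - a * gauss (radius p) := by
    filter_upwards [hΦ₀e] with p hp
    rw [hp]
  have hgw := memLp_weight_mul_gauss (L := L) hm
  have hwe : (fun p => weight m p * (Φ₀ (radius p) - a * gauss (radius p))) =ᵐ[volume]
      (fun p => weight m p * b p) - a • fun p => weight m p * gauss (radius p) := by
    filter_upwards [hfe] with p hp
    rw [← hp]
    simp
    ring
  have hfw : MemLp (fun p : Omega L => weight m p * (Φ₀ (radius p) - a * gauss (radius p))) 2 :=
    (memLp_congr_ae hwe).2 (hb.sub (hgw.const_smul a))
  have hfn : eLpNorm (fun p : Omega L => weight m p * (Φ₀ (radius p) - a * gauss (radius p))) 2 volume ≤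
      (zMeanConst L + circulationConst L m * gaussConst L m) * l2mNorm m ω := by
    rw [eLpNorm_congr_ae hwe, add_mul]
    refine (eLpNorm_sub_le hb.1 (hgw.1.const_smul a) one_le_two).trans (add_le_add hbn ?_)
    rw [eLpNorm_const_smul]
    refine (mul_le_mul_left (enorm_circulation_le hm hωm hω) _).trans (le_of_eq ?_)
    rw [gaussConst]
    simp only [weight]
    ring
  -- Averaging preserves the integral, so the choice of `a` gives exact cancellation.
  have h0 : ∫ p : Omega L, (Φ₀ (radius p) - a * gauss (radius p)) = 0 := by
    rw [← integral_congr_ae hfe, integral_sub (integrable_of_weighted hm hb).1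
      (integrable_gauss.const_mul a), integral_const_mul, integral_gauss,
      (integral_zMean hω2m (integrable_of_weighted hm hw).1).2, ha, circulation]
    have hL := (Fact.out : 0 < L).ne'
    field_simp
    ring
  have hf : Measurable fun p : Omega L => Φ₀ (radius p) - a * gauss (radius p) :=
    hΦ.comp measurable_radius
  have hf2 := memLp_of_weighted hm hf hfw
  have hz : ∀ (p : Omega L) (t : ℝ), Φ₀ (radius (p + translation L 2 t)) -
      a * gauss (radius (p + translation L 2 t)) = Φ₀ (radius p) - a * gauss (radius p) := by
    intro p t
    have e1 : (p + translation L 2 t).1 = p.1 := by simp [translation]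
    simp only [radius, e1]
  have hc := hasCurl_azimuthal hf hf2 hz
  have hn := (eLpNorm_azimuthal_le hm hΦ hfw h0).trans (mul_le_mul_right hfn _)
  refine ⟨_, ⟨hc.locallyIntegrable.aestronglyMeasurable, hn.trans_lt ?_⟩, hc.congr_right ?_,
    hn.trans (le_of_eq (by ring))⟩
  · exact ENNReal.mul_lt_top (by simp [ENNReal.add_lt_top]) (ENNReal.mul_lt_top (by
      simp [ENNReal.add_lt_top, zMeanConst_lt_top,
        ENNReal.mul_lt_top (circulationConst_lt_top hm) (gaussConst_lt_top hm)]) hω.memL2m.2)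
  · filter_upwards [hfe] with p hp
    simp only [vertical, hp]

end HelicalOseen

namespace HelicalOseen

variable {L : ℝ} [Fact (0 < L)]

/-! ### The helical Biot-Savart velocity -/

lemma IsDivFree.congr {v w : Omega L → Vec} (h : IsDivFree v) (hvw : v =ᵐ[volume] w) :
    IsDivFree w := by
  have hl : LocallyIntegrable w := by
    intro x
    obtain ⟨s, hs, hi⟩ := h.locallyIntegrable x
    exact ⟨s, hs, hi.congr (ae_restrict_of_ae hvw)⟩
  refine (isDivFree_iff hl).2 fun φ hφ => ?_
  rw [← (isDivFree_iff h.locallyIntegrable).1 h φ hφ]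
  refine Finset.sum_congr rfl fun i _ => integral_congr_ae ?_
  filter_upwards [hvw] with p hp
  rw [hp]

lemma l2mNorm_congr {m : ℝ} {v w : Omega L → Vec} (hvw : v =ᵐ[volume] w) :
    l2mNorm m v = l2mNorm m w := by
  refine eLpNorm_congr_ae ?_
  filter_upwards [hvw] with p hp
  simp only [weighted, hp]

lemma circulation_congr {v w : Omega L → Vec} (hvw : v =ᵐ[volume] w) :
    circulation v = circulation w := by
  unfold circulation
  congr 1
  refine integral_congr_ae ?_
  filter_upwards [hvw] with p hp
  rw [hp]

lemma MemY.congr {m : ℝ} {v w : Omega L → Vec} (h : MemY m v) (hvw : v =ᵐ[volume] w) :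
    MemY m w where
  memL2m := ⟨(memLp_congr_ae hvw).1 h.memL2m.1, (l2mNorm_congr hvw) ▸ h.memL2m.2⟩
  divFree := h.divFree.congr hvw
  helical := isHelical_congr hvw h.helical

/-- The constant in the `H¹` estimate. -/
noncomputable def velocityConst (L m : ℝ) [Fact (0 < L)] : ℝ≥0∞ :=
  2 * (zPrimConst L + zMeanConst L) + (1 + ENNReal.ofReal (1 / (m - 1))) *
    (zMeanConst L + circulationConst L m * gaussConst L m) +
      (1 + circulationConst L m * gaussConst L m)

lemma velocityConst_lt_top {m : ℝ} (hm : 1 < m) : velocityConst L m < ∞ := by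
  have h1 := ENNReal.mul_lt_top (circulationConst_lt_top (L := L) hm) (gaussConst_lt_top (L := L) hm)
  refine ENNReal.add_lt_top.2 ⟨ENNReal.add_lt_top.2 ⟨?_, ?_⟩, ?_⟩
  · exact ENNReal.mul_lt_top ENNReal.ofNat_lt_top
      (ENNReal.add_lt_top.2 ⟨zPrimConst_lt_top, zMeanConst_lt_top⟩)
  · exact ENNReal.mul_lt_top (by simp [ENNReal.add_lt_top])
      (ENNReal.add_lt_top.2 ⟨zMeanConst_lt_top, h1⟩)
  · exact ENNReal.add_lt_top.2 ⟨ENNReal.one_lt_top, h1⟩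

lemma norm_vertical (f : Omega L → ℝ) (p : Omega L) : ‖vertical f p‖ = ‖f p‖ := by
  rw [← sq_eq_sq₀ (norm_nonneg _) (norm_nonneg _), EuclideanSpace.norm_sq_eq]
  simp [Fin.sum_univ_three, vertical]

/-- In the sum of the fluctuation field and the mean field the two contributions of `⟨ω_z⟩ e_z`
cancel, leaving the curl `ω - a g e_z`, which is helical; `exists_memH_of_curl` then corrects the
sum to an element of `H`. -/
lemma exists_memH_of_measurable {m : ℝ} (hm : 1 < m) {ω : Omega L → Vec} (hωm : Measurable ω)
    (hω : MemY m ω) : ∃ v : Omega L → Vec, MemH v ∧ MemLp v 6 ∧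
      HasCurl v (fun p => ω p + (-circulation ω) • vertical (fun p => gauss (radius p)) p) ∧
      h1Norm v ≤ 2 * velocityConst L m * l2mNorm m ω := by
  obtain ⟨u₁, hu₁, hc₁, hn₁⟩ := exists_hasCurl_fluctuation hm hωm hω
  obtain ⟨u₂, hu₂, hc₂, hn₂⟩ := exists_hasCurl_mean hm hωm hω
  have hgv : MemLp (vertical fun p : Omega L => gauss (radius p)) 2 := by
    refine memLp_euclidean_iff.2 fun i => ?_
    fin_cases i
    · exact MemLp.zero
    · exact MemLp.zero
    · exact memLp_gauss one_le_two ENNReal.ofNat_ne_top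
  have hgn : eLpNorm (vertical fun p : Omega L => gauss (radius p)) 2 volume ≤ gaussConst L m := by
    rw [eLpNorm_congr_norm_ae (.of_forall fun p => norm_vertical _ p)]
    exact eLpNorm_le_of_weighted hm _
  have hcurl : HasCurl (fun p => u₁ p + (1 : ℝ) • u₂ p)
      (fun p => ω p + (-circulation ω) • vertical (fun p => gauss (radius p)) p) := by
    refine (hc₁.add_smul hc₂ 1).congr_right (.of_forall fun p => ?_)
    ext i
    fin_cases i <;> simp [vertical]
    ring
  have hu : MemLp (fun p => u₁ p + (1 : ℝ) • u₂ p) 2 := hu₁.add (hu₂.const_smul (1 : ℝ))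
  have hu_le : eLpNorm (fun p => u₁ p + (1 : ℝ) • u₂ p) 2 volume ≤
      (2 * (zPrimConst L + zMeanConst L) + (1 + ENNReal.ofReal (1 / (m - 1))) *
        (zMeanConst L + circulationConst L m * gaussConst L m)) * l2mNorm m ω := by
    simp only [one_smul]
    rw [add_mul]
    exact (eLpNorm_add_le hu₁.1 hu₂.1 one_le_two).trans (add_le_add hn₁ hn₂)
  have hω2 := hω.memL2m.1
  have hcω : MemLp (fun p => ω p + (-circulation ω) • vertical (fun p => gauss (radius p)) p) 2 :=
    hω2.add (hgv.const_smul (-circulation ω))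
  have hcω_le : eLpNorm (fun p => ω p + (-circulation ω) • vertical (fun p => gauss (radius p)) p) 2
      volume ≤ (1 + circulationConst L m * gaussConst L m) * l2mNorm m ω := by
    refine (eLpNorm_add_le hω2.1 (hgv.const_smul (-circulation ω)).1 one_le_two).trans ?_
    rw [add_mul, one_mul]
    refine add_le_add (eLpNorm_le_l2mNorm hm ω) ?_
    have e : eLpNorm (-circulation ω • vertical fun p : Omega L => gauss (radius p)) 2 volume =
        ‖-circulation ω‖ₑ * eLpNorm (vertical fun p : Omega L => gauss (radius p)) 2 volume :=
      eLpNorm_const_smul _ _ _ _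
    refine e.le.trans ?_
    rw [enorm_neg]
    exact (mul_le_mul' (enorm_circulation_le hm hωm hω) hgn).trans (le_of_eq (by ring))
  have hhel : IsHelical fun p => ω p + (-circulation ω) • vertical (fun p => gauss (radius p)) p :=
    hω.helical.add ((isHelical_vertical gauss).const_smul _)
  obtain ⟨v, hvH, hv6, hvc, hvn⟩ := exists_memH_of_curl hu hcurl hcω hhel
  refine ⟨v, hvH, hv6, hvc, hvn.trans ?_⟩
  refine (mul_le_mul_right (add_le_add hu_le hcω_le) _).trans (le_of_eq ?_)
  rw [velocityConst]
  ring

/-- The superposition estimates are stated for measurable functions, so `ω` is replaced by a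
measurable representative. -/
lemma exists_memH {m : ℝ} (hm : 1 < m) {ω : Omega L → Vec} (hω : MemY m ω) :
    ∃ v : Omega L → Vec, MemH v ∧ MemLp v 6 ∧
      HasCurl v (fun p => ω p + (-circulation ω) • vertical (fun p => gauss (radius p)) p) ∧
      h1Norm v ≤ 2 * velocityConst L m * l2mNorm m ω := by
  have hae := hω.memL2m.1.1.ae_eq_mk
  obtain ⟨v, hvH, hv6, hvc, hvn⟩ := exists_memH_of_measurable hm
    hω.memL2m.1.1.stronglyMeasurable_mk.measurable (hω.congr hae)
  refine ⟨v, hvH, hv6, hvc.congr_right ?_, ?_⟩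
  · filter_upwards [hae] with p hp
    rw [← hp, circulation_congr hae.symm]
  · rwa [l2mNorm_congr hae]

lemma holderConjugate_six : ENNReal.HolderConjugate 6 (6 / 5) := by
  rw [ENNReal.holderConjugate_iff]
  rw [ENNReal.inv_div (by simp) (by simp), ← one_div, ENNReal.div_add_div_same]
  norm_num
  exact ENNReal.div_self (by simp) (by simp)

end HelicalOseen

theorem mainTheorem6 (L : ℝ) [Fact (0 < L)] (m : ℝ) (hm : 1 < m) :
    ∃ C : ℝ, 0 < C ∧ ∀ ω : Omega L → Vec, MemY m ω →
      ∃ u : Omega L → Vec, IsBiotSavart ω u ∧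
        (∀ u' : Omega L → Vec, IsBiotSavart ω u' → u' =ᵐ[volume] u) ∧
        (∃ v : Omega L → Vec, MemH v ∧
          (u =ᵐ[volume] fun p => circulation ω • oseenVelocity 0 p + v p) ∧
          h1Norm v ≤ ENNReal.ofReal C * l2mNorm m ω) ∧
        MemX (circulation ω) u := by
  have hfin : 2 * velocityConst L m < ∞ :=
    ENNReal.mul_lt_top ENNReal.ofNat_lt_top (velocityConst_lt_top hm)
  -- The added `1` only guarantees positivity.
  refine ⟨(2 * velocityConst L m).toReal + 1, by positivity, fun ω hω => ?_⟩
  obtain ⟨v, hvH, hv6, hvc, hvn⟩ := exists_memH hm hω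
  set a := circulation ω
  have hu : IsBiotSavart ω fun p => v p + a • oseenVelocity 0 p :=
    { helical := hvH.helical.add (isHelical_oseenVelocity.const_smul a)
      memL6 := hv6.add (memLp_oseenVelocity.const_smul a)
      divFree := hvH.divFree.add_smul isDivFree_oseenVelocity a
      curl := (hvc.add_smul hasCurl_oseenVelocity a).congr_right (.of_forall fun p => by simp) }
  refine ⟨_, hu, fun u' hu' => ?_, ⟨v, hvH, .of_forall fun p => add_comm _ _, hvn.trans ?_⟩,
    v, hvH, .of_forall fun p => rfl⟩
  · have := holderConjugate_six
    -- Liouville's theorem with `c = 0` in `L⁶`; test functions are measured in the dual exponent `6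
    -- / 5`.
    exact ae_eq_of_curl_eq (6 / 5) (by simp) hu'.memL6 hu.memL6 hu'.divFree hu.divFree hu'.curl
      hu.curl
  · refine mul_le_mul_left ?_ _
    rw [ENNReal.le_ofReal_iff_toReal_le hfin.ne (by positivity)]
    linarith
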